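/- Let $n\ge 4$ and let $(M^n,g)$ be a connected smooth Riemannian manifold with Riemann tensor $R_{ijkl}$ (signs such that $R_{ijij}>0$ on round spheres), Ricci tensor $R_{ij}=\sum_k R_{ikjk}$ and scalar curvature $R$; components are taken in local orthonormal frames, repeated indices are summed, and indices after a comma denote covariant derivatives. Suppose that * $(M,g,f)$ is a vacuum static space: $f$ is a smooth function on $M$, not identically zero, with $\operatorname{Hess} f=f\left(\operatorname{Ric}-\frac{R}{n-1}\,g\right)$; * $(M,g)$ has harmonic curvature: $R_{lijk,l}=0$. Let $U\subseteq M$ be open (for instance $U=M$), and suppose that at every point of $U$ at which $\nabla f\ne 0$ and near which the number of distinct eigenvalues of the Ricci tensor is constant, the Ricci eigenvalues $\lambda_2,\dots,\lambda_n$ other than the one belonging to $\nabla f$ are all equal, that is, all eigenvectors of the Ricci tensor orthogonal to $\nabla f$ have the same eigenvalue. Then: 1. Every point of $U$ at which $\nabla f\neq 0$ has a neighbourhood that is diffeomorphic to a product $(a,b)\times N$ of an open interval and an $(n-1)$-dimensional manifold $N$ in such a way that $$g=ds^2+h(s)^2\,\tilde g ,$$ where $s$ is the coordinate on $(a,b)$,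 $h$ is a smooth positive function on $(a,b)$, and $\tilde g$ is an Einstein metric on $N$ ($\operatorname{Ric}_{\tilde g}=c\,\tilde g$ with a constant $c$). 2. The $D$-tensor $$D_{ijk}=\frac{n-1}{n-2}\left(R_{ik}f_j-R_{ij}f_k\right)+\frac{R}{n-2}\left(f_k\delta_{ij}-f_j\delta_{ik}\right)+\frac{1}{n-2}\,f_l\left(R_{lj}\delta_{ik}-R_{lk}\delta_{ij}\right)$$ vanishes on $U$. 3. The Bach tensor $$B_{ij}=\frac{1}{n-3}\,W_{ikjl,kl}+\frac{1}{n-2}\,R_{kl}W_{ikjl}$$ vanishes on $U$, where $W_{ijkl}=R_{ijkl}-\frac{1}{n-2}\left(A_{ik}\delta_{jl}+A_{jl}\delta_{ik}-A_{il}\delta_{jk}-A_{jk}\delta_{il}\right)$ is the Weyl tensor and $A_{ij}=R_{ij}-\frac{R}{2(n-1)}\delta_{ij}$. -/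

import Mathlib

open scoped Manifold ContDiff Topology

noncomputable section

namespace VacuumStatic

/-! ## Tensor calculus of a metric in local coordinates

A metric on an open subset of `ℝⁿ` is given by its matrix of coefficients `G u i j = g_ij(u)`.
All tensors below are given by their (covariant) components in the coordinate frame; wherever an
orthonormal frame would sum over a repeated index, the sum is taken with the inverse matrix `g^ij`.
The definitions are used only at points of an open set on which `G` is smooth, symmetric and
positive definite. -/

/-- Coordinate space `ℝⁿ`. -/
abbrev Coord (n : ℕ) : Type := EuclideanSpace ℝ (Fin n)

/-- A field of symmetric matrices (the coefficients of a metric) on coordinate space. -/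
abbrev MetricCoeff (n : ℕ) : Type := Coord n → Matrix (Fin n) (Fin n) ℝ

/-- Components of a covariant tensor field of rank `r` on coordinate space. -/
abbrev CovTensor (n r : ℕ) : Type := Coord n → (Fin r → Fin n) → ℝ

/-- `g` is a smooth Riemannian metric on the set `V` (meant to be open). -/
def IsMetricOn {n : ℕ} (G : MetricCoeff n) (V : Set (Coord n)) : Prop :=
  (∀ i j, ContDiffOn ℝ ∞ (fun u => G u i j) V) ∧ ∀ u ∈ V, (G u).PosDef

/-- The partial derivative `∂_k F` at `u`. -/
def pd {n : ℕ} (k : Fin n) (F : Coord n → ℝ) (u : Coord n) : ℝ :=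
  fderiv ℝ F u (EuclideanSpace.single k 1)

/-- Christoffel symbols `Γ^k_ij = ½ g^kl (∂_i g_jl + ∂_j g_il - ∂_l g_ij)`. -/
def christoffel {n : ℕ} (G : MetricCoeff n) (k i j : Fin n) (u : Coord n) : ℝ :=
  (1 / 2) * ∑ l, (G u)⁻¹ k l *
    (pd i (fun v => G v j l) u + pd j (fun v => G v i l) u - pd l (fun v => G v i j) u)

/-- The covariant derivative of a covariant tensor field; the *first* index of the result is the
direction of differentiation:
`(∇T)_{k a₁ … a_r} = ∂_k T_{a₁ … a_r} - ∑_s Γ^p_{k a_s} T_{a₁ … p … a_r}`. -/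
def covDeriv {n r : ℕ} (G : MetricCoeff n) (T : CovTensor n r) : CovTensor n (r + 1) :=
  fun u a =>
    pd (a 0) (fun v => T v (Fin.tail a)) u -
      ∑ s : Fin r, ∑ p : Fin n,
        christoffel G p (a 0) (Fin.tail a s) u * T u (Function.update (Fin.tail a) s p)

/-- The component `R^l_{kij}` of `R(∂_i, ∂_j) ∂_k = ∇_i ∇_j ∂_k - ∇_j ∇_i ∂_k` along `∂_l`. -/
def curvOp {n : ℕ} (G : MetricCoeff n) (l k i j : Fin n) (u : Coord n) : ℝ :=
  pd i (christoffel G l j k) u - pd j (christoffel G l i k) u +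
    ∑ p, (christoffel G l i p u * christoffel G p j k u -
      christoffel G l j p u * christoffel G p i k u)

/-- The Riemann tensor `R_ijkl = ⟨R(∂_i, ∂_j) ∂_l, ∂_k⟩`, so that `R_ijij > 0` on round spheres. -/
def riem {n : ℕ} (G : MetricCoeff n) : CovTensor n 4 :=
  fun u a => ∑ p, G u (a 2) p * curvOp G p (a 3) (a 0) (a 1) u

/-- The Ricci tensor `R_ij = g^kl R_ikjl`. -/
def ric {n : ℕ} (G : MetricCoeff n) (u : Coord n) (i j : Fin n) : ℝ :=
  ∑ k, ∑ l, (G u)⁻¹ k l * riem G u ![i, k, j, l]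

/-- The scalar curvature `R = g^ij R_ij`. -/
def scal {n : ℕ} (G : MetricCoeff n) (u : Coord n) : ℝ :=
  ∑ i, ∑ j, (G u)⁻¹ i j * ric G u i j

/-- The Hessian `f_{i,j} = ∂_i ∂_j f - Γ^k_ij ∂_k f`. -/
def hess {n : ℕ} (G : MetricCoeff n) (f : Coord n → ℝ) (u : Coord n) (i j : Fin n) : ℝ :=
  pd i (pd j f) u - ∑ k, christoffel G k i j u * pd k f u

/-- The Schouten tensor, normalised as `A_ij = R_ij - R / (2(n-1)) g_ij`. -/
def schouten {n : ℕ} (G : MetricCoeff n) (u : Coord n) (i j : Fin n) : ℝ :=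
  ric G u i j - scal G u / (2 * ((n : ℝ) - 1)) * G u i j

/-- The Weyl tensor
`W_ijkl = R_ijkl - (A_ik g_jl + A_jl g_ik - A_il g_jk - A_jk g_il) / (n-2)`. -/
def weyl {n : ℕ} (G : MetricCoeff n) : CovTensor n 4 :=
  fun u a =>
    riem G u a - 1 / ((n : ℝ) - 2) *
      (schouten G u (a 0) (a 2) * G u (a 1) (a 3) + schouten G u (a 1) (a 3) * G u (a 0) (a 2) -
        schouten G u (a 0) (a 3) * G u (a 1) (a 2) - schouten G u (a 1) (a 2) * G u (a 0) (a 3))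

/-- The divergence `∇^l R_lijk` of the Riemann tensor. -/
def divRiem {n : ℕ} (G : MetricCoeff n) (u : Coord n) (i j k : Fin n) : ℝ :=
  ∑ l, ∑ m, (G u)⁻¹ l m * covDeriv G (riem G) u ![m, l, i, j, k]

/-- The Bach tensor `B_ij = W_{ikjl,kl} / (n-3) + R_kl W_ikjl / (n-2)` (indices `k`, `l` contracted
with the metric; after the comma the derivative in direction `k` is taken first). -/
def bach {n : ℕ} (G : MetricCoeff n) (u : Coord n) (i j : Fin n) : ℝ :=
  1 / ((n : ℝ) - 3) *
      (∑ k, ∑ l, ∑ p, ∑ q, (G u)⁻¹ k p * (G u)⁻¹ l q *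
        covDeriv G (covDeriv G (weyl G)) u ![q, p, i, k, j, l]) +
    1 / ((n : ℝ) - 2) *
      (∑ k, ∑ l, ∑ p, ∑ q, (G u)⁻¹ k p * (G u)⁻¹ l q * ric G u p q * weyl G u ![i, k, j, l])

/-- The tensor
`D_ijk = (n-1)/(n-2) (R_ik f_j - R_ij f_k) + R/(n-2) (f_k g_ij - f_j g_ik)
  + 1/(n-2) f^l (R_lj g_ik - R_lk g_ij)`. -/
def dTensor {n : ℕ} (G : MetricCoeff n) (f : Coord n → ℝ) (u : Coord n) (i j k : Fin n) : ℝ :=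
  ((n : ℝ) - 1) / ((n : ℝ) - 2) * (ric G u i k * pd j f u - ric G u i j * pd k f u) +
    scal G u / ((n : ℝ) - 2) * (pd k f u * G u i j - pd j f u * G u i k) +
    1 / ((n : ℝ) - 2) *
      ∑ l, ∑ m, (G u)⁻¹ l m * pd m f u * (ric G u l j * G u i k - ric G u l k * G u i j)

/-- `X` is an eigenvector of the Ricci tensor (relative to the metric) with eigenvalue `c`. -/
def IsRicciEigenvector {n : ℕ} (G : MetricCoeff n) (u : Coord n) (c : ℝ) (X : Fin n → ℝ) : Prop :=
  X ≠ 0 ∧ ∀ j, ∑ i, ric G u i j * X i = c * ∑ i, G u i j * X i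

/-- The number of distinct eigenvalues of the Ricci tensor at a point. -/
def ricciEigenvalueCount {n : ℕ} (G : MetricCoeff n) (u : Coord n) : ℕ :=
  {c : ℝ | ∃ X, IsRicciEigenvector G u c X}.ncard

/-- The number of distinct Ricci eigenvalues is constant in a neighbourhood of the point. -/
def IsRicciRegularAt {n : ℕ} (G : MetricCoeff n) (u : Coord n) : Prop :=
  ∀ᶠ v in 𝓝 u, ricciEigenvalueCount G v = ricciEigenvalueCount G u

/-- The Ricci eigenvalues belonging to directions orthogonal to `∇f` are all equal: any two
eigenvectors of the Ricci tensor that are orthogonal to `∇f` have the same eigenvalue.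
(Orthogonality `g(X, ∇f) = 0` means `df(X) = 0`.) -/
def TransverseRicciEigenvaluesEqual {n : ℕ} (G : MetricCoeff n) (f : Coord n → ℝ) (u : Coord n) :
    Prop :=
  ∀ (X Y : Fin n → ℝ) (c d : ℝ),
    IsRicciEigenvector G u c X → IsRicciEigenvector G u d Y →
    ∑ i, X i * pd i f u = 0 → ∑ i, Y i * pd i f u = 0 → c = d

/-- The metric `G` is Einstein on `V`: `Ric = c g` with a constant `c`. -/
def IsEinsteinOn {n : ℕ} (G : MetricCoeff n) (V : Set (Coord n)) : Prop :=
  ∃ c : ℝ, ∀ u ∈ V, ∀ i j, ric G u i j = c * G u i j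

/-- The last `m` coordinates of a point of `ℝ^{m+1}`. -/
def dropFirst {m : ℕ} (u : Coord (m + 1)) : Coord m :=
  WithLp.toLp 2 (fun a : Fin m => u a.succ)

/-! ## Riemannian manifolds

A tensor on a manifold is handled through its components in all charts of the maximal smooth
atlas; by tensoriality an equation between tensors holds at a point in one chart around it if and
only if it holds there in all of them. -/

section Manifold

variable {n : ℕ} {M : Type*} [TopologicalSpace M] [ChartedSpace (Coord n) M]
  [IsManifold (𝓡 n) ∞ M]

/-- Smooth Riemannian metrics on a smooth `n`-manifold. -/
abbrev Metric (n : ℕ) (M : Type*) [TopologicalSpace M] [ChartedSpace (Coord n) M]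
    [IsManifold (𝓡 n) ∞ M] : Type _ :=
  Bundle.ContMDiffRiemannianMetric (𝓡 n) ∞ (Coord n) (fun x : M => TangentSpace (𝓡 n) x)

/-- The coordinate vector field `∂_i` of a chart, at the point with coordinates `u`. -/
def coordVector (φ : OpenPartialHomeomorph M (Coord n)) (u : Coord n) (i : Fin n) :
    TangentSpace (𝓡 n) (φ.symm u) :=
  mfderiv (𝓡 n) (𝓡 n) φ.symm u (EuclideanSpace.single i (1 : ℝ) : Coord n)

/-- The coefficients `g_ij = g(∂_i, ∂_j)` of a Riemannian metric in a chart. -/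
def coeff (g : Metric n M) (φ : OpenPartialHomeomorph M (Coord n)) : MetricCoeff n :=
  fun u => Matrix.of fun i j => g.inner (φ.symm u) (coordVector φ u i) (coordVector φ u j)

/-- The coordinate expression of a function on the manifold. -/
def inChart (f : M → ℝ) (φ : OpenPartialHomeomorph M (Coord n)) : Coord n → ℝ :=
  fun u => f (φ.symm u)

/-- `(M, g, f)` is a vacuum static space: `f` is smooth, not identically zero, and
`Hess f = f (Ric - R/(n-1) g)`. -/
def IsVacuumStatic (g : Metric n M) (f : M → ℝ) : Prop :=
  ContMDiff (𝓡 n) 𝓘(ℝ, ℝ) ∞ f ∧ (∃ x, f x ≠ 0) ∧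
    ∀ φ ∈ IsManifold.maximalAtlas (𝓡 n) ∞ M, ∀ u ∈ φ.target, ∀ i j,
      hess (coeff g φ) (inChart f φ) u i j =
        inChart f φ u * (ric (coeff g φ) u i j -
          scal (coeff g φ) u / ((n : ℝ) - 1) * coeff g φ u i j)

/-- `(M, g)` has harmonic curvature: the Riemann tensor is divergence free. -/
def HasHarmonicCurvature (g : Metric n M) : Prop :=
  ∀ φ ∈ IsManifold.maximalAtlas (𝓡 n) ∞ M, ∀ u ∈ φ.target, ∀ i j k,
    divRiem (coeff g φ) u i j k = 0

/-- On `U`, at all points where `∇f ≠ 0` and near which the number of distinct Ricci eigenvalues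
is constant, the Ricci eigenvalues other than the one belonging to `∇f` are equal. -/
def RicciEigenvaluesEqualOn (g : Metric n M) (f : M → ℝ) (U : Set M) : Prop :=
  ∀ φ ∈ IsManifold.maximalAtlas (𝓡 n) ∞ M, ∀ u ∈ φ.target, φ.symm u ∈ U →
    mfderiv (𝓡 n) 𝓘(ℝ, ℝ) f (φ.symm u) ≠ 0 → IsRicciRegularAt (coeff g φ) u →
    TransverseRicciEigenvaluesEqual (coeff g φ) (inChart f φ) u

/-- The `D`-tensor of `(M, g, f)` vanishes on `U`. -/
def IsDFlatOn (g : Metric n M) (f : M → ℝ) (U : Set M) : Prop :=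
  ∀ φ ∈ IsManifold.maximalAtlas (𝓡 n) ∞ M, ∀ u ∈ φ.target, φ.symm u ∈ U → ∀ i j k,
    dTensor (coeff g φ) (inChart f φ) u i j k = 0

/-- The Bach tensor of `(M, g)` vanishes on `U`. -/
def IsBachFlatOn (g : Metric n M) (U : Set M) : Prop :=
  ∀ φ ∈ IsManifold.maximalAtlas (𝓡 n) ∞ M, ∀ u ∈ φ.target, φ.symm u ∈ U → ∀ i j,
    bach (coeff g φ) u i j = 0

end Manifold

/-- Near `p`, the metric is a warped product `g = ds² + h(s)² g̃` over an interval with Einstein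
fibre: there is a smooth chart around `p` with image `(a, b) × V`, `V` open in `ℝ^m`, in which
`g_00 = 1`, `g_0a = 0` and `g_ab(s, y) = h(s)² g̃_ab(y)`, with `h` smooth and positive and `g̃` an
Einstein metric on `V`. -/
def IsWarpedProductEinsteinNear {m : ℕ} {M : Type*} [TopologicalSpace M]
    [ChartedSpace (Coord (m + 1)) M] [IsManifold (𝓡 (m + 1)) ∞ M]
    (g : Metric (m + 1) M) (p : M) : Prop :=
  ∃ φ ∈ IsManifold.maximalAtlas (𝓡 (m + 1)) ∞ M, p ∈ φ.source ∧
    ∃ (a b : ℝ) (V : Set (Coord m)) (h : ℝ → ℝ) (γ : MetricCoeff m),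
      IsOpen V ∧ φ.target = {u | u 0 ∈ Set.Ioo a b ∧ dropFirst u ∈ V} ∧
      ContDiffOn ℝ ∞ h (Set.Ioo a b) ∧ (∀ s ∈ Set.Ioo a b, 0 < h s) ∧
      IsMetricOn γ V ∧ IsEinsteinOn γ V ∧
      ∀ u ∈ φ.target, coeff g φ u 0 0 = 1 ∧ ∀ i j : Fin m,
        coeff g φ u 0 i.succ = 0 ∧ coeff g φ u i.succ 0 = 0 ∧
        coeff g φ u i.succ j.succ = h (u 0) ^ 2 * γ (dropFirst u) i j

end VacuumStatic

end

/-!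
Let `(M, g, f)` be a vacuum static space with harmonic curvature, of dimension `n = m + 1 ≥ 4`.
Everything rests on the formula `D_ijk = W_jkil f_l`. Harmonic curvature makes the Ricci tensor a
Codazzi tensor and the scalar curvature `R` locally constant (`nablaRic_codazzi`,
`pd_scal_eq_zero`), so commuting third derivatives of `f` gives
`R(·,·)∇f` in terms of `Ric` (`IsStaticOn.riem_grad`), hence the formula
(`IsStaticOn.weyl_grad`). One more contraction with `∇f`, which gives zero by antisymmetry, shows
that `∇f` is a Ricci eigenvector (`IsStaticOn.exists_ric_grad`).

*The `D`-tensor.* Where `∇f ≠ 0`, the tensor `D` vanishes if and only if all Ricci eigenvalues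
orthogonal to `∇f` coincide, that is, `Ric = a g + b df ⊗ df`
(`dTensor_eq_zero_of_quasiEinstein`, `IsStaticOn.isRicciQuasiEinsteinAt_of_dTensor`). The hypothesis
gives this only at points near which the number of Ricci eigenvalues is constant. That number is
lower semicontinuous (`eventually_le_ricciEigenvalueCount`), so such points are dense, and `D = 0`
follows on all of `U` by continuity (`IsStaticOn.dTensor_eq_zero`).

*The warped product.* Near a point with `∇f ≠ 0`, the function `|∇f|²` is a function of `f`, since
`d|∇f|² = 2 Hess f(∇f, ·)` is a multiple of `df`. Hence `s = ∫ df / |∇f|` is a function with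
`|∇s| = 1`, and a flow box for `∇s` gives coordinates in which `g_00 = 1`, `g_0a = 0` and `f` depends
on the first coordinate only (`exists_flowBox`, `IsStaticOn.exists_adapted`). The flow box needs
smooth dependence of integral curves on the initial point, which is obtained from the inverse
function theorem in a space of continuous curves (`exists_smooth_flow`). In these coordinates
`Hess f` restricted to the slices is `½ ∂_0 g_ab f'`, so that `Ric = a g + b df ⊗ df` and the static
equation turn into `∂_0 g_ab = 2 ρ g_ab`, where `ρ` depends on the first coordinate only because
`f` and `R` do. Integration gives `g_ab = h² γ_ab` with `h' / h = ρ`. The traced Gauss equation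
`Ric(γ) = Ric + (ρ' + m ρ²) γ` on a slice where `f ≠ 0` shows that `γ` is Einstein
(`IsAdaptedOn.ric_slice`, `IsAdaptedOn.exists_warpedProduct`).

*The Bach tensor.* Harmonic curvature also makes the Weyl tensor divergence free, so only the term
`R_kl W_ikjl` remains (`divdiv_weyl_eq_zero`). Where `∇f ≠ 0` one has `Ric = a g + b df ⊗ df`; the
first part contributes a trace of `W`, the second a contraction with `∇f`, which is `D = 0`. By
continuity the term vanishes on the closure of `{∇f ≠ 0}`. On the complement of this closure `f` is
locally constant; it is not zero there by unique continuation for the static equation on the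
connected manifold (`IsVacuumStatic.mfderiv_ne_zero`), so that the static equation and its trace
force `Ric = 0` (`IsStaticOn.bach_eq_zero`).

All computations take place in coordinates; the last part transfers them to the charts of `M`.
-/

noncomputable section

namespace VacuumStatic

/-! ### Partial derivatives -/

section PartialDerivatives

variable {n : ℕ} {V : Set (Coord n)} {u : Coord n}

lemma pd_congr {F F' : Coord n → ℝ} (h : F =ᶠ[𝓝 u] F') (k : Fin n) : pd k F u = pd k F' u := by
  simp only [pd, h.fderiv_eq]

lemma pd_congr_on (hV : IsOpen V) (hu : u ∈ V) {F F' : Coord n → ℝ} (h : ∀ v ∈ V, F v = F' v)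
    (k : Fin n) : pd k F u = pd k F' u :=
  pd_congr (Filter.eventually_of_mem (hV.mem_nhds hu) h) k

@[simp] lemma pd_const (c : ℝ) (k : Fin n) : pd k (fun _ => c) u = 0 := by simp [pd]

lemma pd_add {F F' : Coord n → ℝ} (hF : DifferentiableAt ℝ F u) (hF' : DifferentiableAt ℝ F' u)
    (k : Fin n) : pd k (fun v => F v + F' v) u = pd k F u + pd k F' u := by
  simp [pd, fderiv_fun_add hF hF']

lemma pd_sub {F F' : Coord n → ℝ} (hF : DifferentiableAt ℝ F u) (hF' : DifferentiableAt ℝ F' u)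
    (k : Fin n) : pd k (fun v => F v - F' v) u = pd k F u - pd k F' u := by
  simp [pd, fderiv_fun_sub hF hF']

lemma pd_mul {F F' : Coord n → ℝ} (hF : DifferentiableAt ℝ F u) (hF' : DifferentiableAt ℝ F' u)
    (k : Fin n) : pd k (fun v => F v * F' v) u = pd k F u * F' u + F u * pd k F' u := by
  simp [pd, fderiv_fun_mul hF hF']; ring

lemma pd_const_mul {F : Coord n → ℝ} (hF : DifferentiableAt ℝ F u) (c : ℝ)
    (k : Fin n) : pd k (fun v => c * F v) u = c * pd k F u := by
  rw [pd_mul (differentiableAt_const c) hF]; simp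

lemma pd_sum {ι : Type*} (s : Finset ι) {F : ι → Coord n → ℝ}
    (hF : ∀ i ∈ s, DifferentiableAt ℝ (F i) u) (k : Fin n) :
    pd k (fun v => ∑ i ∈ s, F i v) u = ∑ i ∈ s, pd k (F i) u := by
  simp [pd, fderiv_fun_sum hF]

lemma ContDiffOn.dAt {F : Coord n → ℝ} (hV : IsOpen V) (hF : ContDiffOn ℝ ∞ F V) (hu : u ∈ V) :
    DifferentiableAt ℝ F u :=
  (hF.contDiffAt (hV.mem_nhds hu)).differentiableAt (by simp)

lemma ContDiffOn.pd {F : Coord n → ℝ} (hV : IsOpen V) (hF : ContDiffOn ℝ ∞ F V) (k : Fin n) :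
    ContDiffOn ℝ ∞ (pd k F) V :=
  (hF.fderiv_of_isOpen hV (by simp)).clm_apply contDiffOn_const

lemma pd_comm {F : Coord n → ℝ} (hV : IsOpen V) (hF : ContDiffOn ℝ ∞ F V) (hu : u ∈ V)
    (i j : Fin n) : pd i (pd j F) u = pd j (pd i F) u := by
  have h := hF.contDiffAt (hV.mem_nhds hu)
  have hs : IsSymmSndFDerivAt ℝ F u := h.isSymmSndFDerivAt (by
    simpa using (WithTop.coe_le_coe.2 le_top : ((2 : ℕ∞) : WithTop ℕ∞) ≤ ((⊤ : ℕ∞) : WithTop ℕ∞)))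
  have hd : DifferentiableAt ℝ (fderiv ℝ F) u :=
    (h.fderiv_right (m := 1) (by exact WithTop.coe_le_coe.2 (by simp))).differentiableAt (by simp)
  have key : ∀ a b : Fin n, VacuumStatic.pd a (VacuumStatic.pd b F) u =
      fderiv ℝ (fderiv ℝ F) u (EuclideanSpace.single a 1) (EuclideanSpace.single b 1) := by
    intro a b
    unfold VacuumStatic.pd
    rw [fderiv_clm_apply hd (differentiableAt_const _)]
    simp
  rw [key, key, hs]

end PartialDerivatives

/-! ### Matrix-valued functions -/

section MatrixValued

variable {n : ℕ} {V : Set (Coord n)} {u : Coord n}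

/-- Smoothness of all entries of a matrix-valued function. -/
def MSmooth (F : Coord n → Matrix (Fin n) (Fin n) ℝ) (V : Set (Coord n)) : Prop :=
  ∀ i j, ContDiffOn ℝ ∞ (fun u => F u i j) V

/-- The entrywise partial derivative of a matrix-valued function. -/
def dM (k : Fin n) (F : Coord n → Matrix (Fin n) (Fin n) ℝ) (u : Coord n) :
    Matrix (Fin n) (Fin n) ℝ :=
  Matrix.of fun i j => pd k (fun v => F v i j) u

variable {F F' : Coord n → Matrix (Fin n) (Fin n) ℝ}

lemma MSmooth.mul (hF : MSmooth F V) (hF' : MSmooth F' V) : MSmooth (fun v => F v * F' v) V := by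
  intro i j
  simp only [Matrix.mul_apply]
  exact ContDiffOn.sum fun p _ => (hF i p).mul (hF' p j)

lemma MSmooth.add (hF : MSmooth F V) (hF' : MSmooth F' V) : MSmooth (fun v => F v + F' v) V :=
  fun i j => (hF i j).add (hF' i j)

lemma MSmooth.sub (hF : MSmooth F V) (hF' : MSmooth F' V) : MSmooth (fun v => F v - F' v) V :=
  fun i j => (hF i j).sub (hF' i j)

lemma MSmooth.transpose (hF : MSmooth F V) : MSmooth (fun v => (F v).transpose) V :=
  fun i j => hF j i

lemma MSmooth.dM (hV : IsOpen V) (hF : MSmooth F V) (k : Fin n) : MSmooth (dM k F) V :=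
  fun i j => ContDiffOn.pd hV (hF i j) k

lemma MSmooth.det (hF : MSmooth F V) : ContDiffOn ℝ ∞ (fun u => (F u).det) V := by
  simp only [Matrix.det_apply]
  refine ContDiffOn.sum fun σ _ => ?_
  exact (contDiffOn_prod fun i _ => hF (σ i) i).const_smul (Equiv.Perm.sign σ)

lemma MSmooth.inv (hF : MSmooth F V) (h0 : ∀ u ∈ V, (F u).det ≠ 0) :
    MSmooth (fun v => (F v)⁻¹) V := by
  intro i j
  simp only [Matrix.inv_def, Ring.inverse_eq_inv, Matrix.smul_apply, smul_eq_mul,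
    Matrix.adjugate_apply]
  refine (hF.det.inv h0).mul (MSmooth.det fun a b => ?_)
  by_cases h : a = j
  · subst h; simpa using contDiffOn_const
  · simpa [Matrix.updateRow_ne h] using hF a b

lemma dM_congr (h : F =ᶠ[𝓝 u] F') (k : Fin n) : dM k F u = dM k F' u := by
  ext i j
  exact pd_congr (h.mono fun v hv => by simp only [hv]) k

lemma dM_congr_on (hV : IsOpen V) (hu : u ∈ V) (h : ∀ v ∈ V, F v = F' v) (k : Fin n) :
    dM k F u = dM k F' u :=
  dM_congr (Filter.eventually_of_mem (hV.mem_nhds hu) h) k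

lemma dM_mul (hV : IsOpen V) (hu : u ∈ V) (hF : MSmooth F V) (hF' : MSmooth F' V) (k : Fin n) :
    dM k (fun v => F v * F' v) u = dM k F u * F' u + F u * dM k F' u := by
  ext i j
  simp only [dM, Matrix.of_apply, Matrix.add_apply, Matrix.mul_apply]
  rw [pd_sum _ fun p _ => (ContDiffOn.dAt hV (hF i p) hu).fun_mul (ContDiffOn.dAt hV (hF' p j) hu),
    ← Finset.sum_add_distrib]
  exact Finset.sum_congr rfl fun p _ =>
    pd_mul (ContDiffOn.dAt hV (hF i p) hu) (ContDiffOn.dAt hV (hF' p j) hu) k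

lemma dM_add (hV : IsOpen V) (hu : u ∈ V) (hF : MSmooth F V) (hF' : MSmooth F' V) (k : Fin n) :
    dM k (fun v => F v + F' v) u = dM k F u + dM k F' u := by
  ext i j
  exact pd_add (ContDiffOn.dAt hV (hF i j) hu) (ContDiffOn.dAt hV (hF' i j) hu) k

lemma dM_sub (hV : IsOpen V) (hu : u ∈ V) (hF : MSmooth F V) (hF' : MSmooth F' V) (k : Fin n) :
    dM k (fun v => F v - F' v) u = dM k F u - dM k F' u := by
  ext i j
  exact pd_sub (ContDiffOn.dAt hV (hF i j) hu) (ContDiffOn.dAt hV (hF' i j) hu) k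

lemma dM_transpose (k : Fin n) :
    dM k (fun v => (F v).transpose) u = (dM k F u).transpose := rfl

lemma dM_comm (hV : IsOpen V) (hu : u ∈ V) (hF : MSmooth F V) (i j : Fin n) :
    dM i (dM j F) u = dM j (dM i F) u := by
  ext a b
  exact pd_comm hV (hF a b) hu i j

end MatrixValued

/-! ### The connection and the curvature as matrices -/

section Curvature

variable {n : ℕ} {G : MetricCoeff n} {V : Set (Coord n)} {u : Coord n}

lemma IsMetricOn.smooth (hG : IsMetricOn G V) : MSmooth G V := hG.1

lemma IsMetricOn.symm (hG : IsMetricOn G V) (hu : u ∈ V) (i j : Fin n) : G u i j = G u j i := by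
  simpa using (hG.2 u hu).isHermitian.apply j i

lemma IsMetricOn.transpose (hG : IsMetricOn G V) (hu : u ∈ V) : (G u).transpose = G u := by
  ext i j; exact hG.symm hu j i

lemma IsMetricOn.det_ne (hG : IsMetricOn G V) : ∀ u ∈ V, (G u).det ≠ 0 :=
  fun u hu => (hG.2 u hu).det_pos.ne'

lemma IsMetricOn.mul_inv (hG : IsMetricOn G V) (hu : u ∈ V) : G u * (G u)⁻¹ = 1 :=
  Matrix.mul_nonsing_inv _ (isUnit_iff_ne_zero.2 (hG.det_ne u hu))

lemma IsMetricOn.inv_mul (hG : IsMetricOn G V) (hu : u ∈ V) : (G u)⁻¹ * G u = 1 :=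
  Matrix.nonsing_inv_mul _ (isUnit_iff_ne_zero.2 (hG.det_ne u hu))

lemma IsMetricOn.inv_smooth (hG : IsMetricOn G V) : MSmooth (fun u => (G u)⁻¹) V :=
  hG.smooth.inv hG.det_ne

lemma IsMetricOn.inv_transpose (hG : IsMetricOn G V) (hu : u ∈ V) :
    ((G u)⁻¹).transpose = (G u)⁻¹ := by
  rw [Matrix.transpose_nonsing_inv, hG.transpose hu]

lemma IsMetricOn.inv_symm (hG : IsMetricOn G V) (hu : u ∈ V) (i j : Fin n) :
    (G u)⁻¹ i j = (G u)⁻¹ j i :=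
  congrFun (congrFun (hG.inv_transpose hu) j) i

/-- The connection matrix `(A_k)^p_j = Γ^p_kj`. -/
def connM (G : MetricCoeff n) (k : Fin n) (u : Coord n) : Matrix (Fin n) (Fin n) ℝ :=
  Matrix.of fun p j => christoffel G p k j u

/-- The curvature matrix `(R_ij)^l_k = R^l_kij`. -/
def curvM (G : MetricCoeff n) (i j : Fin n) (u : Coord n) : Matrix (Fin n) (Fin n) ℝ :=
  Matrix.of fun l k => curvOp G l k i j u

lemma christoffel_smooth (hV : IsOpen V) (hG : IsMetricOn G V) (p i j : Fin n) :
    ContDiffOn ℝ ∞ (christoffel G p i j) V := by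
  unfold christoffel
  refine contDiffOn_const.mul (ContDiffOn.sum fun l _ => (hG.inv_smooth p l).mul ?_)
  exact ((ContDiffOn.pd hV (hG.1 _ _) _).add (ContDiffOn.pd hV (hG.1 _ _) _)).sub
    (ContDiffOn.pd hV (hG.1 _ _) _)

lemma connM_smooth (hV : IsOpen V) (hG : IsMetricOn G V) (k : Fin n) : MSmooth (connM G k) V :=
  fun _ _ => christoffel_smooth hV hG _ _ _

lemma christoffel_symm (hV : IsOpen V) (hG : IsMetricOn G V) (hu : u ∈ V) (p i j : Fin n) :
    christoffel G p i j u = christoffel G p j i u := by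
  unfold christoffel
  congr 1
  refine Finset.sum_congr rfl fun l _ => ?_
  rw [pd_congr_on hV hu (fun v hv => hG.symm hv i j)]
  ring

lemma pd_metric_symm (hV : IsOpen V) (hG : IsMetricOn G V) (hu : u ∈ V) (k i j : Fin n) :
    pd k (fun v => G v i j) u = pd k (fun v => G v j i) u :=
  pd_congr_on hV hu (fun _ hv => hG.symm hv i j) k

/-- Christoffel symbols of the first kind. -/
lemma metric_mul_connM (hG : IsMetricOn G V) (hu : u ∈ V) (k l j : Fin n) :
    (G u * connM G k u) l j = (1 / 2) * (pd k (fun v => G v j l) u + pd j (fun v => G v k l) u -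
      pd l (fun v => G v k j) u) := by
  have h : connM G k u = (G u)⁻¹ * Matrix.of fun l j => (1 / 2) * (pd k (fun v => G v j l) u +
      pd j (fun v => G v k l) u - pd l (fun v => G v k j) u) := by
    ext p j
    simp only [connM, christoffel, Matrix.of_apply, Matrix.mul_apply, Finset.mul_sum]
    exact Finset.sum_congr rfl fun _ _ => by ring
  rw [h, ← mul_assoc, hG.mul_inv hu, one_mul, Matrix.of_apply]

/-- Metric compatibility `∇g = 0`, in matrix form. -/
lemma dM_metric (hV : IsOpen V) (hG : IsMetricOn G V) (hu : u ∈ V) (k : Fin n) :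
    dM k G u = G u * connM G k u + (connM G k u).transpose * G u := by
  have h : (connM G k u).transpose * G u = (G u * connM G k u).transpose := by
    rw [Matrix.transpose_mul, hG.transpose hu]
  ext l j
  rw [h, Matrix.add_apply, Matrix.transpose_apply, metric_mul_connM hG hu,
    metric_mul_connM hG hu, pd_metric_symm hV hG hu l k j, pd_metric_symm hV hG hu k j l,
    pd_metric_symm hV hG hu l j k, pd_metric_symm hV hG hu j k l]
  simp only [dM, Matrix.of_apply]
  ring

lemma dM_inv (hV : IsOpen V) (hG : IsMetricOn G V) (hu : u ∈ V) (k : Fin n) :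
    dM k (fun v => (G v)⁻¹) u =
      -(connM G k u * (G u)⁻¹) - (G u)⁻¹ * (connM G k u).transpose := by
  have h1 : dM k (fun v => G v * (G v)⁻¹) u = 0 := by
    rw [dM_congr_on hV hu (F' := fun _ => 1) (fun v hv => hG.mul_inv hv)]
    ext i j; simp [dM]
  rw [dM_mul hV hu hG.smooth hG.inv_smooth, dM_metric hV hG hu] at h1
  have h2 : (G u)⁻¹ * (G u * dM k (fun v => (G v)⁻¹) u) =
      -((G u)⁻¹ * ((G u * connM G k u + (connM G k u).transpose * G u) * (G u)⁻¹)) := by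
    rw [eq_neg_of_add_eq_zero_right h1, mul_neg]
  rw [← mul_assoc, hG.inv_mul hu, one_mul] at h2
  rw [h2]
  have h3 : (G u)⁻¹ * ((G u * connM G k u + (connM G k u).transpose * G u) * (G u)⁻¹) =
      ((G u)⁻¹ * G u) * connM G k u * (G u)⁻¹ +
        (G u)⁻¹ * (connM G k u).transpose * (G u * (G u)⁻¹) := by noncomm_ring
  rw [h3, hG.inv_mul hu, hG.mul_inv hu]
  noncomm_ring

lemma curvM_eq (i j : Fin n) (u : Coord n) :
    curvM G i j u = dM i (connM G j) u - dM j (connM G i) u +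
      (connM G i u * connM G j u - connM G j u * connM G i u) := by
  ext l k
  simp [curvM, curvOp, dM, connM, Matrix.mul_apply, Finset.sum_sub_distrib]

lemma curvM_smooth (hV : IsOpen V) (hG : IsMetricOn G V) (i j : Fin n) :
    MSmooth (curvM G i j) V := by
  have h := connM_smooth hV hG
  have : curvM G i j = fun u => dM i (connM G j) u - dM j (connM G i) u +
      (connM G i u * connM G j u - connM G j u * connM G i u) := funext (curvM_eq i j)
  rw [this]
  exact (((h j).dM hV i).sub ((h i).dM hV j)).add (((h i).mul (h j)).sub ((h j).mul (h i)))

lemma curvM_antisymm (i j : Fin n) (u : Coord n) : curvM G j i u = -curvM G i j u := by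
  rw [curvM_eq, curvM_eq]; abel

/-- The second Bianchi identity, for the curvature matrices. -/
lemma curvM_bianchi (hV : IsOpen V) (hG : IsMetricOn G V) (hu : u ∈ V) (m i j : Fin n) :
    (dM m (curvM G i j) u + connM G m u * curvM G i j u - curvM G i j u * connM G m u) +
    (dM i (curvM G j m) u + connM G i u * curvM G j m u - curvM G j m u * connM G i u) +
    (dM j (curvM G m i) u + connM G j u * curvM G m i u - curvM G m i u * connM G j u) = 0 := by
  have h := connM_smooth hV hG
  have key : ∀ a b c : Fin n, dM a (curvM G b c) u =
      dM a (dM b (connM G c)) u - dM a (dM c (connM G b)) u +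
      ((dM a (connM G b) u * connM G c u + connM G b u * dM a (connM G c) u) -
        (dM a (connM G c) u * connM G b u + connM G c u * dM a (connM G b) u)) := by
    intro a b c
    rw [show curvM G b c = _ from funext (curvM_eq b c),
      dM_add hV hu (((h c).dM hV b).sub ((h b).dM hV c)) (((h b).mul (h c)).sub ((h c).mul (h b))),
      dM_sub hV hu ((h c).dM hV b) ((h b).dM hV c),
      dM_sub hV hu ((h b).mul (h c)) ((h c).mul (h b)), dM_mul hV hu (h b) (h c),
      dM_mul hV hu (h c) (h b)]
  rw [key, key, key, dM_comm hV hu (h j) m i, dM_comm hV hu (h m) i j, dM_comm hV hu (h i) m j,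
    curvM_eq, curvM_eq, curvM_eq]
  noncomm_ring

/-- The Riemann tensor is antisymmetric in its last two indices; in matrix form. -/
lemma metric_mul_curvM_transpose (hV : IsOpen V) (hG : IsMetricOn G V) (hu : u ∈ V)
    (i j : Fin n) : (G u * curvM G i j u).transpose = -(G u * curvM G i j u) := by
  have h := connM_smooth hV hG
  have key : ∀ a b : Fin n, dM a (dM b G) u =
      ((G u * connM G a u + (connM G a u).transpose * G u) * connM G b u +
        G u * dM a (connM G b) u) + ((dM a (connM G b) u).transpose * G u +
        (connM G b u).transpose * (G u * connM G a u + (connM G a u).transpose * G u)) := by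
    intro a b
    rw [dM_congr_on hV hu (F' := fun v => G v * connM G b v + (connM G b v).transpose * G v)
      (fun v hv => dM_metric hV hG hv b),
      dM_add hV hu (hG.smooth.mul (h b)) ((h b).transpose.mul hG.smooth),
      dM_mul hV hu hG.smooth (h b), dM_mul hV hu (h b).transpose hG.smooth, dM_transpose,
      dM_metric hV hG hu]
  have hc := dM_comm hV hu hG.smooth i j
  rw [key, key] at hc
  rw [Matrix.transpose_mul, hG.transpose hu, curvM_eq]
  simp only [Matrix.transpose_add, Matrix.transpose_sub, Matrix.transpose_mul]
  rw [← sub_eq_zero] at hc ⊢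
  rw [← hc]
  noncomm_ring

lemma curvOp_cyclic (hV : IsOpen V) (hG : IsMetricOn G V) (hu : u ∈ V) (l i j k : Fin n) :
    curvOp G l k i j u + curvOp G l i j k u + curvOp G l j k i u = 0 := by
  have hs : ∀ p a b, pd p (christoffel G l a b) u = pd p (christoffel G l b a) u :=
    fun p a b => pd_congr_on hV hu (fun v hv => christoffel_symm hV hG hv l a b) p
  unfold curvOp
  rw [hs i j k, hs j k i, hs k i j]
  simp only [christoffel_symm hV hG hu _ j k, christoffel_symm hV hG hu _ k i,
    christoffel_symm hV hG hu _ i j, Finset.sum_sub_distrib]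
  ring

end Curvature

/-! ### Symmetries of the Riemann tensor and the second Bianchi identity -/

section Riemann

variable {n : ℕ} {G : MetricCoeff n} {V : Set (Coord n)} {u : Coord n}

lemma riem_apply (i j k l : Fin n) :
    riem G u ![i, j, k, l] = (G u * curvM G i j u) k l := by
  simp [riem, Matrix.mul_apply, curvM]

lemma riem_smooth (hV : IsOpen V) (hG : IsMetricOn G V) (a : Fin 4 → Fin n) :
    ContDiffOn ℝ ∞ (fun v => riem G v a) V := by
  unfold riem
  exact ContDiffOn.sum fun p _ => (hG.1 _ _).mul (curvM_smooth hV hG (a 0) (a 1) p (a 3))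

lemma riem_swap_left (i j k l : Fin n) : riem G u ![j, i, k, l] = -riem G u ![i, j, k, l] := by
  rw [riem_apply, riem_apply, curvM_antisymm, mul_neg, Matrix.neg_apply]

lemma riem_swap_right (hV : IsOpen V) (hG : IsMetricOn G V) (hu : u ∈ V) (i j k l : Fin n) :
    riem G u ![i, j, l, k] = -riem G u ![i, j, k, l] := by
  have h := congrFun (congrFun (metric_mul_curvM_transpose hV hG hu i j) k) l
  rw [riem_apply, riem_apply]
  exact h

lemma riem_cyclic (hV : IsOpen V) (hG : IsMetricOn G V) (hu : u ∈ V) (i j k l : Fin n) :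
    riem G u ![i, j, k, l] + riem G u ![j, l, k, i] + riem G u ![l, i, k, j] = 0 := by
  simp only [riem_apply, Matrix.mul_apply, curvM, Matrix.of_apply, ← Finset.sum_add_distrib]
  refine Finset.sum_eq_zero fun p _ => ?_
  have := curvOp_cyclic hV hG hu p i j l
  linear_combination G u k p * this

lemma riem_pair (hV : IsOpen V) (hG : IsMetricOn G V) (hu : u ∈ V) (i j k l : Fin n) :
    riem G u ![k, l, i, j] = riem G u ![i, j, k, l] := by
  have c := riem_cyclic hV hG hu
  have r := riem_swap_right hV hG hu
  have s := @riem_swap_left n G u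
  linarith [c i j k l, c j k l i, c k l i j, c l i j k, s i j k l, s k l i j, s j l i k, s i l j k,
    s j k i l, s k i j l, s i k j l, s j l k i, s l i k j, s j k l i, s k i l j, s l j i k,
    s l i j k, s l k i j, s i j l k, s l j k i, r i j k l, r k l i j, r j k l i, r l i j k,
    r j l i k, r i k j l, r j l k i, r k i j l, r l j i k, r i l j k]

end Riemann

/-! ### Covariant derivatives and contractions -/

section Covariant

lemma sum_rotate {ι : Type*} [Fintype ι] (F : ι → ι → ι → ℝ) :
    ∑ a, ∑ b, ∑ c, F a b c = ∑ b, ∑ c, ∑ a, F a b c := by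
  rw [Finset.sum_comm]
  exact Finset.sum_congr rfl fun _ _ => Finset.sum_comm

lemma sum_comm_pairs {ι : Type*} [Fintype ι] (F : ι → ι → ι → ι → ℝ) :
    ∑ a, ∑ b, ∑ c, ∑ d, F a b c d = ∑ c, ∑ d, ∑ a, ∑ b, F a b c d := by
  rw [← sum_rotate fun a c d => ∑ b, F a b c d]
  exact Finset.sum_congr rfl fun _ _ => sum_rotate _

variable {n : ℕ} {G : MetricCoeff n} {V : Set (Coord n)} {u : Coord n}

lemma covDeriv_four (T : CovTensor n 4) (m i j k l : Fin n) :
    covDeriv G T u ![m, i, j, k, l] = pd m (fun v => T v ![i, j, k, l]) u -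
      (∑ p, christoffel G p m i u * T u ![p, j, k, l] +
       ∑ p, christoffel G p m j u * T u ![i, p, k, l] +
       ∑ p, christoffel G p m k u * T u ![i, j, p, l] +
       ∑ p, christoffel G p m l u * T u ![i, j, k, p]) := by
  have h0 : ∀ p, Function.update ![i, j, k, l] 0 p = ![p, j, k, l] := by
    intro p; ext x; fin_cases x <;> rfl
  have h1 : ∀ p, Function.update ![i, j, k, l] 1 p = ![i, p, k, l] := by
    intro p; ext x; fin_cases x <;> rfl
  have h2 : ∀ p, Function.update ![i, j, k, l] 2 p = ![i, j, p, l] := by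
    intro p; ext x; fin_cases x <;> rfl
  have h3 : ∀ p, Function.update ![i, j, k, l] 3 p = ![i, j, k, p] := by
    intro p; ext x; fin_cases x <;> rfl
  have ht : Fin.tail ![m, i, j, k, l] = ![i, j, k, l] := rfl
  simp only [covDeriv, ht, Fin.sum_univ_four, h0, h1, h2, h3]
  rfl

lemma covDeriv_five (T : CovTensor n 5) (m h i j k l : Fin n) :
    covDeriv G T u ![m, h, i, j, k, l] = pd m (fun v => T v ![h, i, j, k, l]) u -
      (∑ p, christoffel G p m h u * T u ![p, i, j, k, l] +
       ∑ p, christoffel G p m i u * T u ![h, p, j, k, l] +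
       ∑ p, christoffel G p m j u * T u ![h, i, p, k, l] +
       ∑ p, christoffel G p m k u * T u ![h, i, j, p, l] +
       ∑ p, christoffel G p m l u * T u ![h, i, j, k, p]) := by
  have h0 : ∀ p, Function.update ![h, i, j, k, l] 0 p = ![p, i, j, k, l] := by
    intro p; ext x; fin_cases x <;> rfl
  have h1 : ∀ p, Function.update ![h, i, j, k, l] 1 p = ![h, p, j, k, l] := by
    intro p; ext x; fin_cases x <;> rfl
  have h2 : ∀ p, Function.update ![h, i, j, k, l] 2 p = ![h, i, p, k, l] := by
    intro p; ext x; fin_cases x <;> rfl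
  have h3 : ∀ p, Function.update ![h, i, j, k, l] 3 p = ![h, i, j, p, l] := by
    intro p; ext x; fin_cases x <;> rfl
  have h4 : ∀ p, Function.update ![h, i, j, k, l] 4 p = ![h, i, j, k, p] := by
    intro p; ext x; fin_cases x <;> rfl
  have ht : Fin.tail ![m, h, i, j, k, l] = ![h, i, j, k, l] := rfl
  simp only [covDeriv, ht, Fin.sum_univ_five, h0, h1, h2, h3, h4]
  rfl

lemma covDeriv_smooth {r : ℕ} (hV : IsOpen V) (hG : IsMetricOn G V) {T : CovTensor n r}
    (hT : ∀ a, ContDiffOn ℝ ∞ (fun v => T v a) V) (a : Fin (r + 1) → Fin n) :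
    ContDiffOn ℝ ∞ (fun v => covDeriv G T v a) V := by
  unfold covDeriv
  exact (ContDiffOn.pd hV (hT _) _).sub (ContDiffOn.sum fun s _ => ContDiffOn.sum fun p _ =>
    (christoffel_smooth hV hG _ _ _).mul (hT _))

/-- The covariant derivative `(∇S)_mij` of a covariant tensor of rank two. -/
def nabla2 (G : MetricCoeff n) (S : Coord n → Matrix (Fin n) (Fin n) ℝ) (u : Coord n)
    (m i j : Fin n) : ℝ :=
  pd m (fun v => S v i j) u - (∑ p, christoffel G p m i u * S u p j +
    ∑ p, christoffel G p m j u * S u i p)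

/-- `∇g = 0`. -/
lemma nabla2_metric (hV : IsOpen V) (hG : IsMetricOn G V) (hu : u ∈ V) (m i j : Fin n) :
    nabla2 G G u m i j = 0 := by
  have h := congrFun (congrFun (dM_metric hV hG hu m) i) j
  simp only [dM, Matrix.add_apply, Matrix.mul_apply, Matrix.of_apply, Matrix.transpose_apply,
    connM] at h
  rw [nabla2, h, sub_eq_zero, add_comm]
  congr 1
  exact Finset.sum_congr rfl fun _ _ => mul_comm _ _

/-- The metric contraction commutes with the covariant derivative. -/
lemma contract_nabla2 (hV : IsOpen V) (hG : IsMetricOn G V) (hu : u ∈ V)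
    {S : Coord n → Matrix (Fin n) (Fin n) ℝ} (hS : MSmooth S V) (m : Fin n) :
    ∑ a, ∑ b, (G u)⁻¹ a b * nabla2 G S u m a b =
      pd m (fun v => ∑ a, ∑ b, (G v)⁻¹ a b * S v a b) u := by
  have hH := hG.inv_smooth
  have tr : ∀ H T : Matrix (Fin n) (Fin n) ℝ,
      ∑ a, ∑ b, H a b * T a b = (H * T.transpose).trace := by
    intro H T; simp [Matrix.trace, Matrix.mul_apply]
  have hL : (Matrix.of fun a b => nabla2 G S u m a b) =
      dM m S u - ((connM G m u).transpose * S u + S u * connM G m u) := by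
    ext a b
    simp only [nabla2, dM, connM, Matrix.of_apply, Matrix.sub_apply, Matrix.add_apply,
      Matrix.mul_apply, Matrix.transpose_apply]
    congr 2
    exact Finset.sum_congr rfl fun _ _ => mul_comm _ _
  have h1 : pd m (fun v => ∑ a, ∑ b, (G v)⁻¹ a b * S v a b) u =
      ∑ a, ∑ b, dM m (fun v => (G v)⁻¹) u a b * S u a b +
        ∑ a, ∑ b, (G u)⁻¹ a b * dM m S u a b := by
    have hd : ∀ a b, DifferentiableAt ℝ (fun v => (G v)⁻¹ a b * S v a b) u := fun a b =>
      (ContDiffOn.dAt hV (hH a b) hu).fun_mul (ContDiffOn.dAt hV (hS a b) hu)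
    rw [pd_sum _ fun a _ => DifferentiableAt.fun_sum fun b _ => hd a b, ← Finset.sum_add_distrib]
    refine Finset.sum_congr rfl fun a _ => ?_
    rw [pd_sum _ fun b _ => hd a b, ← Finset.sum_add_distrib]
    exact Finset.sum_congr rfl fun b _ =>
      pd_mul (ContDiffOn.dAt hV (hH a b) hu) (ContDiffOn.dAt hV (hS a b) hu) m
  rw [h1, tr, tr, dM_inv hV hG hu]
  have := tr (G u)⁻¹ (Matrix.of fun a b => nabla2 G S u m a b)
  simp only [Matrix.of_apply] at this
  rw [this, hL]
  simp only [Matrix.transpose_sub, Matrix.transpose_add, Matrix.transpose_mul,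
    Matrix.transpose_transpose, mul_sub, mul_add, sub_mul, neg_mul, Matrix.trace_sub,
    Matrix.trace_add, Matrix.trace_neg]
  have h2 : (connM G m u * (G u)⁻¹ * (S u).transpose).trace =
      ((G u)⁻¹ * ((S u).transpose * connM G m u)).trace := by
    rw [mul_assoc, Matrix.trace_mul_comm, mul_assoc]
  rw [h2, mul_assoc]
  ring

/-- Contraction of the covariant derivative of a tensor of rank four over its second and fourth
slots. -/
lemma contract_covDeriv_four (hV : IsOpen V) (hG : IsMetricOn G V) (hu : u ∈ V)
    {T : CovTensor n 4} (hT : ∀ a, ContDiffOn ℝ ∞ (fun v => T v a) V) (m i j : Fin n) :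
    ∑ k, ∑ l, (G u)⁻¹ k l * covDeriv G T u ![m, i, k, j, l] =
      nabla2 G (fun v => Matrix.of fun i j => ∑ k, ∑ l, (G v)⁻¹ k l * T v ![i, k, j, l])
        u m i j := by
  have h := contract_nabla2 hV hG hu (S := fun v => Matrix.of fun k l => T v ![i, k, j, l])
    (fun _ _ => hT _) m
  simp only [nabla2, Matrix.of_apply] at h ⊢
  rw [← h]
  simp only [covDeriv_four]
  have s1 : ∑ p, christoffel G p m i u * ∑ k, ∑ l, (G u)⁻¹ k l * T u ![p, k, j, l] =
      ∑ k, ∑ l, (G u)⁻¹ k l * ∑ p, christoffel G p m i u * T u ![p, k, j, l] := by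
    simp only [Finset.mul_sum]
    rw [Finset.sum_comm]
    refine Finset.sum_congr rfl fun k _ => ?_
    rw [Finset.sum_comm]
    exact Finset.sum_congr rfl fun l _ => Finset.sum_congr rfl fun p _ => by ring
  have s2 : ∑ p, christoffel G p m j u * ∑ k, ∑ l, (G u)⁻¹ k l * T u ![i, k, p, l] =
      ∑ k, ∑ l, (G u)⁻¹ k l * ∑ p, christoffel G p m j u * T u ![i, k, p, l] := by
    simp only [Finset.mul_sum]
    rw [Finset.sum_comm]
    refine Finset.sum_congr rfl fun k _ => ?_
    rw [Finset.sum_comm]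
    exact Finset.sum_congr rfl fun l _ => Finset.sum_congr rfl fun p _ => by ring
  rw [s1, s2]
  simp only [← Finset.sum_add_distrib, ← Finset.sum_sub_distrib]
  refine Finset.sum_congr rfl fun k _ => Finset.sum_congr rfl fun l _ => ?_
  simp only [Finset.sum_add_distrib]
  ring

/-- The covariant derivative of the tensor `S_ab g_cd`, whose Christoffel terms are listed in the
order in which the indices occur. -/
lemma pd_mul_metric (hV : IsOpen V) (hG : IsMetricOn G V) (hu : u ∈ V)
    {S : Coord n → Matrix (Fin n) (Fin n) ℝ} (hS : MSmooth S V) (m a b c d : Fin n) :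
    pd m (fun v => S v a b * G v c d) u =
      nabla2 G S u m a b * G u c d +
      (∑ p, christoffel G p m a u * (S u p b * G u c d) +
       ∑ p, christoffel G p m b u * (S u a p * G u c d) +
       ∑ p, christoffel G p m c u * (S u a b * G u p d) +
       ∑ p, christoffel G p m d u * (S u a b * G u c p)) := by
  rw [pd_mul (ContDiffOn.dAt hV (hS a b) hu) (ContDiffOn.dAt hV (hG.1 c d) hu)]
  have h := nabla2_metric hV hG hu m c d
  rw [nabla2, sub_eq_zero] at h
  rw [h, nabla2]
  have e : ∀ (x : Fin n → ℝ) (y : Fin n → ℝ) (z : ℝ),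
      ∑ p, x p * (y p * z) = (∑ p, x p * y p) * z := fun x y z => by
    rw [Finset.sum_mul]; exact Finset.sum_congr rfl fun _ _ => by ring
  have e' : ∀ (x : Fin n → ℝ) (y : Fin n → ℝ) (z : ℝ),
      ∑ p, x p * (z * y p) = z * (∑ p, x p * y p) := fun x y z => by
    rw [Finset.mul_sum]; exact Finset.sum_congr rfl fun _ _ => by ring
  rw [e, e, e', e']
  ring

end Covariant

/-! ### The Ricci tensor and harmonic curvature -/

section Ricci

variable {n : ℕ} {G : MetricCoeff n} {V : Set (Coord n)} {u : Coord n}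

/-- The second Bianchi identity. -/
lemma covDeriv_riem_bianchi (hV : IsOpen V) (hG : IsMetricOn G V) (hu : u ∈ V)
    (m i j k l : Fin n) :
    covDeriv G (riem G) u ![m, i, j, k, l] + covDeriv G (riem G) u ![i, j, m, k, l] +
      covDeriv G (riem G) u ![j, m, i, k, l] = 0 := by
  have key : ∀ a b c : Fin n, covDeriv G (riem G) u ![a, b, c, k, l] =
      (G u * (dM a (curvM G b c) u + connM G a u * curvM G b c u -
        curvM G b c u * connM G a u)) k l -
      (∑ p, christoffel G p a b u * riem G u ![p, c, k, l] +
        ∑ p, christoffel G p a c u * riem G u ![b, p, k, l]) := by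
    intro a b c
    have h := congrFun (congrFun (dM_mul hV hu hG.smooth (curvM_smooth hV hG b c) a) k) l
    rw [dM_metric hV hG hu] at h
    have h1 : pd a (fun v => riem G v ![b, c, k, l]) u =
        ((G u * connM G a u + (connM G a u).transpose * G u) * curvM G b c u +
          G u * dM a (curvM G b c) u) k l := by
      rw [← h]
      simp only [riem_apply]
      rfl
    have h2 : ∑ p, christoffel G p a k u * riem G u ![b, c, p, l] =
        ((connM G a u).transpose * (G u * curvM G b c u)) k l := by
      simp only [riem_apply]
      rw [Matrix.mul_apply]
      rfl
    have h3 : ∑ p, christoffel G p a l u * riem G u ![b, c, k, p] =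
        ((G u * curvM G b c u) * connM G a u) k l := by
      simp only [riem_apply]
      rw [Matrix.mul_apply]
      exact Finset.sum_congr rfl fun p _ => mul_comm _ _
    rw [covDeriv_four, h1, h2, h3]
    have h4 : G u * (dM a (curvM G b c) u + connM G a u * curvM G b c u -
        curvM G b c u * connM G a u) =
        ((G u * connM G a u + (connM G a u).transpose * G u) * curvM G b c u +
          G u * dM a (curvM G b c) u) - (connM G a u).transpose * (G u * curvM G b c u) -
          (G u * curvM G b c u) * connM G a u := by noncomm_ring
    rw [h4, Matrix.sub_apply, Matrix.sub_apply]
    ring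
  have hb := congrArg (fun X => (G u * X) k l) (curvM_bianchi hV hG hu m i j)
  beta_reduce at hb
  rw [mul_zero, mul_add, mul_add, Matrix.add_apply, Matrix.add_apply, Matrix.zero_apply] at hb
  have hs : ∀ a b c : Fin n, ∑ p, christoffel G p a b u * riem G u ![c, p, k, l] =
      -∑ p, christoffel G p b a u * riem G u ![p, c, k, l] := by
    intro a b c
    rw [← Finset.sum_neg_distrib]
    refine Finset.sum_congr rfl fun p _ => ?_
    rw [christoffel_symm hV hG hu, riem_swap_left p c]
    ring
  rw [key, key, key, hs m j i, hs i m j, hs j i m]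
  linarith

lemma covDeriv_riem_swap_left (hV : IsOpen V) (hG : IsMetricOn G V) (hu : u ∈ V)
    (m i j k l : Fin n) :
    covDeriv G (riem G) u ![m, j, i, k, l] = -covDeriv G (riem G) u ![m, i, j, k, l] := by
  rw [covDeriv_four, covDeriv_four]
  have hp : pd m (fun v => riem G v ![j, i, k, l]) u =
      -pd m (fun v => riem G v ![i, j, k, l]) u := by
    rw [pd_congr_on hV hu (F' := fun v => -1 * riem G v ![i, j, k, l]) fun v hv => by
      rw [riem_swap_left i j]; ring, pd_const_mul (ContDiffOn.dAt hV (riem_smooth hV hG _) hu)]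
    ring
  rw [hp]
  simp only [riem_swap_left i _ k _, riem_swap_left _ j k _, riem_swap_left i j, mul_neg,
    Finset.sum_neg_distrib]
  ring

lemma covDeriv_riem_swap_right (hV : IsOpen V) (hG : IsMetricOn G V) (hu : u ∈ V)
    (m i j k l : Fin n) :
    covDeriv G (riem G) u ![m, i, j, l, k] = -covDeriv G (riem G) u ![m, i, j, k, l] := by
  rw [covDeriv_four, covDeriv_four]
  have hp : pd m (fun v => riem G v ![i, j, l, k]) u =
      -pd m (fun v => riem G v ![i, j, k, l]) u := by
    rw [pd_congr_on hV hu (F' := fun v => -1 * riem G v ![i, j, k, l]) fun v hv => by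
      rw [riem_swap_right hV hG hv i j]; ring,
      pd_const_mul (ContDiffOn.dAt hV (riem_smooth hV hG _) hu)]
    ring
  rw [hp]
  simp only [riem_swap_right hV hG hu _ _ k l, riem_swap_right hV hG hu i j k _,
    riem_swap_right hV hG hu i j _ l, mul_neg, Finset.sum_neg_distrib]
  ring

lemma covDeriv_riem_pair (hV : IsOpen V) (hG : IsMetricOn G V) (hu : u ∈ V)
    (m i j k l : Fin n) :
    covDeriv G (riem G) u ![m, k, l, i, j] = covDeriv G (riem G) u ![m, i, j, k, l] := by
  rw [covDeriv_four, covDeriv_four]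
  have hp : pd m (fun v => riem G v ![k, l, i, j]) u = pd m (fun v => riem G v ![i, j, k, l]) u :=
    pd_congr_on hV hu (fun v hv => riem_pair hV hG hv i j k l) m
  rw [hp]
  simp only [riem_pair hV hG hu i j _ l, riem_pair hV hG hu i j k _, riem_pair hV hG hu _ j k l,
    riem_pair hV hG hu i _ k l]
  ring

lemma ric_symm (hV : IsOpen V) (hG : IsMetricOn G V) (hu : u ∈ V) (i j : Fin n) :
    ric G u i j = ric G u j i := by
  unfold ric
  rw [Finset.sum_comm]
  refine Finset.sum_congr rfl fun l _ => Finset.sum_congr rfl fun k _ => ?_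
  rw [riem_pair hV hG hu j l i k, hG.inv_symm hu]

lemma ric_smooth (hV : IsOpen V) (hG : IsMetricOn G V) (i j : Fin n) :
    ContDiffOn ℝ ∞ (fun v => ric G v i j) V := by
  unfold ric
  exact ContDiffOn.sum fun k _ => ContDiffOn.sum fun l _ =>
    (hG.inv_smooth k l).mul (riem_smooth hV hG _)

lemma scal_smooth (hV : IsOpen V) (hG : IsMetricOn G V) : ContDiffOn ℝ ∞ (scal G) V := by
  unfold scal
  exact ContDiffOn.sum fun k _ => ContDiffOn.sum fun l _ =>
    (hG.inv_smooth k l).mul (ric_smooth hV hG k l)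

/-- The covariant derivative `∇_m R_ij` of the Ricci tensor. -/
def nablaRic (G : MetricCoeff n) (u : Coord n) (m i j : Fin n) : ℝ :=
  nabla2 G (fun v => Matrix.of (ric G v)) u m i j

lemma nablaRic_symm (hV : IsOpen V) (hG : IsMetricOn G V) (hu : u ∈ V) (m i j : Fin n) :
    nablaRic G u m i j = nablaRic G u m j i := by
  simp only [nablaRic, nabla2, Matrix.of_apply]
  rw [pd_congr_on hV hu (fun v hv => ric_symm hV hG hv i j)]
  simp only [ric_symm hV hG hu i, ric_symm hV hG hu _ j]
  ring

lemma contract_covDeriv_riem (hV : IsOpen V) (hG : IsMetricOn G V) (hu : u ∈ V) (m i j : Fin n) :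
    ∑ k, ∑ l, (G u)⁻¹ k l * covDeriv G (riem G) u ![m, i, k, j, l] = nablaRic G u m i j :=
  contract_covDeriv_four hV hG hu (riem_smooth hV hG) m i j

/-- The contracted second Bianchi identity `∇^l R_lijk = ∇_j R_ik - ∇_k R_ij`. -/
lemma divRiem_eq (hV : IsOpen V) (hG : IsMetricOn G V) (hu : u ∈ V) (i j k : Fin n) :
    divRiem G u i j k = nablaRic G u j k i - nablaRic G u k j i := by
  rw [← contract_covDeriv_riem hV hG hu, ← contract_covDeriv_riem hV hG hu, divRiem]
  rw [Finset.sum_comm, ← Finset.sum_sub_distrib]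
  refine Finset.sum_congr rfl fun m _ => ?_
  rw [← Finset.sum_sub_distrib]
  refine Finset.sum_congr rfl fun l _ => ?_
  have h1 := covDeriv_riem_pair hV hG hu m j k l i
  have h2 := covDeriv_riem_bianchi hV hG hu m j k l i
  have h3 := covDeriv_riem_swap_right hV hG hu j k m i l
  have h4 := covDeriv_riem_swap_right hV hG hu k m j i l
  have h5 := covDeriv_riem_swap_left hV hG hu k j m i l
  rw [hG.inv_symm hu l m, h1]
  linear_combination (G u)⁻¹ m l * (h2 - h3 - h4 + h5)

/-- Harmonic curvature means that the Ricci tensor is a Codazzi tensor. -/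
lemma nablaRic_codazzi (hV : IsOpen V) (hG : IsMetricOn G V) (hu : u ∈ V)
    (hd : ∀ i j k, divRiem G u i j k = 0) (m i j : Fin n) :
    nablaRic G u m i j = nablaRic G u i m j := by
  have := divRiem_eq hV hG hu j m i
  rw [hd] at this
  linarith

lemma contract_nablaRic_eq_zero (hV : IsOpen V) (hG : IsMetricOn G V) (hu : u ∈ V)
    (hd : ∀ i j k, divRiem G u i j k = 0) (j : Fin n) :
    ∑ l, ∑ m, (G u)⁻¹ l m * nablaRic G u m l j = 0 := by
  have h : ∑ i, ∑ k, (G u)⁻¹ i k * divRiem G u i j k = 0 := by simp [hd]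
  rw [← h]
  simp only [divRiem, ← contract_covDeriv_riem hV hG hu, Finset.mul_sum]
  rw [sum_comm_pairs]
  refine Finset.sum_congr rfl fun i _ => Finset.sum_congr rfl fun k _ =>
    Finset.sum_congr rfl fun l _ => Finset.sum_congr rfl fun m _ => by ring

/-- The scalar curvature of a metric with harmonic curvature is locally constant. -/
lemma pd_scal_eq_zero (hV : IsOpen V) (hG : IsMetricOn G V) (hu : u ∈ V)
    (hd : ∀ i j k, divRiem G u i j k = 0) (j : Fin n) : pd j (scal G) u = 0 := by
  have h := contract_nabla2 hV hG hu (S := fun v => Matrix.of (ric G v)) (ric_smooth hV hG) j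
  simp only [Matrix.of_apply] at h
  change _ = pd j (scal G) u at h
  rw [← h, ← contract_nablaRic_eq_zero hV hG hu hd j]
  refine Finset.sum_congr rfl fun a _ => Finset.sum_congr rfl fun b _ => ?_
  congr 1
  have h1 := nablaRic_codazzi hV hG hu hd j b a
  have h2 := nablaRic_symm hV hG hu j b a
  have h3 := nablaRic_symm hV hG hu b j a
  change nablaRic G u j a b = _
  linarith

end Ricci

/-! ### The Weyl tensor -/

section Weyl

variable {n : ℕ} {G : MetricCoeff n} {V : Set (Coord n)} {u : Coord n}

lemma weyl_apply (i j k l : Fin n) :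
    weyl G u ![i, j, k, l] = riem G u ![i, j, k, l] - 1 / ((n : ℝ) - 2) *
      (schouten G u i k * G u j l + schouten G u j l * G u i k -
        schouten G u i l * G u j k - schouten G u j k * G u i l) := rfl

lemma schouten_smooth (hV : IsOpen V) (hG : IsMetricOn G V) :
    MSmooth (fun v => Matrix.of (schouten G v)) V := by
  intro i j
  simp only [Matrix.of_apply, schouten]
  exact (ric_smooth hV hG i j).sub (((scal_smooth hV hG).div_const _).mul (hG.1 i j))

lemma weyl_smooth (hV : IsOpen V) (hG : IsMetricOn G V) (a : Fin 4 → Fin n) :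
    ContDiffOn ℝ ∞ (fun v => weyl G v a) V := by
  have h : ∀ i j k l, ContDiffOn ℝ ∞ (fun v => schouten G v i j * G v k l) V :=
    fun i j k l => (schouten_smooth hV hG i j).mul (hG.1 k l)
  unfold weyl
  exact (riem_smooth hV hG a).sub (contDiffOn_const.mul
    ((((h _ _ _ _).add (h _ _ _ _)).sub (h _ _ _ _)).sub (h _ _ _ _)))

/-- For constant scalar curvature, the covariant derivatives of the Schouten and the Ricci tensor
agree. -/
lemma nabla2_schouten (hV : IsOpen V) (hG : IsMetricOn G V) (hu : u ∈ V)
    (hs : ∀ j, pd j (scal G) u = 0) (m i j : Fin n) :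
    nabla2 G (fun v => Matrix.of (schouten G v)) u m i j = nablaRic G u m i j := by
  have hg := nabla2_metric hV hG hu m i j
  simp only [nablaRic, nabla2, Matrix.of_apply, schouten] at hg ⊢
  have hS := ContDiffOn.dAt hV ((scal_smooth hV hG).div_const (2 * ((n : ℝ) - 1))) hu
  have hGd := ContDiffOn.dAt hV (hG.1 i j) hu
  rw [pd_sub (ContDiffOn.dAt hV (ric_smooth hV hG i j) hu) (hS.fun_mul hGd), pd_mul hS hGd]
  have h0 : pd m (fun v => scal G v / (2 * ((n : ℝ) - 1))) u = 0 := by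
    simp only [div_eq_inv_mul]
    rw [pd_const_mul (ContDiffOn.dAt hV (scal_smooth hV hG) hu)]
    rw [hs, mul_zero]
  have e : ∀ (x r g : Fin n → ℝ) (c : ℝ), ∑ p, x p * (r p - c * g p) =
      ∑ p, x p * r p - c * ∑ p, x p * g p := by
    intro x r g c
    rw [Finset.mul_sum, ← Finset.sum_sub_distrib]
    exact Finset.sum_congr rfl fun _ _ => by ring
  rw [h0, e, e]
  linear_combination -(scal G u / (2 * ((n : ℝ) - 1))) * hg

/-- For constant scalar curvature, only the Ricci part of the Schouten tensor is differentiated. -/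
lemma covDeriv_weyl (hV : IsOpen V) (hG : IsMetricOn G V) (hu : u ∈ V)
    (hs : ∀ j, pd j (scal G) u = 0) (m i j k l : Fin n) :
    covDeriv G (weyl G) u ![m, i, j, k, l] = covDeriv G (riem G) u ![m, i, j, k, l] -
      1 / ((n : ℝ) - 2) * (nablaRic G u m i k * G u j l + nablaRic G u m j l * G u i k -
        nablaRic G u m i l * G u j k - nablaRic G u m j k * G u i l) := by
  have hS := schouten_smooth hV hG
  have hd : ∀ a b c d, DifferentiableAt ℝ (fun v => schouten G v a b * G v c d) u := fun a b c d =>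
    ContDiffOn.dAt hV ((hS a b).mul (hG.1 c d)) hu
  have hp : ∀ a b c d, pd m (fun v => schouten G v a b * G v c d) u = _ := fun a b c d =>
    pd_mul_metric hV hG hu hS m a b c d
  simp only [nabla2_schouten hV hG hu hs, Matrix.of_apply] at hp
  have hr := ContDiffOn.dAt hV (riem_smooth hV hG ![i, j, k, l]) hu
  have e : ∀ (x r a b c d : Fin n → ℝ) (q : ℝ),
      ∑ p, x p * (r p - q * (a p + b p - c p - d p)) = ∑ p, x p * r p -
        q * (∑ p, x p * a p + ∑ p, x p * b p - ∑ p, x p * c p - ∑ p, x p * d p) := by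
    intro x r a b c d q
    rw [← Finset.sum_add_distrib, ← Finset.sum_sub_distrib, ← Finset.sum_sub_distrib,
      Finset.mul_sum, ← Finset.sum_sub_distrib]
    exact Finset.sum_congr rfl fun _ _ => by ring
  rw [covDeriv_four, covDeriv_four]
  simp only [weyl_apply, e]
  rw [pd_sub hr ((((hd _ _ _ _).fun_add (hd _ _ _ _)).fun_sub (hd _ _ _ _)).fun_sub
      (hd _ _ _ _) |>.const_mul _),
    pd_const_mul ((((hd _ _ _ _).fun_add (hd _ _ _ _)).fun_sub (hd _ _ _ _)).fun_sub
      (hd _ _ _ _)),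
    pd_sub (((hd _ _ _ _).fun_add (hd _ _ _ _)).fun_sub (hd _ _ _ _)) (hd _ _ _ _),
    pd_sub ((hd _ _ _ _).fun_add (hd _ _ _ _)) (hd _ _ _ _),
    pd_add (hd _ _ _ _) (hd _ _ _ _), hp, hp, hp, hp]
  ring

lemma inv_contract_metric (hG : IsMetricOn G V) (hu : u ∈ V) (x : Fin n → ℝ) (j : Fin n) :
    ∑ k, ∑ l, (G u)⁻¹ k l * (x k * G u l j) = x j := by
  have h : ∀ k, ∑ l, (G u)⁻¹ k l * (x k * G u l j) = x k * (1 : Matrix (Fin n) (Fin n) ℝ) k j := by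
    intro k
    rw [← hG.inv_mul hu, Matrix.mul_apply, Finset.mul_sum]
    exact Finset.sum_congr rfl fun _ _ => by ring
  simp [h, Matrix.one_apply]

lemma inv_contract_self (hG : IsMetricOn G V) (hu : u ∈ V) :
    ∑ k, ∑ l, (G u)⁻¹ k l * G u k l = n := by
  have h : ∀ k, ∑ l, (G u)⁻¹ k l * G u k l = (1 : Matrix (Fin n) (Fin n) ℝ) k k := by
    intro k
    rw [← hG.inv_mul hu, Matrix.mul_apply]
    exact Finset.sum_congr rfl fun l _ => by rw [hG.symm hu]
  simp [h]

lemma inv_contract_comm (hG : IsMetricOn G V) (hu : u ∈ V) (F : Fin n → Fin n → ℝ) :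
    ∑ k, ∑ l, (G u)⁻¹ k l * F l k = ∑ k, ∑ l, (G u)⁻¹ k l * F k l := by
  rw [Finset.sum_comm]
  exact Finset.sum_congr rfl fun l _ => Finset.sum_congr rfl fun k _ => by rw [hG.inv_symm hu]

/-- The Weyl tensor of a metric with harmonic curvature is divergence free. -/
lemma div_weyl_eq_zero (hV : IsOpen V) (hG : IsMetricOn G V) (hu : u ∈ V)
    (hd : ∀ i j k, divRiem G u i j k = 0) (i j l : Fin n) :
    ∑ k, ∑ p, (G u)⁻¹ k p * covDeriv G (weyl G) u ![p, i, k, j, l] = 0 := by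
  have hs := pd_scal_eq_zero hV hG hu hd
  have hc := nablaRic_codazzi hV hG hu hd
  have h1 : ∑ k, ∑ p, (G u)⁻¹ k p * covDeriv G (riem G) u ![p, i, k, j, l] = 0 := by
    have := hd i j l
    rw [divRiem] at this
    rw [← neg_eq_zero, ← this, ← Finset.sum_neg_distrib]
    refine Finset.sum_congr rfl fun k _ => ?_
    rw [← Finset.sum_neg_distrib]
    refine Finset.sum_congr rfl fun p _ => ?_
    rw [covDeriv_riem_swap_left hV hG hu p k i]
    ring
  have h2 := inv_contract_metric hG hu (fun k => nablaRic G u k i j) l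
  have h3 := inv_contract_metric hG hu (fun k => nablaRic G u k i l) j
  have h4 := contract_nablaRic_eq_zero hV hG hu hd
  rw [← inv_contract_comm hG hu] at h2 h3
  have e : ∀ k p, (G u)⁻¹ k p * covDeriv G (weyl G) u ![p, i, k, j, l] =
      (G u)⁻¹ k p * covDeriv G (riem G) u ![p, i, k, j, l] -
      1 / ((n : ℝ) - 2) * ((G u)⁻¹ k p * (nablaRic G u p i j * G u k l) +
        (G u)⁻¹ k p * nablaRic G u p k l * G u i j -
        (G u)⁻¹ k p * (nablaRic G u p i l * G u k j) -
        (G u)⁻¹ k p * nablaRic G u p k j * G u i l) := by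
    intro k p
    rw [covDeriv_weyl hV hG hu hs]
    ring
  simp only [e, Finset.sum_sub_distrib, ← Finset.mul_sum, Finset.sum_add_distrib,
    ← Finset.sum_mul]
  rw [h1, h2, h3, h4, h4, hc l i j, hc j i l, nablaRic_symm hV hG hu i l j]
  ring

/-- The first term of the Bach tensor vanishes if the curvature is harmonic. -/
lemma divdiv_weyl_eq_zero (hV : IsOpen V) (hG : IsMetricOn G V) (hu : u ∈ V)
    (hd : ∀ v ∈ V, ∀ i j k, divRiem G v i j k = 0) (i j : Fin n) :
    ∑ k, ∑ l, ∑ p, ∑ q, (G u)⁻¹ k p * (G u)⁻¹ l q *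
      covDeriv G (covDeriv G (weyl G)) u ![q, p, i, k, j, l] = 0 := by
  have hsm := covDeriv_smooth hV hG (weyl_smooth hV hG)
  have hz : ∀ v ∈ V, ∀ i j l,
      ∑ p, ∑ k, (G v)⁻¹ p k * covDeriv G (weyl G) v ![p, i, k, j, l] = 0 := by
    intro v hv i j l
    rw [← div_weyl_eq_zero hV hG hv (hd v hv) i j l]
    exact inv_contract_comm hG hv fun k p => covDeriv G (weyl G) v ![p, i, k, j, l]
  have key : ∀ q l, ∑ p, ∑ k, (G u)⁻¹ p k *
      covDeriv G (covDeriv G (weyl G)) u ![q, p, i, k, j, l] = 0 := by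
    intro q l
    have h := contract_nabla2 hV hG hu
      (S := fun v => Matrix.of fun p k => covDeriv G (weyl G) v ![p, i, k, j, l])
      (fun _ _ => hsm _) q
    simp only [nabla2, Matrix.of_apply] at h
    rw [pd_congr_on hV hu (F' := fun _ => 0) (fun v hv => hz v hv i j l), pd_const] at h
    have s : ∀ (x : Fin n → ℝ) (T : Fin n → Fin n → Fin n → ℝ),
        (∀ r, ∑ p, ∑ k, (G u)⁻¹ p k * T r p k = 0) →
        ∑ p, ∑ k, (G u)⁻¹ p k * ∑ r, x r * T r p k = 0 := by
      intro x T hT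
      simp only [Finset.mul_sum]
      rw [← sum_rotate fun r p k => (G u)⁻¹ p k * (x r * T r p k)]
      refine Finset.sum_eq_zero fun r _ => ?_
      rw [← mul_zero (x r), ← hT r, Finset.mul_sum]
      refine Finset.sum_congr rfl fun p _ => ?_
      rw [Finset.mul_sum]
      exact Finset.sum_congr rfl fun k _ => by ring
    have s1 := s (fun r => christoffel G r q i u)
      (fun r p k => covDeriv G (weyl G) u ![p, r, k, j, l]) fun r => hz u hu r j l
    have s2 := s (fun r => christoffel G r q j u)
      (fun r p k => covDeriv G (weyl G) u ![p, i, k, r, l]) fun r => hz u hu i r l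
    have s3 := s (fun r => christoffel G r q l u)
      (fun r p k => covDeriv G (weyl G) u ![p, i, k, j, r]) fun r => hz u hu i j r
    have tot : ∀ (a b c d : Fin n → Fin n → ℝ), ∑ p, ∑ k, a p k = 0 → ∑ p, ∑ k, b p k = 0 →
        ∑ p, ∑ k, c p k = 0 → ∑ p, ∑ k, d p k = 0 →
        ∑ p, ∑ k, (a p k - b p k - c p k - d p k) = 0 := by
      intro a b c d ha hb hc hd
      simp only [Finset.sum_sub_distrib, ha, hb, hc, hd, sub_zero]
    rw [← tot _ _ _ _ h s1 s2 s3]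
    refine Finset.sum_congr rfl fun p _ => Finset.sum_congr rfl fun k _ => ?_
    rw [covDeriv_five]
    ring
  have e : ∑ k, ∑ l, ∑ p, ∑ q, (G u)⁻¹ k p * (G u)⁻¹ l q *
      covDeriv G (covDeriv G (weyl G)) u ![q, p, i, k, j, l] =
      ∑ l, ∑ q, (G u)⁻¹ l q * ∑ p, ∑ k, (G u)⁻¹ p k *
        covDeriv G (covDeriv G (weyl G)) u ![q, p, i, k, j, l] := by
    rw [Finset.sum_comm]
    refine Finset.sum_congr rfl fun l _ => ?_
    rw [← sum_rotate fun q k p => (G u)⁻¹ k p * (G u)⁻¹ l q *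
      covDeriv G (covDeriv G (weyl G)) u ![q, p, i, k, j, l]]
    refine Finset.sum_congr rfl fun q _ => ?_
    rw [Finset.sum_comm, Finset.mul_sum]
    refine Finset.sum_congr rfl fun p _ => ?_
    rw [Finset.mul_sum]
    refine Finset.sum_congr rfl fun k _ => ?_
    rw [hG.inv_symm hu k p]
    ring
  rw [e]
  simp [key]

/-- The Weyl tensor is trace free. -/
lemma trace_weyl_eq_zero (hG : IsMetricOn G V) (hu : u ∈ V) (hn : 3 ≤ n)
    (i j : Fin n) : ∑ k, ∑ l, (G u)⁻¹ k l * weyl G u ![i, k, j, l] = 0 := by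
  have h1 := inv_contract_metric hG hu (fun k => schouten G u k j) i
  have h2 := inv_contract_metric hG hu (fun k => schouten G u i k) j
  have hn' : (3 : ℝ) ≤ n := by exact_mod_cast hn
  have hn1 : (n : ℝ) - 1 ≠ 0 := by linarith
  have hn2 : (n : ℝ) - 2 ≠ 0 := by linarith
  have e : ∀ k l, (G u)⁻¹ k l * weyl G u ![i, k, j, l] =
      (G u)⁻¹ k l * riem G u ![i, k, j, l] - 1 / ((n : ℝ) - 2) *
        ((G u)⁻¹ k l * G u k l * schouten G u i j +
          ((G u)⁻¹ k l * ric G u k l - scal G u / (2 * ((n : ℝ) - 1)) * ((G u)⁻¹ k l * G u k l)) *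
            G u i j -
          (G u)⁻¹ k l * (schouten G u i l * G u k j) -
          (G u)⁻¹ k l * (schouten G u k j * G u l i)) := by
    intro k l
    rw [weyl_apply, hG.symm hu i l]
    simp only [schouten]
    ring
  simp only [e, Finset.sum_sub_distrib, ← Finset.mul_sum, Finset.sum_add_distrib,
    ← Finset.sum_mul]
  have h3 : ∑ k, ∑ l, (G u)⁻¹ k l * (schouten G u i l * G u k j) = schouten G u i j := by
    rw [← h2]
    exact inv_contract_comm hG hu fun k l => schouten G u i k * G u l j
  rw [h1, h3, inv_contract_self hG hu]
  change ric G u i j - 1 / ((n : ℝ) - 2) * (n * schouten G u i j +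
    (scal G u - _) * G u i j - schouten G u i j - schouten G u i j) = 0
  simp only [schouten]
  field_simp
  ring

end Weyl

/-! ### The static equation and the `D`-tensor -/

section Static

variable {n : ℕ} {G : MetricCoeff n} {V : Set (Coord n)} {u : Coord n} {f : Coord n → ℝ}

/-- The contravariant components `f^l = g^lm f_m` of the gradient. -/
def grad (G : MetricCoeff n) (f : Coord n → ℝ) (u : Coord n) (l : Fin n) : ℝ :=
  ∑ m, (G u)⁻¹ l m * pd m f u

lemma sum_metric_mul_grad (hG : IsMetricOn G V) (hu : u ∈ V) (k : Fin n) :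
    ∑ l, G u k l * grad G f u l = pd k f u := by
  have h : (G u).mulVec ((G u)⁻¹.mulVec fun m => pd m f u) = fun m => pd m f u := by
    rw [Matrix.mulVec_mulVec, hG.mul_inv hu, Matrix.one_mulVec]
  exact congrFun h k

/-- The Ricci identity for the third derivatives of a function. -/
lemma nabla2_hess_sub (hV : IsOpen V) (hG : IsMetricOn G V) (hu : u ∈ V)
    (hf : ContDiffOn ℝ ∞ f V) (k j i : Fin n) :
    nabla2 G (fun v => Matrix.of (hess G f v)) u k j i -
      nabla2 G (fun v => Matrix.of (hess G f v)) u j k i = -∑ l, curvOp G l i k j u * pd l f u := by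
  have hΓ := fun p a b => christoffel_smooth hV hG p a b
  have hfd := fun a => ContDiffOn.pd hV hf a
  have hdd := fun a b => ContDiffOn.dAt hV (ContDiffOn.pd hV (hfd a) b) hu
  have hmd := fun p a b => ContDiffOn.dAt hV ((hΓ p a b).mul (hfd p)) hu
  have key : ∀ a b, pd a (fun v => hess G f v b i) u = pd a (pd b (pd i f)) u -
      (∑ p, pd a (christoffel G p b i) u * pd p f u +
        ∑ p, christoffel G p b i u * pd a (pd p f) u) := by
    intro a b
    simp only [hess]
    rw [pd_sub (hdd i b) (DifferentiableAt.fun_sum fun p _ => hmd p b i),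
      pd_sum _ (fun p _ => hmd p b i), ← Finset.sum_add_distrib]
    congr 1
    exact Finset.sum_congr rfl fun p _ =>
      pd_mul (ContDiffOn.dAt hV (hΓ p b i) hu) (ContDiffOn.dAt hV (hfd p) hu) a
  have hsym : ∀ p, christoffel G p j k u = christoffel G p k j u :=
    fun p => christoffel_symm hV hG hu p j k
  simp only [nabla2, Matrix.of_apply, key]
  rw [pd_comm hV (hfd i) hu k j]
  simp only [hsym]
  have e1 : ∀ a b, ∑ p, christoffel G p a i u * hess G f u b p =
      ∑ p, christoffel G p a i u * pd b (pd p f) u -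
        ∑ q, (∑ p, christoffel G q b p u * christoffel G p a i u) * pd q f u := by
    intro a b
    simp only [Finset.sum_mul]
    rw [Finset.sum_comm, ← Finset.sum_sub_distrib]
    refine Finset.sum_congr rfl fun p _ => ?_
    rw [hess, mul_sub, Finset.mul_sum]
    congr 1
    exact Finset.sum_congr rfl fun q _ => by ring
  have e2 : ∑ l, curvOp G l i k j u * pd l f u =
      ∑ l, pd k (christoffel G l j i) u * pd l f u - ∑ l, pd j (christoffel G l k i) u * pd l f u +
      (∑ q, (∑ p, christoffel G q k p u * christoffel G p j i u) * pd q f u -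
        ∑ q, (∑ p, christoffel G q j p u * christoffel G p k i u) * pd q f u) := by
    simp only [← Finset.sum_sub_distrib, ← Finset.sum_add_distrib]
    refine Finset.sum_congr rfl fun l _ => ?_
    rw [curvOp, Finset.sum_sub_distrib]
    ring
  rw [e1, e1, e2]
  ring

/-- In coordinates: `(g, f)` is a vacuum static metric with harmonic curvature on `V`. -/
structure IsStaticOn (G : MetricCoeff n) (f : Coord n → ℝ) (V : Set (Coord n)) : Prop where
  isOpen : IsOpen V
  metric : IsMetricOn G V
  smooth : ContDiffOn ℝ ∞ f V
  hess_eq : ∀ v ∈ V, ∀ i j,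
    hess G f v i j = f v * (ric G v i j - scal G v / ((n : ℝ) - 1) * G v i j)
  div_eq : ∀ v ∈ V, ∀ i j k, divRiem G v i j k = 0

lemma IsStaticOn.nabla2_hess (h : IsStaticOn G f V) (hu : u ∈ V) (k j i : Fin n) :
    nabla2 G (fun v => Matrix.of (hess G f v)) u k j i =
      pd k f u * (ric G u j i - scal G u / ((n : ℝ) - 1) * G u j i) +
        f u * nablaRic G u k j i := by
  obtain ⟨hV, hG, hf, hst, hd⟩ := h
  have hg := nabla2_metric hV hG hu k j i
  have hs := pd_scal_eq_zero hV hG hu (hd u hu) k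
  have hfd := ContDiffOn.dAt hV hf hu
  have hrd := ContDiffOn.dAt hV (ric_smooth hV hG j i) hu
  have hSd := ContDiffOn.dAt hV ((scal_smooth hV hG).div_const ((n : ℝ) - 1)) hu
  have hGd := ContDiffOn.dAt hV (hG.1 j i) hu
  have h0 : pd k (fun v => scal G v / ((n : ℝ) - 1)) u = 0 := by
    simp only [div_eq_inv_mul]
    rw [pd_const_mul (ContDiffOn.dAt hV (scal_smooth hV hG) hu), hs, mul_zero]
  simp only [nabla2, nablaRic, Matrix.of_apply] at hg ⊢
  rw [pd_congr_on hV hu (fun v hv => hst v hv j i), pd_mul hfd (hrd.fun_sub (hSd.fun_mul hGd)),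
    pd_sub hrd (hSd.fun_mul hGd), pd_mul hSd hGd, h0]
  simp only [hst u hu]
  have e : ∀ (x r g : Fin n → ℝ) (a c : ℝ), ∑ p, x p * (a * (r p - c * g p)) =
      a * (∑ p, x p * r p - c * ∑ p, x p * g p) := by
    intro x r g a c
    simp only [Finset.mul_sum]
    rw [← Finset.sum_sub_distrib, Finset.mul_sum]
    exact Finset.sum_congr rfl fun _ _ => by ring
  rw [e, e]
  linear_combination -(f u * (scal G u / ((n : ℝ) - 1))) * hg

/-- Commuting third derivatives of `f` expresses `R(·,·)∇f` through the Ricci tensor. -/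
lemma IsStaticOn.riem_grad (h : IsStaticOn G f V) (hu : u ∈ V) (i j k : Fin n) :
    ∑ l, riem G u ![j, k, i, l] * grad G f u l =
      pd j f u * (ric G u k i - scal G u / ((n : ℝ) - 1) * G u k i) -
        pd k f u * (ric G u j i - scal G u / ((n : ℝ) - 1) * G u j i) := by
  obtain ⟨hV, hG, hf, hst, hd⟩ := id h
  have h1 := nabla2_hess_sub hV hG hu hf k j i
  rw [h.nabla2_hess hu, h.nabla2_hess hu, nablaRic_codazzi hV hG hu (hd u hu) k j i] at h1
  have h2 : ∑ l, riem G u ![j, k, i, l] * grad G f u l = ∑ p, curvOp G p i k j u * pd p f u := by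
    have e : ∀ l, riem G u ![j, k, i, l] * grad G f u l =
        ∑ p, curvOp G p i k j u * (G u p l * grad G f u l) := by
      intro l
      rw [riem_swap_right hV hG hu j k l i, riem_swap_left k j, riem_apply, Matrix.mul_apply,
        neg_neg, Finset.sum_mul]
      refine Finset.sum_congr rfl fun p _ => ?_
      rw [hG.symm hu p l]
      simp only [curvM, Matrix.of_apply]
      ring
    simp only [e]
    rw [Finset.sum_comm]
    refine Finset.sum_congr rfl fun p _ => ?_
    rw [← Finset.mul_sum, sum_metric_mul_grad hG hu]
  rw [h2]
  linarith

lemma dTensor_eq (hV : IsOpen V) (hG : IsMetricOn G V) (hu : u ∈ V) (i j k : Fin n) :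
    dTensor G f u i j k =
      ((n : ℝ) - 1) / ((n : ℝ) - 2) * (ric G u i k * pd j f u - ric G u i j * pd k f u) +
      scal G u / ((n : ℝ) - 2) * (pd k f u * G u i j - pd j f u * G u i k) +
      1 / ((n : ℝ) - 2) * ((∑ l, ric G u j l * grad G f u l) * G u i k -
        (∑ l, ric G u k l * grad G f u l) * G u i j) := by
  rw [dTensor]
  congr 2
  rw [Finset.sum_mul, Finset.sum_mul, ← Finset.sum_sub_distrib]
  refine Finset.sum_congr rfl fun l _ => ?_
  rw [← Finset.sum_mul, ric_symm hV hG hu l j, ric_symm hV hG hu l k, ← grad]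
  ring

/-- For harmonic curvature, the `D`-tensor is the Weyl tensor contracted with `∇f`. -/
lemma IsStaticOn.weyl_grad (h : IsStaticOn G f V) (hn : 3 ≤ n) (hu : u ∈ V) (i j k : Fin n) :
    ∑ l, weyl G u ![j, k, i, l] * grad G f u l = dTensor G f u i j k := by
  obtain ⟨hV, hG, hf, hst, hd⟩ := id h
  have hn' : (3 : ℝ) ≤ n := by exact_mod_cast hn
  have hn1 : (n : ℝ) - 1 ≠ 0 := by linarith
  have hn2 : (n : ℝ) - 2 ≠ 0 := by linarith
  have e : ∀ l, weyl G u ![j, k, i, l] * grad G f u l =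
      riem G u ![j, k, i, l] * grad G f u l - 1 / ((n : ℝ) - 2) *
        (schouten G u j i * (G u k l * grad G f u l) +
          G u j i * (ric G u k l * grad G f u l -
            scal G u / (2 * ((n : ℝ) - 1)) * (G u k l * grad G f u l)) -
          G u k i * (ric G u j l * grad G f u l -
            scal G u / (2 * ((n : ℝ) - 1)) * (G u j l * grad G f u l)) -
          schouten G u k i * (G u j l * grad G f u l)) := by
    intro l
    rw [weyl_apply]
    simp only [schouten]
    ring
  simp only [e, Finset.sum_sub_distrib, ← Finset.mul_sum, Finset.sum_add_distrib]
  rw [h.riem_grad hu, sum_metric_mul_grad hG hu, sum_metric_mul_grad hG hu,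
    dTensor_eq hV hG hu, hG.symm hu j i, hG.symm hu k i, ric_symm hV hG hu i j,
    ric_symm hV hG hu i k]
  simp only [schouten]
  rw [hG.symm hu j i, hG.symm hu k i]
  field_simp
  ring

/-- `∇f` is an eigenvector of the Ricci tensor: `Ric(∇f) ∧ df = 0`. -/
lemma IsStaticOn.ric_grad_wedge (h : IsStaticOn G f V) (hu : u ∈ V) (j k : Fin n) :
    (∑ l, ric G u j l * grad G f u l) * pd k f u =
      (∑ l, ric G u k l * grad G f u l) * pd j f u := by
  obtain ⟨hV, hG, hf, hst, hd⟩ := id h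
  have h0 : ∑ i, (∑ l, riem G u ![j, k, i, l] * grad G f u l) * grad G f u i = 0 := by
    have : ∀ S : ℝ, S = -S → S = 0 := fun S hS => by linarith
    apply this
    simp only [Finset.sum_mul]
    rw [← Finset.sum_neg_distrib, Finset.sum_comm]
    refine Finset.sum_congr rfl fun l _ => ?_
    rw [← Finset.sum_neg_distrib]
    refine Finset.sum_congr rfl fun i _ => ?_
    rw [riem_swap_right hV hG hu j k l i]
    ring
  have e : ∀ i, (∑ l, riem G u ![j, k, i, l] * grad G f u l) * grad G f u i =
      pd j f u * (ric G u k i * grad G f u i -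
        scal G u / ((n : ℝ) - 1) * (G u k i * grad G f u i)) -
      pd k f u * (ric G u j i * grad G f u i -
        scal G u / ((n : ℝ) - 1) * (G u j i * grad G f u i)) := by
    intro i
    rw [h.riem_grad hu]
    ring
  simp only [e, Finset.sum_sub_distrib, ← Finset.mul_sum] at h0
  rw [sum_metric_mul_grad hG hu, sum_metric_mul_grad hG hu] at h0
  linarith

end Static

/-! ### Eigenvalues of a symmetric matrix relative to a positive definite one -/

section RelativeEigenvalues

open scoped MatrixOrder Matrix.Norms.L2Operator

variable {n : ℕ}

/-- Simultaneous diagonalisation: a symmetric matrix has a basis of eigenvectors relative to a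
positive definite one. -/
lemma exists_relative_eigenbasis {g S : Matrix (Fin n) (Fin n) ℝ} (hg : g.PosDef)
    (hS : S.transpose = S) :
    ∃ (w : Module.Basis (Fin n) ℝ (Fin n → ℝ)) (c : Fin n → ℝ),
      ∀ i, S.mulVec (w i) = c i • g.mulVec (w i) := by
  obtain ⟨B, hB⟩ := CStarAlgebra.nonneg_iff_eq_star_mul_self.mp hg.posSemidef.nonneg
  rw [Matrix.star_eq_conjTranspose, Matrix.conjTranspose_eq_transpose_of_trivial] at hB
  have hdet : IsUnit B.det := by
    have := hg.det_pos.ne'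
    rw [hB, Matrix.det_mul, Matrix.det_transpose] at this
    exact isUnit_iff_ne_zero.2 fun h => this (by rw [h, zero_mul])
  have hT : IsUnit B.transpose.det := by rwa [Matrix.det_transpose]
  set P := B⁻¹.transpose * S * B⁻¹ with hP
  have hPH : P.IsHermitian := by
    rw [Matrix.IsHermitian, Matrix.conjTranspose_eq_transpose_of_trivial, hP]
    simp only [Matrix.transpose_mul, Matrix.transpose_transpose, hS, mul_assoc]
  have hBinv : B⁻¹.det ≠ 0 := by
    simpa [Matrix.det_nonsing_inv] using hdet.ne_zero
  let e : (Fin n → ℝ) ≃ₗ[ℝ] (Fin n → ℝ) :=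
    Matrix.toLinearEquiv' B⁻¹ (Matrix.invertibleOfIsUnitDet _ (isUnit_iff_ne_zero.2 hBinv))
  let b := (hPH.eigenvectorBasis.toBasis.map (WithLp.linearEquiv 2 ℝ (Fin n → ℝ))).map e
  refine ⟨b, hPH.eigenvalues, fun i => ?_⟩
  have hb : b i = B⁻¹.mulVec (WithLp.ofLp (hPH.eigenvectorBasis i)) := by
    simp [b, e, Matrix.toLinearEquiv']
  have h1 := hPH.mulVec_eigenvectorBasis i
  have h2 : S * B⁻¹ = B.transpose * P := by
    rw [hP, ← mul_assoc, ← mul_assoc, ← Matrix.transpose_mul, Matrix.nonsing_inv_mul _ hdet]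
    simp
  have h3 : g * B⁻¹ = B.transpose := by
    rw [hB, mul_assoc, Matrix.mul_nonsing_inv _ hdet, mul_one]
  rw [hb, Matrix.mulVec_mulVec, Matrix.mulVec_mulVec, h2, h3, ← Matrix.mulVec_mulVec, h1,
    Matrix.mulVec_smul]

lemma relative_eigenvalues_eq_range {g S : Matrix (Fin n) (Fin n) ℝ} (hg : g.PosDef)
    {w : Module.Basis (Fin n) ℝ (Fin n → ℝ)} {c : Fin n → ℝ}
    (hw : ∀ i, S.mulVec (w i) = c i • g.mulVec (w i)) :
    {d : ℝ | ∃ X : Fin n → ℝ, X ≠ 0 ∧ S.mulVec X = d • g.mulVec X} = Set.range c := by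
  ext d
  constructor
  · rintro ⟨X, hX, h⟩
    by_contra hd
    apply hX
    have hu : IsUnit g := by
      rw [Matrix.isUnit_iff_isUnit_det]; exact isUnit_iff_ne_zero.2 hg.det_pos.ne'
    have h1 : g.mulVec (∑ i, ((c i - d) * w.repr X i) • w i) = 0 := by
      have h2 : S.mulVec X = ∑ i, w.repr X i • c i • g.mulVec (w i) := by
        conv_lhs => rw [← w.sum_repr X]
        simp only [Matrix.mulVec_sum, Matrix.mulVec_smul, hw]
      have h3 : g.mulVec X = ∑ i, w.repr X i • g.mulVec (w i) := by
        conv_lhs => rw [← w.sum_repr X]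
        simp only [Matrix.mulVec_sum, Matrix.mulVec_smul]
      rw [h2, h3, ← sub_eq_zero, Finset.smul_sum, ← Finset.sum_sub_distrib] at h
      rw [← h]
      simp only [Matrix.mulVec_sum, Matrix.mulVec_smul]
      refine Finset.sum_congr rfl fun i _ => ?_
      module
    have h4 : ∑ i, ((c i - d) * w.repr X i) • w i = 0 :=
      Matrix.mulVec_injective_iff_isUnit.2 hu (by rw [h1, Matrix.mulVec_zero])
    have h5 := Fintype.linearIndependent_iff.1 w.linearIndependent _ h4
    rw [← w.sum_repr X]
    refine Finset.sum_eq_zero fun i _ => ?_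
    have h6 : c i - d ≠ 0 := fun h => hd ⟨i, sub_eq_zero.1 h⟩
    rw [(mul_eq_zero.1 (h5 i)).resolve_left h6, zero_smul]
  · rintro ⟨i, rfl⟩
    exact ⟨w i, w.ne_zero i, hw i⟩

/-- The powers `1, A, …, A^{k-1}` of `A = g⁻¹ S` are linearly independent if and only if there are
at least `k` eigenvalues of `S` relative to `g`. -/
lemma linearIndependent_pow_iff {g S : Matrix (Fin n) (Fin n) ℝ} (hg : g.PosDef)
    (hS : S.transpose = S) (k : ℕ) :
    LinearIndependent ℝ (fun i : Fin k => (g⁻¹ * S) ^ (i : ℕ)) ↔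
      k ≤ {d : ℝ | ∃ X : Fin n → ℝ, X ≠ 0 ∧ S.mulVec X = d • g.mulVec X}.ncard := by
  obtain ⟨w, c, hw⟩ := exists_relative_eigenbasis hg hS
  rw [relative_eigenvalues_eq_range hg hw]
  set A := g⁻¹ * S with hA
  have hdet : IsUnit g.det := isUnit_iff_ne_zero.2 hg.det_pos.ne'
  have hAw : ∀ i, A.mulVec (w i) = c i • w i := by
    intro i
    rw [hA, ← Matrix.mulVec_mulVec, hw, Matrix.mulVec_smul, Matrix.mulVec_mulVec,
      Matrix.nonsing_inv_mul _ hdet, Matrix.one_mulVec]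
  have hpow : ∀ (m : ℕ) i, (A ^ m).mulVec (w i) = c i ^ m • w i := by
    intro m i
    induction m with
    | zero => simp
    | succ m ih =>
      rw [pow_succ', ← Matrix.mulVec_mulVec, ih, Matrix.mulVec_smul, hAw, smul_smul, pow_succ]
  have hpoly : ∀ (p : Polynomial ℝ) i,
      (Polynomial.aeval A p).mulVec (w i) = p.eval (c i) • w i := by
    intro p i
    rw [Polynomial.aeval_eq_sum_range, Polynomial.eval_eq_sum_range, Matrix.sum_mulVec,
      Finset.sum_smul]
    refine Finset.sum_congr rfl fun m _ => ?_
    rw [Matrix.smul_mulVec, hpow, smul_smul]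
  have hcard : (Set.range c).ncard = (Finset.univ.image c).card := by
    rw [← Set.ncard_coe_finset]; simp
  rw [hcard]
  constructor
  · intro hli
    by_contra! hlt
    -- The product of the linear factors `X - d` over the eigenvalues `d` annihilates `A`.
    let p : Polynomial ℝ := ∏ d ∈ Finset.univ.image c, (Polynomial.X - Polynomial.C d)
    have hpm : p.Monic := Polynomial.monic_prod_of_monic _ _ fun d _ => Polynomial.monic_X_sub_C d
    have hpd : p.natDegree = (Finset.univ.image c).card := by
      simp [p]
    have hp0 : Polynomial.aeval A p = 0 := by
      apply Matrix.toLin'.injective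
      refine w.ext fun i => ?_
      rw [Matrix.toLin'_apply, hpoly]
      have : p.eval (c i) = 0 := by
        rw [Polynomial.eval_prod]
        exact Finset.prod_eq_zero (Finset.mem_image_of_mem c (Finset.mem_univ i)) (by simp)
      simp [this]
    rw [Polynomial.aeval_eq_sum_range' (hpd.trans_lt hlt),
      ← Fin.sum_univ_eq_sum_range fun i => p.coeff i • A ^ i] at hp0
    have := Fintype.linearIndependent_iff.1 hli _ hp0 ⟨p.natDegree, hpd.trans_lt hlt⟩
    have h1 : p.coeff p.natDegree = 1 := hpm.coeff_natDegree
    exact one_ne_zero (h1.symm.trans this)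
  · intro hk
    rw [Fintype.linearIndependent_iff]
    intro a ha
    -- A relation between the powers is a polynomial of degree `< k` vanishing at all eigenvalues.
    let p : Polynomial ℝ := ∑ i : Fin k, Polynomial.C (a i) * Polynomial.X ^ (i : ℕ)
    have hp : Polynomial.aeval A p = 0 := by
      simp only [p, map_sum, map_mul, Polynomial.aeval_C, map_pow, Polynomial.aeval_X]
      rw [← ha]
      exact Finset.sum_congr rfl fun i _ => (Algebra.smul_def _ _).symm
    have hroot : ∀ d ∈ Finset.univ.image c, p.eval d = 0 := by
      intro d hd
      obtain ⟨i, -, rfl⟩ := Finset.mem_image.1 hd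
      have h := hpoly p i
      rw [hp, Matrix.zero_mulVec] at h
      exact (smul_eq_zero.1 h.symm).resolve_right (w.ne_zero i)
    have hdeg : p.degree < (Finset.univ.image c).card :=
      (Polynomial.degree_sum_fin_lt a).trans_le (by exact_mod_cast hk)
    have hz : p = 0 := Polynomial.eq_zero_of_degree_lt_of_eval_finset_eq_zero _ hdeg hroot
    intro i
    have h1 : p.coeff i = a i := by
      simp [p, Polynomial.coeff_C_mul, Polynomial.coeff_X_pow, Fin.val_inj]
    rw [← h1, hz, Polynomial.coeff_zero]

end RelativeEigenvalues

/-! ### The Ricci eigenvalues and the `D`-tensor -/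

section RicciEigenvalues

variable {n : ℕ} {G : MetricCoeff n} {V : Set (Coord n)} {u : Coord n} {f : Coord n → ℝ}

lemma ric_transpose (hV : IsOpen V) (hG : IsMetricOn G V) (hu : u ∈ V) :
    (Matrix.of (ric G u)).transpose = Matrix.of (ric G u) := by
  ext i j; exact ric_symm hV hG hu j i

lemma isRicciEigenvector_iff (hV : IsOpen V) (hG : IsMetricOn G V) (hu : u ∈ V) (c : ℝ)
    (X : Fin n → ℝ) : IsRicciEigenvector G u c X ↔
      X ≠ 0 ∧ (Matrix.of (ric G u)).mulVec X = c • (G u).mulVec X := by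
  rw [IsRicciEigenvector, funext_iff]
  refine and_congr_right fun _ => forall_congr' fun j => ?_
  simp only [Matrix.mulVec, dotProduct, Matrix.of_apply, Pi.smul_apply, smul_eq_mul,
    ric_symm hV hG hu j, hG.symm hu j]

lemma ricciEigenvalueCount_eq (hV : IsOpen V) (hG : IsMetricOn G V) (hu : u ∈ V) :
    ricciEigenvalueCount G u = {d : ℝ | ∃ X : Fin n → ℝ, X ≠ 0 ∧
      (Matrix.of (ric G u)).mulVec X = d • (G u).mulVec X}.ncard := by
  simp only [ricciEigenvalueCount, isRicciEigenvector_iff hV hG hu]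

lemma ricciEigenvalueCount_le (hV : IsOpen V) (hG : IsMetricOn G V) (hu : u ∈ V) :
    ricciEigenvalueCount G u ≤ n := by
  rw [ricciEigenvalueCount_eq hV hG hu]
  obtain ⟨w, c, hw⟩ := exists_relative_eigenbasis (hG.2 u hu) (ric_transpose hV hG hu)
  rw [relative_eigenvalues_eq_range (hG.2 u hu) hw, ← Set.image_univ]
  exact (Set.ncard_image_le Set.finite_univ).trans (by simp [Set.ncard_univ])

open scoped Matrix.Norms.Elementwise in
/-- The number of distinct Ricci eigenvalues is lower semicontinuous: by
`linearIndependent_pow_iff` it is bounded below by `k` exactly where finitely many continuous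
fields of matrices are linearly independent, which is an open condition. -/
lemma eventually_le_ricciEigenvalueCount (hV : IsOpen V) (hG : IsMetricOn G V) (hu : u ∈ V) :
    ∀ᶠ v in 𝓝 u, ricciEigenvalueCount G u ≤ ricciEigenvalueCount G v := by
  have hcont : ContinuousAt (fun v => fun i : Fin (ricciEigenvalueCount G u) =>
      ((G v)⁻¹ * Matrix.of (ric G v)) ^ (i : ℕ)) u := by
    have hA : ContinuousAt (fun v => (G v)⁻¹ * Matrix.of (ric G v)) u := by
      refine continuousAt_pi.2 fun i => continuousAt_pi.2 fun j => ?_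
      exact ((hG.inv_smooth.mul (F' := fun v => Matrix.of (ric G v)) (ric_smooth hV hG)
        i j).contDiffAt (hV.mem_nhds hu)).continuousAt
    exact continuousAt_pi.2 fun i => hA.pow _
  have h0 : LinearIndependent ℝ (fun i : Fin (ricciEigenvalueCount G u) =>
      ((G u)⁻¹ * Matrix.of (ric G u)) ^ (i : ℕ)) := by
    rw [linearIndependent_pow_iff (hG.2 u hu) (ric_transpose hV hG hu),
      ricciEigenvalueCount_eq hV hG hu]
  filter_upwards [hcont.eventually h0.eventually, hV.mem_nhds hu] with v hv hvV
  rw [ricciEigenvalueCount_eq hV hG hvV,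
    ← linearIndependent_pow_iff (hG.2 v hvV) (ric_transpose hV hG hvV)]
  exact hv

/-- Points near which the number of distinct Ricci eigenvalues is constant are dense. -/
lemma exists_isRicciRegularAt (hV : IsOpen V) (hG : IsMetricOn G V) {W : Set (Coord n)}
    (hW : IsOpen W) (hWV : W ⊆ V) (hne : W.Nonempty) : ∃ v ∈ W, IsRicciRegularAt G v := by
  obtain ⟨w, hw⟩ := hne
  -- The count is constant near a point of `W` where it is maximal.
  let S : Set ℕ := ricciEigenvalueCount G '' W
  have hb : BddAbove S := ⟨n, by
    rintro _ ⟨v, hv, rfl⟩; exact ricciEigenvalueCount_le hV hG (hWV hv)⟩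
  obtain ⟨v, hv, hmax⟩ := Nat.sSup_mem (s := S) ⟨_, w, hw, rfl⟩ hb
  refine ⟨v, hv, ?_⟩
  filter_upwards [eventually_le_ricciEigenvalueCount hV hG (hWV hv), hW.mem_nhds hv] with z hz hzW
  refine le_antisymm ?_ hz
  rw [hmax]
  exact le_csSup hb ⟨z, hzW, rfl⟩

/-- `Ric = a g + b df ⊗ df` at the point: where `∇f ≠ 0`, this says that `∇f` is a Ricci eigenvector
and that all directions orthogonal to it have the same Ricci eigenvalue. -/
def IsRicciQuasiEinsteinAt (G : MetricCoeff n) (f : Coord n → ℝ) (u : Coord n) : Prop :=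
  ∃ a b : ℝ, ∀ i j, ric G u i j = a * G u i j + b * (pd i f u * pd j f u)

lemma sum_pd_mul_grad_pos (hG : IsMetricOn G V) (hu : u ∈ V) {k : Fin n} (hk : pd k f u ≠ 0) :
    0 < ∑ i, pd i f u * grad G f u i := by
  have h := (hG.2 u hu).inv.dotProduct_mulVec_pos (x := fun i => pd i f u)
    (fun h => hk (congrFun h k))
  simpa [dotProduct, Matrix.mulVec, grad] using h

/-- `∇f` is a Ricci eigenvector. -/
lemma IsStaticOn.exists_ric_grad (h : IsStaticOn G f V) (hu : u ∈ V) {k : Fin n}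
    (hk : pd k f u ≠ 0) : ∃ μ : ℝ, ∀ j, ∑ l, ric G u j l * grad G f u l = μ * pd j f u :=
  ⟨(∑ l, ric G u k l * grad G f u l) / pd k f u, fun j => by
    rw [div_mul_eq_mul_div, eq_div_iff hk, h.ric_grad_wedge hu]⟩

/-- The projections of a Ricci eigenbasis to the orthogonal complement of `∇f` are again
eigenvectors or zero, so they all belong to one eigenvalue `a`; hence `Ric - a g` is a
multiple of `df ⊗ df`. -/
lemma IsStaticOn.isRicciQuasiEinsteinAt (h : IsStaticOn G f V) (hu : u ∈ V) {k : Fin n}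
    (hk : pd k f u ≠ 0) (hT : TransverseRicciEigenvaluesEqual G f u) :
    IsRicciQuasiEinsteinAt G f u := by
  obtain ⟨hV, hG, -, -, -⟩ := id h
  obtain ⟨μ, hμ⟩ := h.exists_ric_grad hu hk
  set Z := grad G f u with hZ
  set R := Matrix.of (ric G u) with hR
  set df : (Fin n → ℝ) →ₗ[ℝ] ℝ := Fintype.linearCombination ℝ (fun i => pd i f u) with hdf
  have hdf' : ∀ X, df X = ∑ i, X i * pd i f u := fun X => by
    simp [hdf, Fintype.linearCombination_apply]
  set N := ∑ i, pd i f u * Z i with hN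
  have hNpos : 0 < N := sum_pd_mul_grad_pos hG hu hk
  have hdZ : df Z = N := by
    rw [hdf']; exact Finset.sum_congr rfl fun _ _ => mul_comm _ _
  have hGZ : (G u).mulVec Z = fun i => pd i f u := by
    ext i; exact sum_metric_mul_grad hG hu i
  have hRZ : R.mulVec Z = μ • (G u).mulVec Z := by
    rw [hGZ]; ext j; exact hμ j
  obtain ⟨w, c, hw⟩ : ∃ (w : Module.Basis (Fin n) ℝ (Fin n → ℝ)) (c : Fin n → ℝ),
      ∀ i, R.mulVec (w i) = c i • (G u).mulVec (w i) :=
    exists_relative_eigenbasis (hG.2 u hu) (ric_transpose hV hG hu)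
  set w' : Fin n → Fin n → ℝ := fun i => w i - (df (w i) / N) • Z with hw'
  have hdw' : ∀ i, df (w' i) = 0 := fun i => by
    simp only [hw', map_sub, map_smul, hdZ, smul_eq_mul]
    field_simp
    ring
  have hcμ : ∀ i, (c i - μ) * df (w i) = 0 := by
    intro i
    have h1 : dotProduct Z (R.mulVec (w i)) = c i * df (w i) := by
      rw [hw, dotProduct_smul, Matrix.dotProduct_mulVec, ← Matrix.mulVec_transpose,
        hG.transpose hu, hGZ, hdf', smul_eq_mul]
      congr 1
      exact Finset.sum_congr rfl fun _ _ => mul_comm _ _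
    have h2 : dotProduct Z (R.mulVec (w i)) = μ * df (w i) := by
      rw [Matrix.dotProduct_mulVec, ← Matrix.mulVec_transpose, ric_transpose hV hG hu, hRZ,
        smul_dotProduct, hGZ, hdf', smul_eq_mul]
      congr 1
      exact Finset.sum_congr rfl fun _ _ => mul_comm _ _
    linarith
  have hRw' : ∀ i, R.mulVec (w' i) = c i • (G u).mulVec (w' i) := by
    intro i
    simp only [hw', Matrix.mulVec_sub, Matrix.mulVec_smul, hRZ, hw, smul_sub, smul_smul]
    congr 2
    linear_combination (-1 / N) * hcμ i
  obtain ⟨a, ha⟩ : ∃ a : ℝ, ∀ i, R.mulVec (w' i) = a • (G u).mulVec (w' i) := by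
    by_cases hex : ∃ i, w' i ≠ 0
    · obtain ⟨i₀, hi₀⟩ := hex
      refine ⟨c i₀, fun i => ?_⟩
      by_cases hi : w' i = 0
      · simp [hi]
      · rw [hT (w' i₀) (w' i) (c i₀) (c i)
          ((isRicciEigenvector_iff hV hG hu _ _).2 ⟨hi₀, hRw' i₀⟩)
          ((isRicciEigenvector_iff hV hG hu _ _).2 ⟨hi, hRw' i⟩)
          (by rw [← hdf', hdw']) (by rw [← hdf', hdw'])]
        exact hRw' i
    · push Not at hex
      exact ⟨0, fun i => by simp [hex i]⟩
  have hall : ∀ X, R.mulVec X = a • (G u).mulVec X +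
      ((μ - a) / N * df X) • (G u).mulVec Z := by
    intro X
    let T : (Fin n → ℝ) →ₗ[ℝ] (Fin n → ℝ) := a • (G u).mulVecLin +
      ((μ - a) / N) • df.smulRight ((G u).mulVec Z)
    have hT : R.mulVecLin = T := by
      refine w.ext fun i => ?_
      have hwi : w i = w' i + (df (w i) / N) • Z := by simp [hw']
      simp only [T, LinearMap.add_apply, LinearMap.smul_apply, LinearMap.smulRight_apply,
        Matrix.mulVecLin_apply]
      rw [hwi]
      simp only [Matrix.mulVec_add, Matrix.mulVec_smul, ha, hRZ, map_add, map_smul, hdw', hdZ,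
        smul_eq_mul, smul_add, smul_smul, zero_add]
      rw [add_assoc, ← add_smul]
      congr 2
      field_simp
      ring
    have := LinearMap.congr_fun hT X
    simpa [T, smul_smul] using this
  refine ⟨a, (μ - a) / N, fun i j => ?_⟩
  have h1 := congrFun (hall (Pi.single j 1)) i
  rw [hGZ, hdf'] at h1
  simp [Matrix.mulVec_single, Pi.single_apply] at h1
  change R i j = _
  rw [h1]
  ring

lemma scal_eq_of_quasiEinstein (hG : IsMetricOn G V) (hu : u ∈ V) {a b : ℝ}
    (hab : ∀ i j, ric G u i j = a * G u i j + b * (pd i f u * pd j f u)) :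
    scal G u = n * a + b * ∑ i, pd i f u * grad G f u i := by
  have e : ∀ i j, (G u)⁻¹ i j * ric G u i j = a * ((G u)⁻¹ i j * G u i j) +
      b * (pd i f u * ((G u)⁻¹ i j * pd j f u)) := by
    intro i j; rw [hab]; ring
  simp only [scal, e, Finset.sum_add_distrib, ← Finset.mul_sum]
  rw [inv_contract_self hG hu]
  simp only [grad]
  ring

lemma dTensor_eq_zero_of_quasiEinstein (hV : IsOpen V) (hG : IsMetricOn G V) (hu : u ∈ V)
    (hn : 3 ≤ n) (hq : IsRicciQuasiEinsteinAt G f u) (i j k : Fin n) :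
    dTensor G f u i j k = 0 := by
  obtain ⟨a, b, hab⟩ := hq
  have hn' : (3 : ℝ) ≤ n := by exact_mod_cast hn
  have hn2 : (n : ℝ) - 2 ≠ 0 := by linarith
  have hr : ∀ j, ∑ l, ric G u j l * grad G f u l =
      (a + b * ∑ i, pd i f u * grad G f u i) * pd j f u := by
    intro j
    have e : ∀ l, ric G u j l * grad G f u l = a * (G u j l * grad G f u l) +
        b * pd j f u * (pd l f u * grad G f u l) := by
      intro l; rw [hab]; ring
    simp only [e, Finset.sum_add_distrib, ← Finset.mul_sum]
    rw [sum_metric_mul_grad hG hu]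
    ring
  rw [dTensor_eq hV hG hu, hr, hr, scal_eq_of_quasiEinstein hG hu hab, hab, hab]
  field_simp
  ring

/-- Where `∇f ≠ 0`, vanishing of the `D`-tensor means that the Ricci eigenvalues transverse to
`∇f` coincide. -/
lemma IsStaticOn.isRicciQuasiEinsteinAt_of_dTensor (h : IsStaticOn G f V) (hn : 3 ≤ n)
    (hu : u ∈ V) {k : Fin n} (hk : pd k f u ≠ 0) (hD : ∀ i j k, dTensor G f u i j k = 0) :
    IsRicciQuasiEinsteinAt G f u := by
  obtain ⟨hV, hG, -, -, -⟩ := id h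
  obtain ⟨μ, hμ⟩ := h.exists_ric_grad hu hk
  have hn' : (3 : ℝ) ≤ n := by exact_mod_cast hn
  have hn1 : (n : ℝ) - 1 ≠ 0 := by linarith
  have hn2 : (n : ℝ) - 2 ≠ 0 := by linarith
  let T : Fin n → Fin n → ℝ := fun i j => ((n : ℝ) - 1) * ric G u i j - (scal G u - μ) * G u i j
  have hT : ∀ i j, T i j = T j i := fun i j => by
    simp only [T]; rw [ric_symm hV hG hu, hG.symm hu]
  have hx : ∀ i j l, pd j f u * T i l = pd l f u * T i j := by
    intro i j l
    have h1 := hD i j l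
    rw [dTensor_eq hV hG hu, hμ, hμ] at h1
    field_simp at h1
    simp only [T]
    linarith
  refine ⟨(scal G u - μ) / ((n : ℝ) - 1), T k k / (((n : ℝ) - 1) * (pd k f u) ^ 2),
    fun i j => ?_⟩
  have h1 : T i j = T k k / (pd k f u) ^ 2 * (pd i f u * pd j f u) := by
    have e1 := hx i k j
    have e2 := hx k k i
    rw [hT k i] at e2
    field_simp
    linear_combination (pd k f u) * e1 + pd j f u * e2
  have h2 : ((n : ℝ) - 1) * ric G u i j = (scal G u - μ) * G u i j + T i j := by
    simp only [T]; ring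
  rw [h1] at h2
  field_simp at h2 ⊢
  linear_combination h2

/-- If the transverse Ricci eigenvalues coincide at all regular points of an open set, then the
`D`-tensor vanishes there: otherwise it is nonzero on a nonempty open set, which contains a point
near which the number of Ricci eigenvalues is constant. -/
lemma IsStaticOn.dTensor_eq_zero (h : IsStaticOn G f V) (hn : 3 ≤ n) {W : Set (Coord n)}
    (hW : IsOpen W) (hWV : W ⊆ V)
    (hT : ∀ v ∈ W, (∃ k, pd k f v ≠ 0) → IsRicciRegularAt G v →
      TransverseRicciEigenvaluesEqual G f v) (hu : u ∈ W) (i j k : Fin n) :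
    dTensor G f u i j k = 0 := by
  obtain ⟨hV, hG, hf, -, -⟩ := id h
  by_contra hne
  have hcont : ContinuousOn (fun v => dTensor G f v i j k) W := by
    have hp := fun a => (ContDiffOn.pd hV hf a).continuousOn.mono hWV
    have hr := fun a b => (ric_smooth hV hG a b).continuousOn.mono hWV
    have hg := fun a b => (hG.1 a b).continuousOn.mono hWV
    have hi := fun a b => (hG.inv_smooth a b).continuousOn.mono hWV
    have hs := (scal_smooth hV hG).continuousOn.mono hWV
    unfold dTensor
    refine ((continuousOn_const.mul (((hr i k).mul (hp j)).sub ((hr i j).mul (hp k)))).add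
      ((hs.div_const _).mul (((hp k).mul (hg i j)).sub ((hp j).mul (hg i k))))).add
      (continuousOn_const.mul ?_)
    exact continuousOn_finsetSum _ fun l _ => continuousOn_finsetSum _ fun m _ =>
      ((hi l m).mul (hp m)).mul (((hr l j).mul (hg i k)).sub ((hr l k).mul (hg i j)))
  have hO : IsOpen {v ∈ W | dTensor G f v i j k ≠ 0} :=
    hcont.isOpen_inter_preimage hW isOpen_ne
  obtain ⟨v, ⟨hvW, hvD⟩, hreg⟩ := exists_isRicciRegularAt hV hG hO
    (fun v hv => hWV hv.1) ⟨u, hu, hne⟩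
  by_cases hz : ∃ k, pd k f v ≠ 0
  · obtain ⟨l, hl⟩ := id hz
    exact hvD (dTensor_eq_zero_of_quasiEinstein hV hG (hWV hvW) hn
      (h.isRicciQuasiEinsteinAt (hWV hvW) hl (hT v hvW hz hreg)) i j k)
  · push Not at hz
    exact hvD (by simp [dTensor, hz])

end RicciEigenvalues

/-! ### Smooth local flows of vector fields -/

section Flow

/-- The smooth inverse function theorem, with a smooth inverse on a whole open set. -/
lemma exists_openPartialHomeomorph_of_hasFDerivAt {E F : Type*} [NormedAddCommGroup E]
    [NormedSpace ℝ E] [CompleteSpace E] [NormedAddCommGroup F] [NormedSpace ℝ F] [CompleteSpace F]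
    {f : E → F} {U : Set E} (hU : IsOpen U) (hf : ContDiffOn ℝ ∞ f U) {a : E} (ha : a ∈ U)
    {f' : E ≃L[ℝ] F} (hf' : HasFDerivAt f (f' : E →L[ℝ] F) a) :
    ∃ e : OpenPartialHomeomorph E F, a ∈ e.source ∧ e.source ⊆ U ∧ (⇑e = f) ∧
      ContDiffOn ℝ ∞ e.symm e.target := by
  have hfa : ContDiffAt ℝ ∞ f a := hf.contDiffAt (hU.mem_nhds ha)
  let e₀ := hfa.toOpenPartialHomeomorph f hf' (by simp)
  have he₀ : ⇑e₀ = f := rfl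
  have hO : IsOpen (U ∩ fderiv ℝ f ⁻¹' Set.range ((↑) : (E ≃L[ℝ] F) → E →L[ℝ] F)) :=
    (hf.continuousOn_fderiv_of_isOpen hU (by simp)).isOpen_inter_preimage hU
      ContinuousLinearEquiv.isOpen
  refine ⟨e₀.restrOpen _ hO, ⟨hfa.mem_toOpenPartialHomeomorph_source hf' (by simp), ha, f',
    hf'.fderiv.symm⟩, fun x hx => hx.2.1, rfl, fun y hy => ?_⟩
  have hy' := (e₀.restrOpen _ hO).map_target hy
  obtain ⟨hyU, g, hg⟩ := hy'.2
  have hc : ContDiffAt ℝ ∞ f ((e₀.restrOpen _ hO).symm y) := hf.contDiffAt (hU.mem_nhds hyU)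
  refine ((e₀.restrOpen _ hO).contDiffAt_symm (f₀' := g) hy ?_ hc).contDiffWithinAt
  rw [hg]
  exact (hc.differentiableAt (by simp)).hasFDerivAt

variable {K : Type*} [TopologicalSpace K] [CompactSpace K]

/-- Pointwise application of a continuous family of linear maps to a continuous function. -/
def pointwiseApply (K : Type*) [TopologicalSpace K] [CompactSpace K] (E F : Type*)
    [NormedAddCommGroup E] [NormedSpace ℝ E] [NormedAddCommGroup F] [NormedSpace ℝ F] :
    C(K, E →L[ℝ] F) →L[ℝ] C(K, E) →L[ℝ] C(K, F) :=
  LinearMap.mkContinuous₂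
    (LinearMap.mk₂ ℝ
      (fun (A : C(K, E →L[ℝ] F)) (η : C(K, E)) =>
        (⟨fun t => A t (η t), A.continuous.clm_apply η.continuous⟩ : C(K, F)))
      (fun _ _ _ => by ext; simp) (fun _ _ _ => by ext; simp) (fun _ _ _ => by ext; simp)
      (fun _ _ _ => by ext; simp)) 1 (fun A η => by
    rw [one_mul]
    refine (ContinuousMap.norm_le _ (mul_nonneg (norm_nonneg A) (norm_nonneg η))).2 fun t => ?_
    exact ((A t).le_opNorm _).trans (mul_le_mul (A.norm_coe_le_norm t) (η.norm_coe_le_norm t)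
      (norm_nonneg _) (norm_nonneg _)))

/-- The remainder estimate is uniform on `K` because `γ ↦ X' ∘ γ` is continuous for the uniform
norm. -/
lemma hasFDerivAt_postcomp {E F : Type*} [NormedAddCommGroup E] [NormedSpace ℝ E]
    [NormedAddCommGroup F] [NormedSpace ℝ F] (X : C(E, F)) (X' : C(E, E →L[ℝ] F))
    (hX : ∀ x, HasFDerivAt X (X' x) x) (γ : C(K, E)) :
    HasFDerivAt (fun γ : C(K, E) => X.comp γ) (pointwiseApply K E F (X'.comp γ)) γ := by
  rw [hasFDerivAt_iff_isLittleO_nhds_zero, Asymptotics.isLittleO_iff]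
  intro ε hε
  have hc : ContinuousAt (fun γ : C(K, E) => X'.comp γ) γ :=
    (ContinuousMap.continuous_postcomp X').continuousAt
  obtain ⟨δ, hδ, h⟩ := (Metric.continuousAt_iff (f := fun γ : C(K, E) => X'.comp γ)).1 hc ε hε
  filter_upwards [Metric.ball_mem_nhds (0 : C(K, E)) hδ] with η hη
  rw [mem_ball_zero_iff] at hη
  rw [ContinuousMap.norm_le _ (by positivity)]
  intro t
  have hseg : ∀ z ∈ segment ℝ (γ t) (γ t + η t), ‖X' z - X' (γ t)‖ ≤ ε := by
    rintro z ⟨a, b, ha, hb, hab, rfl⟩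
    have h1 : dist (γ + b • η) γ < δ := by
      rw [dist_eq_norm, add_sub_cancel_left, norm_smul, Real.norm_of_nonneg hb]
      have : b ≤ 1 := by linarith
      nlinarith [norm_nonneg η]
    have h2 := (ContinuousMap.dist_lt_iff hε).1 (h h1) t
    rw [dist_eq_norm] at h2
    have h3 : a • γ t + b • (γ t + η t) = (γ + b • η) t := by
      simp only [ContinuousMap.add_apply, ContinuousMap.smul_apply, smul_add, ← add_assoc,
        ← add_smul, hab, one_smul]
    rw [h3]
    exact h2.le
  have hm := (convex_segment (γ t) (γ t + η t)).norm_image_sub_le_of_norm_hasFDerivWithin_le'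
    (f := X) (fun z _ => (hX z).hasFDerivWithinAt) hseg (left_mem_segment ℝ _ _)
    (right_mem_segment ℝ _ _)
  rw [add_sub_cancel_left] at hm
  exact hm.trans (mul_le_mul_of_nonneg_left (η.norm_coe_le_norm t) hε.le)

/-- Composition with a smooth map is a smooth operator between spaces of continuous functions on a
compact space. -/
lemma contDiff_postcomp {E : Type*} [NormedAddCommGroup E] [NormedSpace ℝ E]
    (X : C(E, E)) (hX : ContDiff ℝ ∞ X) : ContDiff ℝ ∞ (fun γ : C(K, E) => X.comp γ) := by
  have key : ∀ (k : ℕ) {F : Type _} [NormedAddCommGroup F] [NormedSpace ℝ F] (Y : C(E, F)),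
      ContDiff ℝ ∞ Y → ContDiff ℝ k (fun γ : C(K, E) => Y.comp γ) := by
    intro k
    induction k with
    | zero =>
      intro F _ _ Y _
      exact contDiff_zero.2 (ContinuousMap.continuous_postcomp Y)
    | succ k ih =>
      intro F _ _ Y hY
      have hd : ContDiff ℝ ∞ (fderiv ℝ Y) := hY.fderiv_right (by simp)
      let Y' : C(E, E →L[ℝ] F) := ⟨fderiv ℝ Y, hd.continuous⟩
      have hY' : ContDiff ℝ k (fun γ : C(K, E) => pointwiseApply K E F (Y'.comp γ)) := by
        have h1 : ContDiff ℝ k (pointwiseApply K E F) := by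
          apply ContinuousLinearMap.contDiff
        exact h1.comp (ih Y' hd)
      exact contDiff_succ_iff_hasFDerivAt.2 ⟨_, hY', hasFDerivAt_postcomp Y Y'
        fun x => (hY.differentiable (by simp) x).hasFDerivAt⟩
  exact contDiff_infty.2 fun k => key k X hX

variable {E : Type*} [NormedAddCommGroup E]

/-- The time interval on which integral curves are parametrised. -/
abbrev TimeInterval : Type := Set.Icc (-1 : ℝ) 1

/-- Extension of a continuous function on the time interval by constants. -/
def timeExtend (β : C(TimeInterval, E)) : ℝ → E :=
  Set.IccExtend (by norm_num : (-1 : ℝ) ≤ 1) β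

lemma continuous_timeExtend (β : C(TimeInterval, E)) : Continuous (timeExtend β) :=
  β.continuous.Icc_extend'

lemma timeExtend_of_mem (β : C(TimeInterval, E)) {t : ℝ} (ht : t ∈ Set.Icc (-1 : ℝ) 1) :
    timeExtend β t = β ⟨t, ht⟩ := Set.IccExtend_of_mem _ _ ht

lemma norm_timeExtend_le (β : C(TimeInterval, E)) (t : ℝ) : ‖timeExtend β t‖ ≤ ‖β‖ :=
  β.norm_coe_le_norm _

/-- The curve `τ ↦ γ(aτ)`. -/
def rescaleTime (a : ℝ) (γ : C(TimeInterval, E)) : C(TimeInterval, E) :=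
  ⟨fun τ => timeExtend γ (a * τ), (continuous_timeExtend γ).comp
    (continuous_const.mul continuous_subtype_val)⟩

lemma norm_rescaleTime_le (a : ℝ) (γ : C(TimeInterval, E)) : ‖rescaleTime a γ‖ ≤ ‖γ‖ :=
  (ContinuousMap.norm_le _ (norm_nonneg _)).2 fun _ => norm_timeExtend_le _ _

variable [NormedSpace ℝ E] [CompleteSpace E]

/-- The integral `τ ↦ ∫_0^τ β`. -/
def integralOp (E : Type*) [NormedAddCommGroup E] [NormedSpace ℝ E] [CompleteSpace E] :
    C(TimeInterval, E) →L[ℝ] C(TimeInterval, E) :=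
  LinearMap.mkContinuous
    { toFun := fun β => ⟨fun τ => ∫ σ in (0 : ℝ)..τ, timeExtend β σ,
        (intervalIntegral.continuous_primitive
          (fun _ _ => (continuous_timeExtend β).intervalIntegrable _ _) 0).comp
          continuous_subtype_val⟩
      map_add' := fun β β' => by
        ext τ
        exact intervalIntegral.integral_add ((continuous_timeExtend β).intervalIntegrable _ _)
          ((continuous_timeExtend β').intervalIntegrable _ _)
      map_smul' := fun c β => by
        ext τ
        exact intervalIntegral.integral_smul c _ } 1 (fun β => by
    rw [one_mul, ContinuousMap.norm_le _ (norm_nonneg _)]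
    intro τ
    have h := intervalIntegral.norm_integral_le_of_norm_le_const (a := 0) (b := (τ : ℝ))
      (f := timeExtend β) (C := ‖β‖) fun σ _ => norm_timeExtend_le β σ
    have hτ : |(τ : ℝ) - 0| ≤ 1 := by rw [sub_zero]; exact abs_le.2 τ.2
    exact h.trans (mul_le_of_le_one_right (norm_nonneg _) hτ))

/-- The operator `(x, γ) ↦ (τ ↦ ∫_0^τ X(x + γ))`. -/
def picardOp (X : C(E, E)) (p : E × C(TimeInterval, E)) : C(TimeInterval, E) :=
  integralOp E (X.comp (ContinuousLinearMap.const ℝ TimeInterval p.1 + p.2))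

lemma contDiff_picardOp {X : C(E, E)} (hX : ContDiff ℝ ∞ X) : ContDiff ℝ ∞ (picardOp X) := by
  have hc : ContDiff ℝ ∞ (ContinuousLinearMap.const ℝ TimeInterval (M := E)) :=
    ContinuousLinearMap.contDiff _
  exact (integralOp E).contDiff.comp
    ((contDiff_postcomp X hX).comp ((hc.comp contDiff_fst).add contDiff_snd))

lemma picardOp_apply (X : C(E, E)) (x : E) (γ : C(TimeInterval, E)) (τ : TimeInterval) :
    picardOp X (x, γ) τ = ∫ σ in (0 : ℝ)..τ, X (x + timeExtend γ σ) := rfl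

/-- Rescaling the time of a solution of `γ = ε ∫_0^τ X(x + γ)`. -/
lemma picard_rescaleTime {X : C(E, E)} {ε a : ℝ} (ha : a ∈ Set.Icc (-1 : ℝ) 1) {x : E}
    {γ : C(TimeInterval, E)} (hγ : γ = ε • picardOp X (x, γ)) :
    rescaleTime a γ = (a * ε) • picardOp X (x, rescaleTime a γ) := by
  ext τ
  have haτ : ∀ σ ∈ Set.Icc (-1 : ℝ) 1, a * σ ∈ Set.Icc (-1 : ℝ) 1 := by
    intro σ hσ
    rw [Set.mem_Icc, ← abs_le] at *
    rw [abs_mul]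
    exact mul_le_one₀ ha (abs_nonneg _) hσ
  have hval : rescaleTime a γ τ = γ ⟨a * τ, haτ τ τ.2⟩ := timeExtend_of_mem _ (haτ τ τ.2)
  rw [hval]
  conv_lhs => rw [hγ]
  simp only [ContinuousMap.smul_apply, picardOp_apply]
  have h1 : ∫ σ in (0 : ℝ)..a * τ, X (x + timeExtend γ σ) =
      a • ∫ σ in (0 : ℝ)..τ, X (x + timeExtend γ (a * σ)) := by
    rw [intervalIntegral.smul_integral_comp_mul_left (fun s => X (x + timeExtend γ s)) a, mul_zero]
  rw [h1, mul_comm a ε, mul_smul]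
  congr 2
  refine intervalIntegral.integral_congr fun σ hσ => ?_
  have hσ' : σ ∈ Set.Icc (-1 : ℝ) 1 :=
    (Set.uIcc_subset_Icc (by norm_num) τ.2 : Set.uIcc (0 : ℝ) τ ⊆ _) hσ
  change X (x + timeExtend γ (a * σ)) = X (x + timeExtend (rescaleTime a γ) σ)
  rw [timeExtend_of_mem _ hσ']
  rfl

lemma hasDerivAt_of_picard {X : C(E, E)} {ε : ℝ} {x : E} {γ : C(TimeInterval, E)}
    (hγ : γ = ε • picardOp X (x, γ)) {τ : ℝ} (hτ : τ ∈ Set.Ioo (-1 : ℝ) 1) :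
    HasDerivAt (timeExtend γ) (ε • X (x + timeExtend γ τ)) τ := by
  have hc : Continuous fun σ => X (x + timeExtend γ σ) :=
    X.continuous.comp (continuous_const.add (continuous_timeExtend γ))
  have h := ((hc.integral_hasStrictDerivAt 0 τ).hasDerivAt).const_smul ε
  refine h.congr_of_eventuallyEq ?_
  filter_upwards [Ioo_mem_nhds hτ.1 hτ.2] with σ hσ
  rw [timeExtend_of_mem _ (Set.Ioo_subset_Icc_self hσ)]
  conv_lhs => rw [hγ]
  rfl

/-- A smooth vector field has a local flow that depends smoothly on time and initial value. The
displacement curve `γ` with `γ(τ) = ε ∫_0^τ X(x + γ)`, defined on a fixed time interval, is found as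
a smooth function of `(ε, x)` by inverting `(ε, x, γ) ↦ (ε, x, γ - ε ∫ X(x + γ))` near `ε = 0`. -/
theorem exists_smooth_flow {X : E → E} (hX : ContDiff ℝ ∞ X) (x₀ : E) :
    ∃ r > 0, ∃ Φ : ℝ × E → E, ContDiffOn ℝ ∞ Φ (Metric.ball 0 r ×ˢ Metric.ball x₀ r) ∧
      (∀ x ∈ Metric.ball x₀ r, Φ (0, x) = x) ∧
      ∀ t ∈ Metric.ball (0 : ℝ) r, ∀ x ∈ Metric.ball x₀ r,
        HasDerivAt (fun s => Φ (s, x)) (X (Φ (t, x))) t := by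
  let Y : C(E, E) := ⟨X, hX.continuous⟩
  let Ψ : ℝ × E × C(TimeInterval, E) → ℝ × E × C(TimeInterval, E) :=
    fun p => (p.1, p.2.1, p.2.2 - p.1 • picardOp Y p.2)
  have hP : ContDiff ℝ ∞ (picardOp Y) := contDiff_picardOp hX
  have hΨ : ContDiff ℝ ∞ Ψ :=
    contDiff_fst.prodMk ((contDiff_fst.comp contDiff_snd).prodMk
      ((contDiff_snd.comp contDiff_snd).sub (contDiff_fst.smul (hP.comp contDiff_snd))))
  set p₀ : ℝ × E × C(TimeInterval, E) := (0, x₀, 0) with hp₀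
  set v := picardOp Y (x₀, 0) with hv
  let L : (ℝ × E × C(TimeInterval, E)) ≃L[ℝ] (ℝ × E × C(TimeInterval, E)) :=
    ContinuousLinearEquiv.equivOfInverse
      ((ContinuousLinearMap.fst ℝ _ _).prod ((ContinuousLinearMap.fst ℝ _ _ ∘L
        ContinuousLinearMap.snd ℝ _ _).prod ((ContinuousLinearMap.snd ℝ _ _ ∘L
        ContinuousLinearMap.snd ℝ _ _) - (ContinuousLinearMap.fst ℝ _ _).smulRight v)))
      ((ContinuousLinearMap.fst ℝ _ _).prod ((ContinuousLinearMap.fst ℝ _ _ ∘L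
        ContinuousLinearMap.snd ℝ _ _).prod ((ContinuousLinearMap.snd ℝ _ _ ∘L
        ContinuousLinearMap.snd ℝ _ _) + (ContinuousLinearMap.fst ℝ _ _).smulRight v)))
      (fun p => by simp) (fun p => by simp)
  have hL : HasFDerivAt Ψ (L : _ →L[ℝ] _) p₀ := by
    have h1 : HasFDerivAt (fun p : ℝ × E × C(TimeInterval, E) => p.1 • picardOp Y p.2)
        ((ContinuousLinearMap.fst ℝ ℝ (E × C(TimeInterval, E))).smulRight v) p₀ := by
      have hd := (((hP.comp contDiff_snd).differentiable (by simp) p₀).hasFDerivAt :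
        HasFDerivAt (fun p : ℝ × E × C(TimeInterval, E) => picardOp Y p.2) _ p₀)
      refine ((hasFDerivAt_fst (𝕜 := ℝ) (p := p₀)).smul hd).congr_fderiv ?_
      exact ContinuousLinearMap.ext fun p => by simp [hp₀, hv]
    exact hasFDerivAt_fst.prodMk ((hasFDerivAt_fst.comp p₀ hasFDerivAt_snd).prodMk
      ((hasFDerivAt_snd.comp p₀ hasFDerivAt_snd).sub h1))
  obtain ⟨e, hpe, -, he, hes⟩ := exists_openPartialHomeomorph_of_hasFDerivAt isOpen_univ
    hΨ.contDiffOn (Set.mem_univ p₀) hL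
  have hΨp : Ψ p₀ = p₀ := by simp [Ψ, hp₀]
  have hpt : p₀ ∈ e.target := by
    have := e.map_source hpe
    rwa [he, hΨp] at this
  have hsymm₀ : e.symm p₀ = p₀ := by
    have := e.left_inv hpe
    rwa [he, hΨp] at this
  have hcont : ContinuousAt e.symm p₀ := e.continuousAt_symm hpt
  have hsrc : e.source ∈ 𝓝 (e.symm p₀) := by rw [hsymm₀]; exact e.open_source.mem_nhds hpe
  -- a product neighbourhood inside the source on which the equation has a unique solution
  obtain ⟨r₁, hr₁, hball⟩ : ∃ r₁ > 0, ∀ ε x (γ : C(TimeInterval, E)), |ε| < r₁ →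
      dist x x₀ < r₁ → ‖γ‖ < r₁ → (ε, x, γ) ∈ e.source := by
    obtain ⟨r₁, hr₁, h⟩ := Metric.mem_nhds_iff.1 (e.open_source.mem_nhds hpe)
    refine ⟨r₁, hr₁, fun ε x γ h1 h2 h3 => h ?_⟩
    simp only [hp₀, Metric.mem_ball, Prod.dist_eq, max_lt_iff, dist_zero_right, Real.norm_eq_abs]
    exact ⟨h1, h2, h3⟩
  obtain ⟨r₂, hr₂, hsm⟩ : ∃ r₂ > 0, ∀ ε x, |ε| < r₂ → dist x x₀ < r₂ →
      (ε, x, (0 : C(TimeInterval, E))) ∈ e.target ∧ ‖(e.symm (ε, x, 0)).2.2‖ < r₁ := by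
    have h1 : ∀ᶠ q in 𝓝 p₀, q ∈ e.target ∧ ‖(e.symm q).2.2‖ < r₁ := by
      have h2 : ContinuousAt (fun q => ‖(e.symm q).2.2‖) p₀ := hcont.snd.snd.norm
      have h3 : ‖(e.symm p₀).2.2‖ < r₁ := by rw [hsymm₀]; simpa [hp₀] using hr₁
      filter_upwards [e.open_target.mem_nhds hpt, h2.eventually_lt continuousAt_const h3]
        with q hq hq' using ⟨hq, hq'⟩
    obtain ⟨r₂, hr₂, h⟩ := Metric.eventually_nhds_iff.1 h1
    refine ⟨r₂, hr₂, fun ε x h2 h3 => h ?_⟩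
    simp only [hp₀, Prod.dist_eq, max_lt_iff, dist_zero_right, Real.norm_eq_abs, norm_zero]
    exact ⟨h2, h3, hr₂⟩
  let Γ : ℝ → E → C(TimeInterval, E) := fun ε x => (e.symm (ε, x, 0)).2.2
  have hΓ : ∀ ε x, |ε| < r₂ → dist x x₀ < r₂ →
      e.symm (ε, x, 0) = (ε, x, Γ ε x) ∧ Γ ε x = ε • picardOp Y (x, Γ ε x) := by
    intro ε x h1 h2
    have h3 := e.right_inv (hsm ε x h1 h2).1
    rw [he] at h3
    simp only [Ψ, Prod.mk.injEq] at h3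
    obtain ⟨a1, a2, a3⟩ := h3
    have h4 : e.symm (ε, x, 0) = (ε, x, Γ ε x) := Prod.ext a1 (Prod.ext a2 rfl)
    refine ⟨h4, ?_⟩
    rw [h4] at a3
    exact sub_eq_zero.1 a3
  set r := min r₁ r₂ with hr
  have hr0 : 0 < r := lt_min hr₁ hr₂
  -- uniqueness makes the solution curves rescalings of each other
  have hresc : ∀ ε x a, |ε| < r → dist x x₀ < r → a ∈ Set.Icc (-1 : ℝ) 1 →
      Γ (a * ε) x = rescaleTime a (Γ ε x) := by
    intro ε x a h1 h2 ha
    obtain ⟨h3, h4⟩ := hΓ ε x (h1.trans_le (min_le_right _ _)) (h2.trans_le (min_le_right _ _))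
    have h5 := picard_rescaleTime ha h4
    have h6 : |a * ε| < r := by
      rw [abs_mul]
      exact (mul_le_of_le_one_left (abs_nonneg _) (abs_le.2 ha)).trans_lt h1
    have h7 : (a * ε, x, rescaleTime a (Γ ε x)) ∈ e.source :=
      hball _ _ _ (h6.trans_le (min_le_left _ _)) (h2.trans_le (min_le_left _ _))
        ((norm_rescaleTime_le _ _).trans_lt (hsm ε x (h1.trans_le (min_le_right _ _))
          (h2.trans_le (min_le_right _ _))).2)
    have h8 := e.left_inv h7
    rw [he] at h8
    simp only [Ψ] at h8
    rw [sub_eq_zero.2 h5] at h8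
    simp only [Γ, h8]
  have h1mem : (1 : ℝ) ∈ Set.Icc (-1 : ℝ) 1 := by norm_num
  refine ⟨r, hr0, fun p => p.2 + Γ p.1 p.2 ⟨1, h1mem⟩, ?_, ?_, ?_⟩
  · have hmaps : Set.MapsTo (fun p : ℝ × E => (p.1, p.2, (0 : C(TimeInterval, E))))
        (Metric.ball 0 r ×ˢ Metric.ball x₀ r) e.target := by
      rintro ⟨ε, x⟩ ⟨h1, h2⟩
      simp only [Metric.mem_ball, dist_zero_right, Real.norm_eq_abs] at h1 h2
      exact (hsm ε x (h1.trans_le (min_le_right _ _)) (h2.trans_le (min_le_right _ _))).1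
    have hin : ContDiff ℝ ∞ (fun p : ℝ × E => (p.1, p.2, (0 : C(TimeInterval, E)))) :=
      contDiff_fst.prodMk (contDiff_snd.prodMk contDiff_const)
    have h2 := (hes.comp hin.contDiffOn hmaps).snd.snd
    have hev : ContDiff ℝ ∞ (fun β : C(TimeInterval, E) => β ⟨1, h1mem⟩) := by
      have h3 : ContDiff ℝ ∞ (ContinuousMap.evalCLM (M := E) ℝ (⟨1, h1mem⟩ : TimeInterval)) := by
        apply ContinuousLinearMap.contDiff
      exact h3
    exact contDiff_snd.contDiffOn.add (hev.comp_contDiffOn h2)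
  · intro x hx
    have h1 := (hΓ 0 x (by simpa using hr₂)
      ((Metric.mem_ball.1 hx).trans_le (min_le_right _ _))).2
    rw [zero_smul] at h1
    simp [h1]
  · intro t ht x hx
    simp only [Metric.mem_ball, dist_zero_right, Real.norm_eq_abs] at ht hx
    obtain ⟨ε, hε, hεr⟩ := exists_between ht
    have hε0 : 0 < ε := (abs_nonneg t).trans_lt hε
    have hεr' : |ε| < r := by rwa [abs_of_pos hε0]
    have hmem : ∀ s, |s| < ε → s / ε ∈ Set.Ioo (-1 : ℝ) 1 := by
      intro s hs
      rw [Set.mem_Ioo, ← abs_lt, abs_div, abs_of_pos hε0]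
      exact (div_lt_one hε0).2 hs
    have hform : ∀ s, |s| < ε → x + Γ s x ⟨1, h1mem⟩ = x + timeExtend (Γ ε x) (s / ε) := by
      intro s hs
      have h := hresc ε x (s / ε) hεr' hx (Set.Ioo_subset_Icc_self (hmem s hs))
      rw [div_mul_cancel₀ _ hε0.ne'] at h
      rw [h]
      simp [rescaleTime]
    have hd := hasDerivAt_of_picard (hΓ ε x (hεr'.trans_le (min_le_right _ _))
      (hx.trans_le (min_le_right _ _))).2 (hmem t hε)
    have hd2 : HasDerivAt (fun s => x + timeExtend (Γ ε x) (s / ε))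
        (ε⁻¹ • ε • Y (x + timeExtend (Γ ε x) (t / ε))) t := by
      refine HasDerivAt.const_add x ?_
      have := hd.scomp t ((hasDerivAt_id t).div_const ε)
      simpa [div_eq_mul_inv, Function.comp_def] using this
    rw [smul_smul, inv_mul_cancel₀ hε0.ne', one_smul, ← hform t hε] at hd2
    refine hd2.congr_of_eventuallyEq ?_
    filter_upwards [(continuous_abs.isOpen_preimage _ isOpen_Iio).mem_nhds
      (show t ∈ abs ⁻¹' Set.Iio ε from hε)] with s hs
    exact hform s hs

end Flow

/-! ### Flow boxes -/

section FlowBox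

variable {m : ℕ}

/-- `dropFirst` as a continuous linear map. -/
def dropFirstL (m : ℕ) : Coord (m + 1) →L[ℝ] Coord m :=
  LinearMap.toContinuousLinearMap
    { toFun := dropFirst
      map_add' := fun u v => by ext; simp [dropFirst]
      map_smul' := fun c u => by ext; simp [dropFirst] }

@[simp] lemma dropFirstL_apply (u : Coord (m + 1)) : dropFirstL m u = dropFirst u := rfl

/-- The point with first coordinate `t` and remaining coordinates `y`. -/
def consCoord (t : ℝ) (y : Coord m) : Coord (m + 1) := WithLp.toLp 2 (Fin.cons t (fun a => y a))

@[simp] lemma consCoord_zero (t : ℝ) (y : Coord m) : consCoord t y 0 = t := rfl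

@[simp] lemma consCoord_succ (t : ℝ) (y : Coord m) (a : Fin m) : consCoord t y a.succ = y a := rfl

@[simp] lemma dropFirst_consCoord (t : ℝ) (y : Coord m) : dropFirst (consCoord t y) = y := rfl

@[simp] lemma consCoord_dropFirst (u : Coord (m + 1)) : consCoord (u 0) (dropFirst u) = u := by
  ext i; refine Fin.cases ?_ (fun a => ?_) i <;> simp [dropFirst]

lemma contDiff_consCoord : ContDiff ℝ ∞ (fun p : ℝ × Coord m => consCoord p.1 p.2) := by
  rw [contDiff_euclidean]
  intro i
  refine Fin.cases ?_ (fun a => ?_) i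
  · exact contDiff_fst
  · exact contDiff_euclidean.1 contDiff_snd a

lemma contDiff_coord_zero : ContDiff ℝ ∞ (fun u : Coord (m + 1) => u 0) :=
  contDiff_euclidean.1 contDiff_id 0

lemma contDiff_dropFirst : ContDiff ℝ ∞ (dropFirst : Coord (m + 1) → Coord m) :=
  (dropFirstL m).contDiff

/-- The coordinate box `(t - δ, t + δ) × B(0, δ)`. -/
def coordBox (t δ : ℝ) : Set (Coord (m + 1)) :=
  {u | u 0 ∈ Set.Ioo (t - δ) (t + δ) ∧ dropFirst u ∈ Metric.ball (0 : Coord m) δ}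

lemma isOpen_coordBox (t δ : ℝ) : IsOpen (coordBox t δ : Set (Coord (m + 1))) :=
  (isOpen_Ioo.preimage contDiff_coord_zero.continuous).inter
    (Metric.isOpen_ball.preimage contDiff_dropFirst.continuous)

lemma exists_coordBox_subset {t : ℝ} {N : Set (Coord (m + 1))} (hN : N ∈ 𝓝 (consCoord t 0)) :
    ∃ δ > 0, coordBox t δ ⊆ N := by
  have hc : Continuous (fun p : ℝ × Coord m => consCoord p.1 p.2) := contDiff_consCoord.continuous
  have h : (fun p : ℝ × Coord m => consCoord p.1 p.2) ⁻¹' N ∈ 𝓝 (t, (0 : Coord m)) :=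
    hc.continuousAt hN
  obtain ⟨δ, hδ, hsub⟩ := Metric.mem_nhds_iff.1 h
  refine ⟨δ, hδ, fun u hu => ?_⟩
  have : (u 0, dropFirst u) ∈ Metric.ball (t, (0 : Coord m)) δ := by
    rw [← ball_prod_same, Real.ball_eq_Ioo]
    exact ⟨hu.1, hu.2⟩
  simpa using hsub this

lemma hasDerivAt_line (u : Coord (m + 1)) (i : Fin (m + 1)) :
    HasDerivAt (fun t : ℝ => u + t • EuclideanSpace.single i (1 : ℝ))
      (EuclideanSpace.single i (1 : ℝ)) 0 := by
  simpa using ((hasDerivAt_id (0 : ℝ)).smul_const (EuclideanSpace.single i (1 : ℝ))).const_add u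

/-- A linear parametrisation of the kernel of a nonzero linear form. -/
lemma exists_injective_ker {ℓ : Coord (m + 1) →L[ℝ] ℝ} (hℓ : ℓ ≠ 0) :
    ∃ ι : Coord m →L[ℝ] Coord (m + 1), Function.Injective ι ∧ ∀ y, ℓ (ι y) = 0 := by
  have h1 : Module.finrank ℝ (LinearMap.ker (ℓ : Coord (m + 1) →ₗ[ℝ] ℝ)) = m := by
    have h2 := LinearMap.finrank_range_add_finrank_ker (ℓ : Coord (m + 1) →ₗ[ℝ] ℝ)
    have h3 : LinearMap.range (ℓ : Coord (m + 1) →ₗ[ℝ] ℝ) = ⊤ := by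
      apply LinearMap.range_eq_top.2
      apply LinearMap.surjective
      intro h
      exact hℓ (ContinuousLinearMap.coe_injective h)
    rw [h3, finrank_top, Module.finrank_self, finrank_euclideanSpace_fin] at h2
    omega
  let e : Coord m ≃ₗ[ℝ] LinearMap.ker (ℓ : Coord (m + 1) →ₗ[ℝ] ℝ) :=
    LinearEquiv.ofFinrankEq _ _ (by rw [h1, finrank_euclideanSpace_fin])
  refine ⟨LinearMap.toContinuousLinearMap ((Submodule.subtype _).comp e.toLinearMap), ?_, ?_⟩
  · exact Subtype.val_injective.comp e.injective
  · intro y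
    exact (e y).2

/-- A function that is smooth near a point agrees there with a smooth function defined everywhere:
multiply it by a bump function. -/
lemma exists_smooth_extension {E F : Type*} [NormedAddCommGroup E] [NormedSpace ℝ E]
    [HasContDiffBump E] [FiniteDimensional ℝ E] [NormedAddCommGroup F] [NormedSpace ℝ F]
    {U : Set E} (hU : IsOpen U) {X : E → F} (hX : ContDiffOn ℝ ∞ X U) {x₀ : E} (hx₀ : x₀ ∈ U) :
    ∃ Y : E → F, ContDiff ℝ ∞ Y ∧ Y =ᶠ[𝓝 x₀] X := by
  obtain ⟨ε, hε, hsub⟩ := Metric.nhds_basis_closedBall.mem_iff.1 (hU.mem_nhds hx₀)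
  let χ : ContDiffBump x₀ := ⟨ε / 2, ε, half_pos hε, half_lt_self hε⟩
  refine ⟨fun x => χ x • X x, contDiff_iff_contDiffAt.2 fun x => ?_, ?_⟩
  · by_cases hx : x ∈ U
    · exact χ.contDiffAt.smul (hX.contDiffAt (hU.mem_nhds hx))
    · have hx' : x ∉ tsupport χ := by
        rw [χ.tsupport_eq]; exact fun h => hx (hsub h)
      have h0 : (fun x => χ x • X x) =ᶠ[𝓝 x] fun _ => 0 := by
        filter_upwards [(isClosed_tsupport χ).isOpen_compl.mem_nhds hx'] with y hy
        rw [image_eq_zero_of_notMem_tsupport hy, zero_smul]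
      exact contDiffAt_const.congr_of_eventuallyEq h0
  · filter_upwards [χ.eventuallyEq_one] with x hx
    rw [hx]; simp

/-- Flow box for a vector field `X` and a function `s` with `ds(X) = 1`: near any point there are
smooth coordinates, on a box, whose first coordinate is `s` and whose first coordinate vector field
is `X`. With `ι` a parametrisation of the kernel of `ds` at the given point `x₀`, the coordinates
are the inverse of `(σ, y) ↦ Φ(σ - s(x₀ + ι y), x₀ + ι y)`, where `Φ` is the flow of `X`. -/
theorem exists_flowBox {U : Set (Coord (m + 1))} (hU : IsOpen U) {s : Coord (m + 1) → ℝ}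
    (hs : ContDiffOn ℝ ∞ s U) {X : Coord (m + 1) → Coord (m + 1)} (hX : ContDiffOn ℝ ∞ X U)
    (hsX : ∀ x ∈ U, fderiv ℝ s x (X x) = 1) {x₀ : Coord (m + 1)} (hx₀ : x₀ ∈ U) :
    ∃ (e : OpenPartialHomeomorph (Coord (m + 1)) (Coord (m + 1))) (δ : ℝ), 0 < δ ∧
      e.source = coordBox (s x₀) δ ∧ e.target ⊆ U ∧ x₀ ∈ e.target ∧
      ContDiffOn ℝ ∞ e e.source ∧ ContDiffOn ℝ ∞ e.symm e.target ∧
      (∀ u ∈ e.source, s (e u) = u 0) ∧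
      ∀ u ∈ e.source, fderiv ℝ e u (EuclideanSpace.single 0 1) = X (e u) := by
  obtain ⟨Y, hY, hYX⟩ := exists_smooth_extension hU hX hx₀
  obtain ⟨ρ, hρ, hρU, hρY⟩ : ∃ ρ > 0, Metric.ball x₀ ρ ⊆ U ∧ ∀ x ∈ Metric.ball x₀ ρ, Y x = X x := by
    obtain ⟨ρ, hρ, h⟩ := Metric.mem_nhds_iff.1 (Filter.inter_mem (hU.mem_nhds hx₀) hYX)
    exact ⟨ρ, hρ, fun x hx => (h hx).1, fun x hx => (h hx).2⟩
  obtain ⟨r₀, hr₀, Φ, hΦ, hΦ0, hΦd⟩ := exists_smooth_flow hY x₀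
  have hopen₀ : IsOpen (Metric.ball (0 : ℝ) r₀ ×ˢ Metric.ball x₀ r₀) :=
    Metric.isOpen_ball.prod Metric.isOpen_ball
  have hmem₀ : ((0 : ℝ), x₀) ∈ Metric.ball (0 : ℝ) r₀ ×ˢ Metric.ball x₀ r₀ :=
    ⟨Metric.mem_ball_self hr₀, Metric.mem_ball_self hr₀⟩
  have hΦc : ContDiffAt ℝ ∞ Φ (0, x₀) := hΦ.contDiffAt (hopen₀.mem_nhds hmem₀)
  have hΦx₀ : Φ (0, x₀) = x₀ := hΦ0 x₀ (Metric.mem_ball_self hr₀)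
  -- shrink the domain of the flow so that it stays where `Y = X`
  obtain ⟨r, hr, hrr₀, hrρ, hrΦ⟩ : ∃ r > 0, r ≤ r₀ ∧ r ≤ ρ ∧
      ∀ t ∈ Metric.ball (0 : ℝ) r, ∀ x ∈ Metric.ball x₀ r, Φ (t, x) ∈ Metric.ball x₀ ρ := by
    have h1 : Φ ⁻¹' Metric.ball x₀ ρ ∈ 𝓝 ((0 : ℝ), x₀) :=
      hΦc.continuousAt.preimage_mem_nhds (by rw [hΦx₀]; exact Metric.ball_mem_nhds _ hρ)
    obtain ⟨r, hr, h⟩ := Metric.mem_nhds_iff.1 h1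
    refine ⟨min r (min r₀ ρ), lt_min hr (lt_min hr₀ hρ), (min_le_right _ _).trans (min_le_left _ _),
      (min_le_right _ _).trans (min_le_right _ _), fun t ht x hx => h ?_⟩
    rw [← ball_prod_same]
    exact ⟨Metric.ball_subset_ball (min_le_left _ _) ht,
      Metric.ball_subset_ball (min_le_left _ _) hx⟩
  have hsd : ∀ x ∈ U, HasFDerivAt s (fderiv ℝ s x) x := fun x hx =>
    ((hs.contDiffAt (hU.mem_nhds hx)).differentiableAt (by simp)).hasFDerivAt
  have hflow : ∀ t ∈ Metric.ball (0 : ℝ) r, ∀ x ∈ Metric.ball x₀ r,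
      HasDerivAt (fun t => Φ (t, x)) (X (Φ (t, x))) t := by
    intro t ht x hx
    have := hΦd t (Metric.ball_subset_ball hrr₀ ht) x (Metric.ball_subset_ball hrr₀ hx)
    rwa [hρY _ (hrΦ t ht x hx)] at this
  -- along the flow, `s` grows with unit speed
  have hsΦ : ∀ t ∈ Metric.ball (0 : ℝ) r, ∀ x ∈ Metric.ball x₀ r, s (Φ (t, x)) = s x + t := by
    intro t ht x hx
    have hd : ∀ τ ∈ Metric.ball (0 : ℝ) r, HasDerivAt (fun τ => s (Φ (τ, x)) - τ) 0 τ := by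
      intro τ hτ
      have hmemU := hρU (hrΦ τ hτ x hx)
      have h1 := (hsd _ hmemU).comp_hasDerivAt τ (hflow τ hτ x hx)
      rw [hsX _ hmemU] at h1
      have h2 := h1.sub (hasDerivAt_id τ)
      rw [sub_self] at h2
      exact h2
    have hconst := (convex_ball (0 : ℝ) r).is_const_of_fderivWithin_eq_zero
      (f := fun τ => s (Φ (τ, x)) - τ) (𝕜 := ℝ)
      (fun τ hτ => (hd τ hτ).differentiableAt.differentiableWithinAt)
      (fun τ hτ => by
        rw [fderivWithin_of_isOpen Metric.isOpen_ball hτ, (hd τ hτ).hasFDerivAt.fderiv]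
        ext; simp)
      ht (Metric.mem_ball_self hr)
    rw [hΦ0 x (Metric.ball_subset_ball hrr₀ hx)] at hconst
    linarith
  have hℓ : fderiv ℝ s x₀ ≠ 0 := fun h => by
    have := hsX x₀ hx₀
    rw [h] at this
    simp at this
  obtain ⟨ι, hι, hℓι⟩ := exists_injective_ker hℓ
  let ψ : Coord (m + 1) → Coord (m + 1) := fun u => x₀ + ι (dropFirst u)
  have hψ : ContDiff ℝ ∞ ψ := contDiff_const.add (ι.contDiff.comp contDiff_dropFirst)
  set u₀ : Coord (m + 1) := consCoord (s x₀) 0 with hu₀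
  have hψu₀ : ψ u₀ = x₀ := by
    simp [ψ, hu₀]
  let O : Set (Coord (m + 1)) :=
    {u | ψ u ∈ Metric.ball x₀ r} ∩ (fun u => u 0 - s (ψ u)) ⁻¹' Metric.ball 0 r
  have hO₁ : IsOpen {u | ψ u ∈ Metric.ball x₀ r} :=
    Metric.isOpen_ball.preimage hψ.continuous
  have hsψ : ContDiffOn ℝ ∞ (fun u => u 0 - s (ψ u)) {u | ψ u ∈ Metric.ball x₀ r} :=
    contDiff_coord_zero.contDiffOn.sub (hs.comp hψ.contDiffOn fun u hu =>
      hρU (Metric.ball_subset_ball hrρ hu))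
  have hO : IsOpen O := hsψ.continuousOn.isOpen_inter_preimage hO₁ Metric.isOpen_ball
  let κ : Coord (m + 1) → Coord (m + 1) := fun u => Φ (u 0 - s (ψ u), ψ u)
  have hκ : ContDiffOn ℝ ∞ κ O :=
    hΦ.comp ((hsψ.mono Set.inter_subset_left).prodMk hψ.contDiffOn) fun u hu =>
      ⟨Metric.ball_subset_ball hrr₀ hu.2, Metric.ball_subset_ball hrr₀ hu.1⟩
  have hu₀O : u₀ ∈ O := by
    constructor
    · change ψ u₀ ∈ Metric.ball x₀ r
      rw [hψu₀]; exact Metric.mem_ball_self hr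
    · change u₀ 0 - s (ψ u₀) ∈ Metric.ball (0 : ℝ) r
      rw [hψu₀, hu₀, consCoord_zero, sub_self]; exact Metric.mem_ball_self hr
  have hκu₀ : κ u₀ = x₀ := by
    change Φ (u₀ 0 - s (ψ u₀), ψ u₀) = x₀
    rw [hψu₀, hu₀, consCoord_zero, sub_self, hΦx₀]
  -- the derivative of `κ` at the base point
  let proj0 : Coord (m + 1) →L[ℝ] ℝ := EuclideanSpace.proj (0 : Fin (m + 1))
  let A : Coord (m + 1) →L[ℝ] Coord (m + 1) :=
    proj0.smulRight (X x₀) + ι ∘L dropFirstL m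
  have hA : HasFDerivAt κ A u₀ := by
    have hψd : HasFDerivAt ψ (ι ∘L dropFirstL m) u₀ :=
      (ι ∘L dropFirstL m).hasFDerivAt.const_add x₀
    have h1 : HasFDerivAt (fun u => u 0 - s (ψ u))
        (proj0 - fderiv ℝ s x₀ ∘L (ι ∘L dropFirstL m)) u₀ := by
      have hs' : HasFDerivAt s (fderiv ℝ s x₀) (ψ u₀) := by rw [hψu₀]; exact hsd x₀ hx₀
      exact (proj0.hasFDerivAt (x := u₀)).sub (hs'.comp u₀ hψd)
    obtain ⟨D, hD⟩ := hΦc.differentiableAt (by simp)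
    have hD' : HasFDerivAt Φ D (u₀ 0 - s (ψ u₀), ψ u₀) := by
      rw [hψu₀, hu₀, consCoord_zero, sub_self]; exact hD
    refine (hD'.comp u₀ (h1.prodMk hψd)).congr_fderiv ?_
    have hDt : ∀ t : ℝ, D (t, 0) = t • X x₀ := by
      have h2 : HasDerivAt (fun t : ℝ => Φ (t, x₀)) (D (1, 0)) 0 :=
        hD.comp_hasDerivAt 0 ((hasDerivAt_id (0 : ℝ)).prodMk (hasDerivAt_const (0 : ℝ) x₀))
      have h3 := h2.unique (hflow 0 (Metric.mem_ball_self hr) x₀ (Metric.mem_ball_self hr))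
      intro t
      have h4 : ((t, 0) : ℝ × Coord (m + 1)) = t • ((1 : ℝ), (0 : Coord (m + 1))) := by simp
      rw [h4, map_smul, h3, hΦx₀]
    have hDx : ∀ v, D (0, v) = v := by
      have h2 : HasFDerivAt (fun x => Φ ((0 : ℝ), x))
          (D ∘L (ContinuousLinearMap.inr ℝ ℝ (Coord (m + 1)))) x₀ :=
        hD.comp x₀ (hasFDerivAt_prodMk_right (0 : ℝ) x₀)
      have h3 : HasFDerivAt (fun x => Φ ((0 : ℝ), x)) (ContinuousLinearMap.id ℝ _) x₀ := by
        refine (hasFDerivAt_id x₀).congr_of_eventuallyEq ?_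
        filter_upwards [Metric.ball_mem_nhds x₀ hr₀] with x hx using hΦ0 x hx
      intro v
      exact congrArg (fun L => L v) (h2.unique h3)
    ext1 v
    have h5 : ∀ (a : ℝ) (b : Coord (m + 1)), D (a, b) = a • X x₀ + b := by
      intro a b
      have : ((a, b) : ℝ × Coord (m + 1)) = (a, 0) + (0, b) := by simp
      rw [this, map_add, hDt, hDx]
    simp [A, h5, hℓι]
  have hAinj : Function.Injective A := by
    rw [injective_iff_map_eq_zero]
    intro v hv
    have h1 : v 0 • X x₀ + ι (dropFirst v) = 0 := hv
    have h2 : v 0 = 0 := by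
      have := congrArg (fderiv ℝ s x₀) h1
      simpa [hℓι, hsX x₀ hx₀] using this
    rw [h2, zero_smul, zero_add] at h1
    have h3 : dropFirst v = 0 := hι (by rw [h1, map_zero])
    rw [← consCoord_dropFirst v, h2, h3]
    ext i; refine Fin.cases ?_ (fun a => ?_) i <;> simp
  let A' : Coord (m + 1) ≃L[ℝ] Coord (m + 1) :=
    (LinearEquiv.ofInjectiveEndo (A : Coord (m + 1) →ₗ[ℝ] Coord (m + 1))
      hAinj).toContinuousLinearEquiv
  have hA' : (A' : Coord (m + 1) →L[ℝ] Coord (m + 1)) = A := by ext1 v; rfl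
  obtain ⟨e, heu₀, heO, heκ, hes⟩ := exists_openPartialHomeomorph_of_hasFDerivAt hO hκ hu₀O
    (f' := A') (by rw [hA']; exact hA)
  obtain ⟨δ, hδ, hbox⟩ := exists_coordBox_subset (e.open_source.mem_nhds heu₀)
  have hu₀box : u₀ ∈ (coordBox (s x₀) δ : Set (Coord (m + 1))) := by
    simp [coordBox, hu₀, hδ]
  have hsource : (e.restrOpen _ (isOpen_coordBox (s x₀) δ)).source = coordBox (s x₀) δ := by
    rw [OpenPartialHomeomorph.restrOpen_source]; exact Set.inter_eq_right.2 hbox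
  have hboxO : ∀ u ∈ (coordBox (s x₀) δ : Set (Coord (m + 1))), u ∈ O := fun u hu => heO (hbox hu)
  have htarget : (e.restrOpen _ (isOpen_coordBox (s x₀) δ)).target ⊆ e.target := fun x hx => hx.1
  refine ⟨e.restrOpen _ (isOpen_coordBox (s x₀) δ), δ, hδ, hsource, ?_, ?_, ?_, ?_, ?_, ?_⟩
  · intro x hx
    have h1 := (e.restrOpen _ (isOpen_coordBox (s x₀) δ)).map_target hx
    rw [hsource] at h1
    have h2 := e.right_inv (htarget hx)
    rw [heκ] at h2
    rw [← h2]
    have h3 := hboxO _ h1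
    exact hρU (hrΦ _ h3.2 _ h3.1)
  · have := (e.restrOpen _ (isOpen_coordBox (s x₀) δ)).map_source (x := u₀) (by rwa [hsource])
    rwa [OpenPartialHomeomorph.coe_restrOpen, heκ, hκu₀] at this
  · rw [OpenPartialHomeomorph.coe_restrOpen, heκ, hsource]
    exact hκ.mono hboxO
  · exact hes.mono htarget
  · intro u hu
    rw [hsource] at hu
    have h3 := hboxO _ hu
    rw [OpenPartialHomeomorph.coe_restrOpen, heκ]
    change s (Φ (u 0 - s (ψ u), ψ u)) = u 0
    rw [hsΦ _ h3.2 _ h3.1]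
    ring
  · intro u hu
    rw [hsource] at hu
    have h3 := hboxO _ hu
    rw [OpenPartialHomeomorph.coe_restrOpen, heκ]
    have hd : HasFDerivAt κ (fderiv ℝ κ u) (u + (0 : ℝ) • EuclideanSpace.single 0 (1 : ℝ)) := by
      rw [zero_smul, add_zero]
      exact ((hκ.contDiffAt (hO.mem_nhds h3)).differentiableAt (by simp)).hasFDerivAt
    have h4 := hd.comp_hasDerivAt 0 (hasDerivAt_line u 0)
    have hψl : ∀ t : ℝ, ψ (u + t • EuclideanSpace.single 0 (1 : ℝ)) = ψ u := by
      intro t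
      simp only [ψ]
      congr 2
      ext a
      simp [dropFirst]
    have h5 : HasDerivAt (fun t : ℝ => Φ (u 0 - s (ψ u) + t, ψ u)) (X (κ u)) 0 := by
      have h6 := hflow (u 0 - s (ψ u)) h3.2 _ h3.1
      have h7 : HasDerivAt (fun t => Φ (t, ψ u)) (X (κ u)) (u 0 - s (ψ u) + 0) := by
        rw [add_zero]; exact h6
      exact h7.comp_const_add (u 0 - s (ψ u)) 0
    refine h4.unique (h5.congr_of_eventuallyEq (Filter.Eventually.of_forall fun t => ?_))
    change Φ (_ - s (ψ _), ψ _) = _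
    rw [hψl]
    congr 2
    simp
    ring

end FlowBox

/-! ### Functions of the first coordinate -/

section FirstCoordinate

variable {m : ℕ} {t₀ δ : ℝ}

/-- The inclusion of the last coordinates. -/
def consL (m : ℕ) : Coord m →L[ℝ] Coord (m + 1) :=
  LinearMap.toContinuousLinearMap
    { toFun := consCoord 0
      map_add' := fun u v => by ext i; refine Fin.cases ?_ (fun a => ?_) i <;> simp
      map_smul' := fun c u => by ext i; refine Fin.cases ?_ (fun a => ?_) i <;> simp }

lemma consL_single (a : Fin m) :
    consL m (EuclideanSpace.single a 1) = EuclideanSpace.single a.succ 1 := by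
  change consCoord 0 _ = _
  ext i
  refine Fin.cases ?_ (fun b => ?_) i
  · simp [Fin.succ_ne_zero, eq_comm]
  · simp

lemma hasFDerivAt_consCoord (t : ℝ) (y : Coord m) : HasFDerivAt (consCoord t) (consL m) y := by
  have h : (consCoord t : Coord m → Coord (m + 1)) = fun y => consCoord t 0 + consL m y := by
    funext y
    change _ = consCoord t 0 + consCoord 0 y
    ext i; refine Fin.cases ?_ (fun a => ?_) i <;> simp
  rw [h]
  exact (consL m).hasFDerivAt.const_add _

lemma pd_comp_consCoord {F : Coord (m + 1) → ℝ} {t : ℝ} {y : Coord m}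
    (hF : DifferentiableAt ℝ F (consCoord t y)) (a : Fin m) :
    pd a (fun y => F (consCoord t y)) y = pd a.succ F (consCoord t y) := by
  have h := hF.hasFDerivAt.comp y (hasFDerivAt_consCoord t y)
  change fderiv ℝ (F ∘ consCoord t) y _ = _
  rw [h.fderiv, ContinuousLinearMap.comp_apply, consL_single, pd]

lemma hasDerivAt_consCoord (t : ℝ) (y : Coord m) :
    HasDerivAt (fun t => consCoord t y) (EuclideanSpace.single 0 1) t := by
  have h : (fun t => consCoord t y) =
      fun t : ℝ => consCoord 0 y + t • EuclideanSpace.single (0 : Fin (m + 1)) (1 : ℝ) := by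
    funext t
    ext i; refine Fin.cases ?_ (fun a => ?_) i <;> simp
  rw [h]
  simpa using ((hasDerivAt_id t).smul_const
    (EuclideanSpace.single (0 : Fin (m + 1)) (1 : ℝ))).const_add (consCoord 0 y)

lemma hasDerivAt_comp_consCoord {F : Coord (m + 1) → ℝ} {t : ℝ} {y : Coord m}
    (hF : DifferentiableAt ℝ F (consCoord t y)) :
    HasDerivAt (fun t => F (consCoord t y)) (pd 0 F (consCoord t y)) t :=
  hF.hasFDerivAt.comp_hasDerivAt t (hasDerivAt_consCoord t y)

lemma eq_zero_of_pd_eq_zero {n : ℕ} {L : Coord n →L[ℝ] ℝ}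
    (h : ∀ a, L (EuclideanSpace.single a 1) = 0) : L = 0 := by
  ext v
  rw [← (EuclideanSpace.basisFun (Fin n) ℝ).sum_repr v]
  simp [h]

lemma consCoord_mem_coordBox {t : ℝ} {y : Coord m} :
    consCoord t y ∈ (coordBox t₀ δ : Set (Coord (m + 1))) ↔
      t ∈ Set.Ioo (t₀ - δ) (t₀ + δ) ∧ y ∈ Metric.ball (0 : Coord m) δ := Iff.rfl

/-- On a box, a function with vanishing derivatives in all directions but the first depends on the
first coordinate only. -/
lemma eq_of_pd_succ_eq_zero {F : Coord (m + 1) → ℝ}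
    (hF : ∀ u ∈ (coordBox t₀ δ : Set (Coord (m + 1))), DifferentiableAt ℝ F u)
    (h0 : ∀ u ∈ (coordBox t₀ δ : Set (Coord (m + 1))), ∀ a : Fin m, pd a.succ F u = 0)
    {u v : Coord (m + 1)} (hu : u ∈ (coordBox t₀ δ : Set (Coord (m + 1))))
    (hv : v ∈ (coordBox t₀ δ : Set (Coord (m + 1)))) (huv : u 0 = v 0) : F u = F v := by
  have hmem : ∀ y ∈ Metric.ball (0 : Coord m) δ,
      consCoord (u 0) y ∈ (coordBox t₀ δ : Set (Coord (m + 1))) := fun y hy => ⟨hu.1, hy⟩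
  have hd : ∀ y ∈ Metric.ball (0 : Coord m) δ,
      HasFDerivAt (fun y => F (consCoord (u 0) y)) (0 : Coord m →L[ℝ] ℝ) y := by
    intro y hy
    have h := (hF _ (hmem y hy)).hasFDerivAt.comp y (hasFDerivAt_consCoord (u 0) y)
    refine h.congr_fderiv (eq_zero_of_pd_eq_zero fun a => ?_)
    rw [ContinuousLinearMap.comp_apply, consL_single]
    exact h0 _ (hmem y hy) a
  have h := (convex_ball (0 : Coord m) δ).is_const_of_fderivWithin_eq_zero (𝕜 := ℝ)
    (f := fun y => F (consCoord (u 0) y))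
    (fun y hy => (hd y hy).differentiableAt.differentiableWithinAt)
    (fun y hy => by rw [fderivWithin_of_isOpen Metric.isOpen_ball hy, (hd y hy).fderiv])
    hu.2 hv.2
  rw [consCoord_dropFirst, huv, consCoord_dropFirst] at h
  exact h

lemma consCoord_zero_mem_coordBox {t : ℝ} (hδ : 0 < δ) (ht : t ∈ Set.Ioo (t₀ - δ) (t₀ + δ)) :
    consCoord t (0 : Coord m) ∈ (coordBox t₀ δ : Set (Coord (m + 1))) :=
  ⟨ht, Metric.mem_ball_self hδ⟩

lemma contDiffOn_comp_consCoord {F : Coord (m + 1) → ℝ} (hδ : 0 < δ)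
    (hF : ContDiffOn ℝ ∞ F (coordBox t₀ δ)) :
    ContDiffOn ℝ ∞ (fun t => F (consCoord t 0)) (Set.Ioo (t₀ - δ) (t₀ + δ)) :=
  hF.comp (contDiff_consCoord.comp (contDiff_id.prodMk contDiff_const)).contDiffOn
    fun _ ht => consCoord_zero_mem_coordBox hδ ht

/-- A smooth function on an open interval has a smooth antiderivative. -/
lemma exists_smooth_antideriv {a b : ℝ} {W : ℝ → ℝ} (hW : ContDiffOn ℝ ∞ W (Set.Ioo a b)) {t₁ : ℝ}
    (ht₁ : t₁ ∈ Set.Ioo a b) : ∃ S : ℝ → ℝ, ContDiffOn ℝ ∞ S (Set.Ioo a b) ∧ S t₁ = 0 ∧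
      ∀ t ∈ Set.Ioo a b, HasDerivAt S (W t) t := by
  have hd : ∀ t ∈ Set.Ioo a b, HasDerivAt (fun t => ∫ τ in t₁..t, W τ) (W t) t := by
    intro t ht
    refine intervalIntegral.integral_hasDerivAt_right
      ((hW.continuousOn.mono ?_).intervalIntegrable)
      (hW.continuousOn.stronglyMeasurableAtFilter isOpen_Ioo t ht)
      (hW.continuousOn.continuousAt (isOpen_Ioo.mem_nhds ht))
    exact Set.ordConnected_Ioo.uIcc_subset ht₁ ht
  refine ⟨fun t => ∫ τ in t₁..t, W τ, ?_, by simp, hd⟩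
  rw [contDiffOn_infty_iff_deriv_of_isOpen isOpen_Ioo]
  exact ⟨fun t ht => (hd t ht).differentiableAt.differentiableWithinAt,
    hW.congr fun t ht => (hd t ht).deriv⟩

/-- If `dw` is a multiple of `df` and `df ≠ 0`, then `w` is locally a smooth function of `f`. -/
lemma exists_eq_comp_of_fderiv_parallel {U : Set (Coord (m + 1))} (hU : IsOpen U)
    {f w : Coord (m + 1) → ℝ} (hf : ContDiffOn ℝ ∞ f U) (hw : ContDiffOn ℝ ∞ w U)
    (hpar : ∀ x ∈ U, ∃ c : ℝ, fderiv ℝ w x = c • fderiv ℝ f x) {x₀ : Coord (m + 1)} (hx₀ : x₀ ∈ U)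
    (hf0 : fderiv ℝ f x₀ ≠ 0) :
    ∃ δ > 0, ∃ (W : ℝ → ℝ) (N : Set (Coord (m + 1))),
      ContDiffOn ℝ ∞ W (Set.Ioo (f x₀ - δ) (f x₀ + δ)) ∧ IsOpen N ∧ x₀ ∈ N ∧ N ⊆ U ∧
      ∀ x ∈ N, f x ∈ Set.Ioo (f x₀ - δ) (f x₀ + δ) ∧ w x = W (f x) := by
  obtain ⟨v, hv⟩ : ∃ v, fderiv ℝ f x₀ v ≠ 0 := by
    by_contra! h
    exact hf0 (ContinuousLinearMap.ext h)
  have hdf : ContDiffOn ℝ ∞ (fun x => fderiv ℝ f x v) U :=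
    (hf.fderiv_of_isOpen hU (by simp)).clm_apply contDiffOn_const
  set U' := U ∩ (fun x => fderiv ℝ f x v) ⁻¹' {0}ᶜ with hU'
  have hU'o : IsOpen U' := hdf.continuousOn.isOpen_inter_preimage hU isOpen_compl_singleton
  have hX : ContDiffOn ℝ ∞ (fun x => (fderiv ℝ f x v)⁻¹ • v) U' :=
    ((hdf.mono Set.inter_subset_left).inv fun x hx => hx.2).smul contDiffOn_const
  obtain ⟨e, δ, hδ, hsrc, htgt, hx₀e, he, hes, hfe, -⟩ := exists_flowBox hU'o
    (hf.mono Set.inter_subset_left) hX (fun x hx => by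
      rw [map_smul, smul_eq_mul, inv_mul_cancel₀ hx.2]) (x₀ := x₀) ⟨hx₀, hv⟩
  have hbo : IsOpen (coordBox (f x₀) δ : Set (Coord (m + 1))) := isOpen_coordBox _ _
  have hwe : ContDiffOn ℝ ∞ (fun u => w (e u)) (coordBox (f x₀) δ) := by
    rw [← hsrc]
    exact hw.comp he fun u hu => (htgt (e.map_source hu)).1
  have hz : ∀ u ∈ (coordBox (f x₀) δ : Set (Coord (m + 1))), ∀ a : Fin m,
      pd a.succ (fun u => w (e u)) u = 0 := by
    intro u hu a
    have hus : u ∈ e.source := by rwa [hsrc]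
    have hU1 := (htgt (e.map_source hus)).1
    have hde := ((he.contDiffAt (e.open_source.mem_nhds hus)).differentiableAt
      (by simp)).hasFDerivAt
    have hdw := ((hw.contDiffAt (hU.mem_nhds hU1)).differentiableAt (by simp)).hasFDerivAt
    have hdf := ((hf.contDiffAt (hU.mem_nhds hU1)).differentiableAt (by simp)).hasFDerivAt
    obtain ⟨c, hc⟩ := hpar _ hU1
    have h1 : fderiv ℝ (fun u => f (e u)) u (EuclideanSpace.single a.succ 1) = 0 := by
      have h2 : (fun u => f (e u)) =ᶠ[𝓝 u] fun u => u 0 := by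
        filter_upwards [e.open_source.mem_nhds hus] with y hy using hfe y hy
      rw [h2.fderiv_eq]
      have h3 : HasFDerivAt (fun u : Coord (m + 1) => u 0)
        (EuclideanSpace.proj (𝕜 := ℝ) (0 : Fin (m + 1)) : Coord (m + 1) →L[ℝ] ℝ) u :=
        (EuclideanSpace.proj (𝕜 := ℝ) (0 : Fin (m + 1)) : Coord (m + 1) →L[ℝ] ℝ).hasFDerivAt
      rw [h3.fderiv]
      simp
    have h4 : fderiv ℝ (fun u => f (e u)) u = (fderiv ℝ f (e u)).comp (fderiv ℝ e u) :=
      (hdf.comp u hde).fderiv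
    have h5 : fderiv ℝ (fun u => w (e u)) u = (fderiv ℝ w (e u)).comp (fderiv ℝ e u) :=
      (hdw.comp u hde).fderiv
    rw [h4, ContinuousLinearMap.comp_apply] at h1
    rw [pd, h5, ContinuousLinearMap.comp_apply, hc, smul_apply, h1, smul_zero]
  refine ⟨δ, hδ, fun t => w (e (consCoord t 0)), e.target, contDiffOn_comp_consCoord hδ hwe,
    e.open_target, hx₀e, fun x hx => (htgt hx).1, fun x hx => ?_⟩
  have h1 := e.map_target hx
  have h2 := hfe _ h1
  rw [e.right_inv hx] at h2
  rw [hsrc] at h1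
  have h3 : f x ∈ Set.Ioo (f x₀ - δ) (f x₀ + δ) := by rw [h2]; exact h1.1
  refine ⟨h3, ?_⟩
  have h4 := eq_of_pd_succ_eq_zero (fun u hu => ContDiffOn.dAt hbo hwe hu) hz h1
    (consCoord_zero_mem_coordBox hδ h3) (by rw [consCoord_zero, h2])
  rw [e.right_inv hx] at h4
  exact h4

end FirstCoordinate

/-! ### Coordinates adapted to the potential -/

section Adapted

lemma fderiv_eq_sum_pd {n : ℕ} (F : Coord n → ℝ) (u X : Coord n) :
    fderiv ℝ F u X = ∑ i, pd i F u * X i := by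
  conv_lhs => rw [← (EuclideanSpace.basisFun (Fin n) ℝ).sum_repr X]
  simp [pd, mul_comm]

lemma fderiv_ne_zero_of_pd {n : ℕ} {F : Coord n → ℝ} {u : Coord n} {k : Fin n}
    (h : pd k F u ≠ 0) : fderiv ℝ F u ≠ 0 := fun h0 => h (by simp [pd, h0])

variable {n : ℕ} {G : MetricCoeff n} {V : Set (Coord n)} {u : Coord n} {f : Coord n → ℝ}

lemma grad_smooth (hV : IsOpen V) (hG : IsMetricOn G V) (hf : ContDiffOn ℝ ∞ f V) (l : Fin n) :
    ContDiffOn ℝ ∞ (fun u => grad G f u l) V :=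
  ContDiffOn.sum fun m _ => (hG.inv_smooth l m).mul (ContDiffOn.pd hV hf m)

/-- The squared length of the gradient. -/
def gradSq (G : MetricCoeff n) (f : Coord n → ℝ) (u : Coord n) : ℝ :=
  ∑ i, pd i f u * grad G f u i

lemma gradSq_smooth (hV : IsOpen V) (hG : IsMetricOn G V) (hf : ContDiffOn ℝ ∞ f V) :
    ContDiffOn ℝ ∞ (gradSq G f) V :=
  ContDiffOn.sum fun i _ => (ContDiffOn.pd hV hf i).mul (grad_smooth hV hG hf i)

/-- `d|∇f|² = 2 Hess f(∇f, ·)`. -/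
lemma pd_gradSq (hV : IsOpen V) (hG : IsMetricOn G V) (hf : ContDiffOn ℝ ∞ f V) (hu : u ∈ V)
    (k : Fin n) : pd k (gradSq G f) u = 2 * ∑ j, hess G f u k j * grad G f u j := by
  have hfd := fun i => ContDiffOn.pd hV hf i
  have hS : MSmooth (fun v => Matrix.of fun i j => pd i f v * pd j f v) V :=
    fun i j => (hfd i).mul (hfd j)
  have h1 := contract_nabla2 hV hG hu hS k
  have h2 : (fun v => ∑ a, ∑ b, (G v)⁻¹ a b * (Matrix.of fun i j => pd i f v * pd j f v) a b) =
      gradSq G f := by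
    funext v
    simp only [gradSq, grad, Finset.mul_sum, Matrix.of_apply]
    exact Finset.sum_congr rfl fun a _ => Finset.sum_congr rfl fun b _ => by ring
  have h3 : ∀ i j, nabla2 G (fun v => Matrix.of fun i j => pd i f v * pd j f v) u k i j =
      hess G f u k i * pd j f u + hess G f u k j * pd i f u := by
    intro i j
    simp only [nabla2, Matrix.of_apply, hess]
    rw [pd_mul (ContDiffOn.dAt hV (hfd i) hu) (ContDiffOn.dAt hV (hfd j) hu)]
    have e1 : ∑ p, christoffel G p k i u * (pd p f u * pd j f u) =
        (∑ p, christoffel G p k i u * pd p f u) * pd j f u := by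
      rw [Finset.sum_mul]; exact Finset.sum_congr rfl fun _ _ => by ring
    have e2 : ∑ p, christoffel G p k j u * (pd i f u * pd p f u) =
        (∑ p, christoffel G p k j u * pd p f u) * pd i f u := by
      rw [Finset.sum_mul]; exact Finset.sum_congr rfl fun _ _ => by ring
    rw [e1, e2]
    ring
  rw [h2] at h1
  rw [← h1]
  simp only [h3]
  have e3 : ∑ a, ∑ b, (G u)⁻¹ a b * (hess G f u k a * pd b f u) =
      ∑ j, hess G f u k j * grad G f u j := by
    simp only [grad, Finset.mul_sum]
    exact Finset.sum_congr rfl fun a _ => Finset.sum_congr rfl fun b _ => by ring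
  have e4 := inv_contract_comm hG hu fun a b => hess G f u k a * pd b f u
  simp only [mul_add, Finset.sum_add_distrib]
  rw [e4, e3]
  ring

/-- `|∇f|²` is locally a function of `f`, since `Hess f(∇f, ·)` is a multiple of `df`. -/
lemma IsStaticOn.fderiv_gradSq_parallel (h : IsStaticOn G f V) (hu : u ∈ V) {k : Fin n}
    (hk : pd k f u ≠ 0) : ∃ c : ℝ, fderiv ℝ (gradSq G f) u = c • fderiv ℝ f u := by
  obtain ⟨hV, hG, hf, hst, hd⟩ := id h
  obtain ⟨μ, hμ⟩ := h.exists_ric_grad hu hk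
  refine ⟨2 * (f u * (μ - scal G u / ((n : ℝ) - 1))), ?_⟩
  rw [← sub_eq_zero]
  refine eq_zero_of_pd_eq_zero fun i => ?_
  have h1 := pd_gradSq hV hG hf hu i
  have h2 : ∑ j, hess G f u i j * grad G f u j =
      f u * (μ - scal G u / ((n : ℝ) - 1)) * pd i f u := by
    have e : ∀ j, hess G f u i j * grad G f u j = f u * (ric G u i j * grad G f u j -
        scal G u / ((n : ℝ) - 1) * (G u i j * grad G f u j)) := by
      intro j; rw [hst u hu]; ring
    simp only [e, ← Finset.mul_sum, Finset.sum_sub_distrib]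
    rw [hμ, sum_metric_mul_grad hG hu]
    ring
  rw [h2] at h1
  simp only [sub_apply, smul_apply, smul_eq_mul]
  change pd i (gradSq G f) u - _ * pd i f u = 0
  rw [h1]
  ring

/-- The coefficients of the pullback of a metric under a map `κ` of coordinate spaces. -/
def pullCoeff {n : ℕ} (κ : Coord n → Coord n) (G : MetricCoeff n) : MetricCoeff n :=
  fun u => Matrix.of fun i j => ∑ a, ∑ b,
    fderiv ℝ κ u (EuclideanSpace.single i 1) a * fderiv ℝ κ u (EuclideanSpace.single j 1) b *
      G (κ u) a b

/-- Near a point where `∇f ≠ 0` there are coordinates whose first coordinate is arc length along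
the gradient lines of `f`: the first coordinate is `s = ∫ df/|∇f|`, a function of `f`, and the
first coordinate vector field is `∇s = ∇f/|∇f|`. -/
theorem IsStaticOn.exists_adapted {m : ℕ} {G : MetricCoeff (m + 1)} {V : Set (Coord (m + 1))}
    {f : Coord (m + 1) → ℝ} (h : IsStaticOn G f V) {x₀ : Coord (m + 1)} (hx₀ : x₀ ∈ V)
    {k : Fin (m + 1)} (hk : pd k f x₀ ≠ 0) :
    ∃ (e : OpenPartialHomeomorph (Coord (m + 1)) (Coord (m + 1))) (t₀ δ : ℝ), 0 < δ ∧
      e.source = coordBox t₀ δ ∧ e.target ⊆ V ∧ x₀ ∈ e.target ∧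
      ContDiffOn ℝ ∞ e e.source ∧ ContDiffOn ℝ ∞ e.symm e.target ∧
      ∀ u ∈ e.source, pullCoeff e G u 0 0 = 1 ∧
        (∀ a : Fin m, pullCoeff e G u 0 a.succ = 0 ∧ pullCoeff e G u a.succ 0 = 0) ∧
        (∀ a : Fin m, pd a.succ (fun v => f (e v)) u = 0) ∧
        pd 0 (fun v => f (e v)) u ≠ 0 := by
  obtain ⟨hV, hG, hf, hst, hd⟩ := id h
  have hfd := ContDiffOn.pd hV hf k
  set U := V ∩ pd k f ⁻¹' {0}ᶜ with hUdef
  have hU : IsOpen U := hfd.continuousOn.isOpen_inter_preimage hV isOpen_compl_singleton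
  have hUV : U ⊆ V := Set.inter_subset_left
  have hw := gradSq_smooth hV hG hf
  have hwpos : ∀ x ∈ U, 0 < gradSq G f x := fun x hx => sum_pd_mul_grad_pos hG hx.1 hx.2
  obtain ⟨δ₁, hδ₁, W, N₁, hW, hN₁, hx₀N₁, hN₁U, hWw⟩ := exists_eq_comp_of_fderiv_parallel hU
    (hf.mono hUV) (hw.mono hUV) (fun x hx => h.fderiv_gradSq_parallel hx.1 hx.2) (x₀ := x₀)
    ⟨hx₀, hk⟩ (fderiv_ne_zero_of_pd hk)
  -- an interval around `f x₀` on which `W` is positive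
  have hcx₀ : f x₀ ∈ Set.Ioo (f x₀ - δ₁) (f x₀ + δ₁) := (hWw x₀ hx₀N₁).1
  have hWpos₀ : 0 < W (f x₀) := by rw [← (hWw x₀ hx₀N₁).2]; exact hwpos x₀ ⟨hx₀, hk⟩
  obtain ⟨δ₂, hδ₂, hsub₂, hWpos⟩ : ∃ δ₂ > 0,
      Set.Ioo (f x₀ - δ₂) (f x₀ + δ₂) ⊆ Set.Ioo (f x₀ - δ₁) (f x₀ + δ₁) ∧
      ∀ t ∈ Set.Ioo (f x₀ - δ₂) (f x₀ + δ₂), 0 < W t := by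
    have h1 : Set.Ioo (f x₀ - δ₁) (f x₀ + δ₁) ∩ W ⁻¹' Set.Ioi 0 ∈ 𝓝 (f x₀) :=
      Filter.inter_mem (isOpen_Ioo.mem_nhds hcx₀)
        ((hW.continuousOn.continuousAt (isOpen_Ioo.mem_nhds hcx₀)).preimage_mem_nhds
          (isOpen_Ioi.mem_nhds hWpos₀))
    obtain ⟨δ₂, hδ₂, h2⟩ := Metric.mem_nhds_iff.1 h1
    rw [Real.ball_eq_Ioo] at h2
    exact ⟨δ₂, hδ₂, fun t ht => (h2 ht).1, fun t ht => (h2 ht).2⟩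
  set I := Set.Ioo (f x₀ - δ₂) (f x₀ + δ₂) with hI
  have hx₀I : f x₀ ∈ I := ⟨by linarith, by linarith⟩
  have hW' : ContDiffOn ℝ ∞ (fun t => (Real.sqrt (W t))⁻¹) I :=
    ((hW.mono hsub₂).sqrt fun t ht => (hWpos t ht).ne').inv fun t ht =>
      (Real.sqrt_pos.2 (hWpos t ht)).ne'
  obtain ⟨S, hS, -, hSd⟩ := exists_smooth_antideriv hW' hx₀I
  set N := N₁ ∩ f ⁻¹' I with hNdef
  have hN : IsOpen N := ((hf.mono hUV).mono hN₁U).continuousOn.isOpen_inter_preimage hN₁ isOpen_Ioo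
  have hNU : N ⊆ U := fun x hx => hN₁U hx.1
  have hNV : N ⊆ V := hNU.trans hUV
  have hx₀N : x₀ ∈ N := ⟨hx₀N₁, hx₀I⟩
  -- the function `s` and its gradient
  let s : Coord (m + 1) → ℝ := fun x => S (f x)
  have hs : ContDiffOn ℝ ∞ s N := hS.comp (hf.mono hNV) fun x hx => hx.2
  have hds : ∀ x ∈ N, fderiv ℝ s x = (Real.sqrt (gradSq G f x))⁻¹ • fderiv ℝ f x := by
    intro x hx
    have h1 := (hSd (f x) hx.2).comp_hasFDerivAt x (ContDiffOn.dAt hV hf (hNV hx)).hasFDerivAt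
    rw [← (hWw x hx.1).2] at h1
    exact h1.fderiv
  have hsq : ∀ x ∈ N, 0 < Real.sqrt (gradSq G f x) := fun x hx =>
    Real.sqrt_pos.2 (hwpos x (hNU hx))
  let X : Coord (m + 1) → Coord (m + 1) := fun x =>
    WithLp.toLp 2 fun l => (Real.sqrt (gradSq G f x))⁻¹ * grad G f x l
  have hX : ContDiffOn ℝ ∞ X N := by
    rw [contDiffOn_euclidean]
    intro l
    exact (((hw.mono hNV).sqrt fun x hx => (hwpos x (hNU hx)).ne').inv fun x hx =>
      (hsq x hx).ne').mul ((grad_smooth hV hG hf l).mono hNV)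
  have hsX : ∀ x ∈ N, fderiv ℝ s x (X x) = 1 := by
    intro x hx
    rw [hds x hx, smul_apply, fderiv_eq_sum_pd, smul_eq_mul]
    have h1 : ∑ i, pd i f x * X x i = (Real.sqrt (gradSq G f x))⁻¹ * gradSq G f x := by
      simp only [X, gradSq, Finset.mul_sum]
      exact Finset.sum_congr rfl fun _ _ => by ring
    rw [h1, ← mul_assoc, ← mul_inv, Real.mul_self_sqrt (hwpos x (hNU hx)).le,
      inv_mul_cancel₀ (hwpos x (hNU hx)).ne']
  have hGX : ∀ x ∈ N, ∀ b, ∑ a, X x a * G x a b = pd b s x := by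
    intro x hx b
    have h1 : pd b s x = (Real.sqrt (gradSq G f x))⁻¹ * pd b f x := by
      rw [pd, hds x hx]; rfl
    rw [h1, ← sum_metric_mul_grad hG (hNV hx), Finset.mul_sum]
    refine Finset.sum_congr rfl fun a _ => ?_
    rw [hG.symm (hNV hx) a b]
    simp only [X]
    ring
  obtain ⟨e, δ, hδ, hsrc, htgt, hx₀e, he, hes, hse, hXe⟩ := exists_flowBox hN hs hX hsX hx₀N
  refine ⟨e, s x₀, δ, hδ, hsrc, htgt.trans hNV, hx₀e, he, hes, fun u hu => ?_⟩
  have heu := htgt (e.map_source hu)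
  have hde := ((he.contDiffAt (e.open_source.mem_nhds hu)).differentiableAt (by simp)).hasFDerivAt
  have hsde := ((hs.contDiffAt (hN.mem_nhds heu)).differentiableAt (by simp)).hasFDerivAt
  have hfde := (ContDiffOn.dAt hV hf (hNV heu)).hasFDerivAt
  -- `ds` in the new coordinates
  have hse' : ∀ j : Fin (m + 1), fderiv ℝ s (e u) (fderiv ℝ e u (EuclideanSpace.single j 1)) =
      if j = 0 then 1 else 0 := by
    intro j
    have h1 : fderiv ℝ (fun u => s (e u)) u = (fderiv ℝ s (e u)).comp (fderiv ℝ e u) :=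
      (hsde.comp u hde).fderiv
    rw [← ContinuousLinearMap.comp_apply, ← h1]
    have h2 : (fun u => s (e u)) =ᶠ[𝓝 u] fun u => u 0 := by
      filter_upwards [e.open_source.mem_nhds hu] with y hy using hse y hy
    have h3 : HasFDerivAt (fun u : Coord (m + 1) => u 0)
      (EuclideanSpace.proj (𝕜 := ℝ) (0 : Fin (m + 1)) : Coord (m + 1) →L[ℝ] ℝ) u :=
      (EuclideanSpace.proj (𝕜 := ℝ) (0 : Fin (m + 1)) : Coord (m + 1) →L[ℝ] ℝ).hasFDerivAt
    rw [h2.fderiv_eq, h3.fderiv]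
    simp [eq_comm]
  have hpull : ∀ j : Fin (m + 1), pullCoeff e G u 0 j = if j = 0 then 1 else 0 := by
    intro j
    rw [← hse' j, fderiv_eq_sum_pd]
    simp only [pullCoeff, Matrix.of_apply, hXe u hu]
    rw [Finset.sum_comm]
    refine Finset.sum_congr rfl fun b _ => ?_
    rw [← hGX _ heu, Finset.sum_mul]
    exact Finset.sum_congr rfl fun a _ => by ring
  have hsymm : ∀ i j, pullCoeff e G u i j = pullCoeff e G u j i := by
    intro i j
    simp only [pullCoeff, Matrix.of_apply]
    rw [Finset.sum_comm]
    refine Finset.sum_congr rfl fun b _ => Finset.sum_congr rfl fun a _ => ?_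
    rw [hG.symm (hNV heu) a b]
    ring
  have hfs : ∀ j : Fin (m + 1), pd j (fun v => f (e v)) u =
      Real.sqrt (gradSq G f (e u)) * (if j = 0 then 1 else 0) := by
    intro j
    have h1 : fderiv ℝ (fun u => f (e u)) u = (fderiv ℝ f (e u)).comp (fderiv ℝ e u) :=
      (hfde.comp u hde).fderiv
    rw [← hse' j, hds _ heu, pd, h1, ContinuousLinearMap.comp_apply, smul_apply, smul_eq_mul,
      ← mul_assoc, mul_inv_cancel₀ (hsq _ heu).ne', one_mul]
  refine ⟨by rw [hpull]; simp, fun a => ⟨by rw [hpull]; simp [Fin.succ_ne_zero], ?_⟩,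
    fun a => ?_, ?_⟩
  · rw [hsymm, hpull]; simp [Fin.succ_ne_zero]
  · rw [hfs]; simp [Fin.succ_ne_zero]
  · rw [hfs]; simpa using (hsq _ heu).ne'

end Adapted

/-! ### The warped product form and the Einstein fibre -/

section Warped

variable {m : ℕ} {t₀ δ : ℝ} {G : MetricCoeff (m + 1)} {f : Coord (m + 1) → ℝ} {u : Coord (m + 1)}

/-- The Ricci tensor as a trace of the curvature operator. -/
lemma ric_eq_sum_curvOp {n : ℕ} {G : MetricCoeff n} {V : Set (Coord n)} {u : Coord n}
    (hV : IsOpen V) (hG : IsMetricOn G V) (hu : u ∈ V) (i j : Fin n) :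
    ric G u i j = ∑ l, curvOp G l i l j u := by
  have e : ∀ k l, (G u)⁻¹ k l * riem G u ![i, k, j, l] =
      (G u)⁻¹ l k * (G u * curvM G l j u) k i := by
    intro k l
    rw [← riem_pair hV hG hu i k j l, ← riem_apply, riem_swap_left l j,
      riem_swap_right hV hG hu l j k i, hG.inv_symm hu k l, neg_neg]
  have e2 : ∀ l, ∑ k, (G u)⁻¹ l k * (G u * curvM G l j u) k i = curvOp G l i l j u := by
    intro l
    have : (G u)⁻¹ * (G u * curvM G l j u) = curvM G l j u := by
      rw [← mul_assoc, hG.inv_mul hu, one_mul]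
    have h := congrFun (congrFun this l) i
    rwa [Matrix.mul_apply] at h
  simp only [ric, e]
  rw [Finset.sum_comm]
  exact Finset.sum_congr rfl fun l _ => e2 l

/-- A function on a box that depends on the first coordinate only has the same property for its
derivative in that direction. -/
lemma pd_zero_eq_of_zero_eq {F : Coord (m + 1) → ℝ}
    (hF : ∀ u ∈ (coordBox t₀ δ : Set (Coord (m + 1))), DifferentiableAt ℝ F u)
    (hc : ∀ u ∈ (coordBox t₀ δ : Set (Coord (m + 1))), ∀ v ∈ (coordBox t₀ δ : Set (Coord (m + 1))),
      u 0 = v 0 → F u = F v) :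
    ∀ u ∈ (coordBox t₀ δ : Set (Coord (m + 1))), ∀ v ∈ (coordBox t₀ δ : Set (Coord (m + 1))),
      u 0 = v 0 → pd 0 F u = pd 0 F v := by
  intro u hu v hv huv
  have key : ∀ w ∈ (coordBox t₀ δ : Set (Coord (m + 1))),
      HasDerivAt (fun t => F (consCoord t (dropFirst w))) (pd 0 F w) (w 0) := by
    intro w hw
    have h := hasDerivAt_comp_consCoord (F := F) (t := w 0) (y := dropFirst w)
      (by rw [consCoord_dropFirst]; exact hF w hw)
    rwa [consCoord_dropFirst] at h
  have h1 := key u hu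
  have h2 := key v hv
  rw [← huv] at h2
  refine h1.unique (h2.congr_of_eventuallyEq ?_)
  filter_upwards [isOpen_Ioo.mem_nhds hu.1] with t ht
  exact hc (consCoord t (dropFirst u)) ⟨ht, hu.2⟩ (consCoord t (dropFirst v)) ⟨ht, hv.2⟩ (by simp)

/-- Coordinates on a box in which `g_00 = 1`, `g_0a = 0` and `f` depends on the first coordinate
only, with nonvanishing derivative. -/
structure IsAdaptedOn (G : MetricCoeff (m + 1)) (f : Coord (m + 1) → ℝ) (t₀ δ : ℝ) : Prop where
  pos : 0 < δ
  static : IsStaticOn G f (coordBox t₀ δ)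
  metric_zero : ∀ u ∈ (coordBox t₀ δ : Set (Coord (m + 1))), G u 0 0 = 1
  metric_zero_succ : ∀ u ∈ (coordBox t₀ δ : Set (Coord (m + 1))), ∀ a : Fin m, G u 0 a.succ = 0
  pd_succ : ∀ u ∈ (coordBox t₀ δ : Set (Coord (m + 1))), ∀ a : Fin m, pd a.succ f u = 0
  pd_zero : ∀ u ∈ (coordBox t₀ δ : Set (Coord (m + 1))), pd 0 f u ≠ 0

namespace IsAdaptedOn

lemma metric_succ_zero (h : IsAdaptedOn G f t₀ δ) (hu : u ∈ coordBox t₀ δ) (a : Fin m) :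
    G u a.succ 0 = 0 := by
  rw [h.static.metric.symm hu, h.metric_zero_succ u hu]

lemma pd_metric_zero (h : IsAdaptedOn G f t₀ δ) (hu : u ∈ coordBox t₀ δ) (k j : Fin (m + 1)) :
    pd k (fun v => G v j 0) u = 0 ∧ pd k (fun v => G v 0 j) u = 0 := by
  have hV := h.static.isOpen
  refine Fin.cases ?_ (fun a => ?_) j
  · rw [pd_congr_on hV hu h.metric_zero]; simp
  · rw [pd_congr_on hV hu (fun v hv => h.metric_succ_zero hv a),
      pd_congr_on hV hu (fun v hv => h.metric_zero_succ v hv a)]; simp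

lemma inv_zero (h : IsAdaptedOn G f t₀ δ) (hu : u ∈ coordBox t₀ δ) (j : Fin (m + 1)) :
    (G u)⁻¹ 0 j = if 0 = j then 1 else 0 := by
  have h1 := congrFun (congrFun (h.static.metric.mul_inv hu) 0) j
  rw [Matrix.mul_apply, Fin.sum_univ_succ, h.metric_zero u hu, Matrix.one_apply] at h1
  simpa [h.metric_zero_succ u hu] using h1

lemma inv_zero_zero (h : IsAdaptedOn G f t₀ δ) (hu : u ∈ coordBox t₀ δ) :
    (G u)⁻¹ 0 0 = 1 := by simpa using h.inv_zero hu 0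

lemma inv_zero_succ (h : IsAdaptedOn G f t₀ δ) (hu : u ∈ coordBox t₀ δ) (a : Fin m) :
    (G u)⁻¹ 0 a.succ = 0 := by simpa [(Fin.succ_ne_zero a).symm] using h.inv_zero hu a.succ

lemma inv_succ_zero (h : IsAdaptedOn G f t₀ δ) (hu : u ∈ coordBox t₀ δ) (a : Fin m) :
    (G u)⁻¹ a.succ 0 = 0 := by rw [h.static.metric.inv_symm hu, h.inv_zero_succ hu]

lemma christoffel_zero (h : IsAdaptedOn G f t₀ δ) (hu : u ∈ coordBox t₀ δ) (i j : Fin (m + 1)) :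
    christoffel G 0 i j u = -(1 / 2) * pd 0 (fun v => G v i j) u := by
  rw [christoffel, Fin.sum_univ_succ]
  simp [h.inv_zero_zero hu, h.inv_zero_succ hu, (h.pd_metric_zero hu _ _).1]

lemma christoffel_zero_zero (h : IsAdaptedOn G f t₀ δ) (hu : u ∈ coordBox t₀ δ)
    (j : Fin (m + 1)) : christoffel G 0 0 j u = 0 ∧ christoffel G 0 j 0 u = 0 := by
  rw [h.christoffel_zero hu, h.christoffel_zero hu, (h.pd_metric_zero hu _ _).1,
    (h.pd_metric_zero hu _ _).2]
  simp

lemma hess_zero_zero (h : IsAdaptedOn G f t₀ δ) (hu : u ∈ coordBox t₀ δ) :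
    hess G f u 0 0 = pd 0 (pd 0 f) u := by
  rw [hess, Fin.sum_univ_succ]
  simp [(h.christoffel_zero_zero hu 0).1, h.pd_succ u hu]

lemma hess_succ_succ (h : IsAdaptedOn G f t₀ δ) (hu : u ∈ coordBox t₀ δ) (a b : Fin m) :
    hess G f u a.succ b.succ = (1 / 2) * pd 0 (fun v => G v a.succ b.succ) u * pd 0 f u := by
  rw [hess, Fin.sum_univ_succ, h.christoffel_zero hu,
    pd_congr_on h.static.isOpen hu fun v hv => h.pd_succ v hv b]
  simp [h.pd_succ u hu]

lemma sum_pd_mul_grad (h : IsAdaptedOn G f t₀ δ) (hu : u ∈ coordBox t₀ δ) :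
    ∑ i, pd i f u * grad G f u i = pd 0 f u ^ 2 := by
  rw [Fin.sum_univ_succ]
  simp only [h.pd_succ u hu, zero_mul, Finset.sum_const_zero, add_zero, grad, Fin.sum_univ_succ,
    h.inv_zero_zero hu, mul_zero]
  ring

end IsAdaptedOn

/-- The logarithmic derivative `h' / h` of the warping function, read off from the trace of the
static equation. -/
def warpRate (G : MetricCoeff (m + 1)) (f : Coord (m + 1) → ℝ) (u : Coord (m + 1)) : ℝ :=
  -(pd 0 (pd 0 f) u + f u * scal G u / m) / (m * pd 0 f u)

namespace IsAdaptedOn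

lemma warpRate_smooth (h : IsAdaptedOn G f t₀ δ) (hm : 0 < m) :
    ContDiffOn ℝ ∞ (warpRate G f) (coordBox t₀ δ) := by
  obtain ⟨hV, hG, hf, -, -⟩ := h.static
  have hf0 := ContDiffOn.pd hV hf 0
  refine ((((ContDiffOn.pd hV hf0 0).add ((hf.mul (scal_smooth hV hG)).div_const _)).neg).div
    (contDiffOn_const.mul hf0) fun u hu => ?_)
  exact mul_ne_zero (by exact_mod_cast hm.ne') (h.pd_zero u hu)

lemma potential_eq (h : IsAdaptedOn G f t₀ δ) : ∀ u ∈ (coordBox t₀ δ : Set (Coord (m + 1))),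
    ∀ v ∈ (coordBox t₀ δ : Set (Coord (m + 1))), u 0 = v 0 → f u = f v := fun _ hu _ hv huv =>
  eq_of_pd_succ_eq_zero (fun _ hw => ContDiffOn.dAt h.static.isOpen h.static.smooth hw)
    h.pd_succ hu hv huv

lemma pd_potential_eq (h : IsAdaptedOn G f t₀ δ) : ∀ u ∈ (coordBox t₀ δ : Set (Coord (m + 1))),
    ∀ v ∈ (coordBox t₀ δ : Set (Coord (m + 1))), u 0 = v 0 → pd 0 f u = pd 0 f v :=
  pd_zero_eq_of_zero_eq (fun _ hw => ContDiffOn.dAt h.static.isOpen h.static.smooth hw)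
    h.potential_eq

lemma scal_eq (h : IsAdaptedOn G f t₀ δ) : ∀ u ∈ (coordBox t₀ δ : Set (Coord (m + 1))),
    ∀ v ∈ (coordBox t₀ δ : Set (Coord (m + 1))), u 0 = v 0 → scal G u = scal G v := by
  obtain ⟨hV, hG, hf, -, hd⟩ := h.static
  exact fun _ hu _ hv huv => eq_of_pd_succ_eq_zero
    (fun _ hw => ContDiffOn.dAt hV (scal_smooth hV hG) hw)
    (fun w hw a => pd_scal_eq_zero hV hG hw (hd w hw) a.succ) hu hv huv

lemma warpRate_eq (h : IsAdaptedOn G f t₀ δ) : ∀ u ∈ (coordBox t₀ δ : Set (Coord (m + 1))),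
    ∀ v ∈ (coordBox t₀ δ : Set (Coord (m + 1))), u 0 = v 0 →
      warpRate G f u = warpRate G f v := by
  intro u hu v hv huv
  have hV := h.static.isOpen
  have h2 := pd_zero_eq_of_zero_eq (fun _ hw => ContDiffOn.dAt hV
    (ContDiffOn.pd hV h.static.smooth 0) hw) h.pd_potential_eq u hu v hv huv
  rw [warpRate, warpRate, h2, h.potential_eq u hu v hv huv, h.scal_eq u hu v hv huv,
    h.pd_potential_eq u hu v hv huv]

/-- The static equation in directions orthogonal to `∇f`; the coefficient of the metric is found by
comparing the static equation in the direction of `∇f` with the trace of the Ricci tensor. -/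
lemma quasiEinstein_coeff (h : IsAdaptedOn G f t₀ δ) (hm : 0 < m) (hu : u ∈ coordBox t₀ δ)
    {a b : ℝ} (hab : ∀ i j, ric G u i j = a * G u i j + b * (pd i f u * pd j f u)) :
    f u * (a - scal G u / m) = warpRate G f u * pd 0 f u := by
  have hm' : (m : ℝ) ≠ 0 := by exact_mod_cast hm.ne'
  have h1 := h.static.hess_eq u hu 0 0
  rw [h.hess_zero_zero hu, hab, h.metric_zero u hu] at h1
  have h2 := scal_eq_of_quasiEinstein h.static.metric hu hab
  rw [h.sum_pd_mul_grad hu] at h2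
  push_cast at h1 h2
  rw [add_sub_cancel_right] at h1
  have h3 := h.pd_zero u hu
  rw [warpRate, h1]
  field_simp
  linear_combination (-(m : ℝ) * f u) * h2

lemma pd_zero_metric (h : IsAdaptedOn G f t₀ δ) (hm : 0 < m) (hu : u ∈ coordBox t₀ δ)
    (hQ : IsRicciQuasiEinsteinAt G f u) (a b : Fin m) :
    pd 0 (fun v => G v a.succ b.succ) u = 2 * warpRate G f u * G u a.succ b.succ := by
  obtain ⟨x, y, hxy⟩ := hQ
  have h1 := h.static.hess_eq u hu a.succ b.succ
  rw [h.hess_succ_succ hu, hxy, h.pd_succ u hu] at h1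
  have h2 := h.quasiEinstein_coeff hm hu hxy
  push_cast at h1
  rw [add_sub_cancel_right] at h1
  refine mul_right_cancel₀ (h.pd_zero u hu) ?_
  linear_combination 2 * h1 + 2 * G u a.succ b.succ * h2

lemma christoffel_succ_zero (h : IsAdaptedOn G f t₀ δ) (hm : 0 < m) (hu : u ∈ coordBox t₀ δ)
    (hQ : IsRicciQuasiEinsteinAt G f u) (c b : Fin m) :
    christoffel G c.succ 0 b.succ u = if c = b then warpRate G f u else 0 := by
  have h1 := congrFun (congrFun (h.static.metric.inv_mul hu) c.succ) b.succ
  rw [Matrix.mul_apply, Fin.sum_univ_succ, h.inv_succ_zero hu, zero_mul, zero_add,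
    Matrix.one_apply] at h1
  rw [christoffel, Fin.sum_univ_succ, h.inv_succ_zero hu, zero_mul, zero_add]
  have e : ∀ l : Fin m, (G u)⁻¹ c.succ l.succ * (pd 0 (fun v => G v b.succ l.succ) u +
      pd b.succ (fun v => G v 0 l.succ) u - pd l.succ (fun v => G v 0 b.succ) u) =
      2 * warpRate G f u * ((G u)⁻¹ c.succ l.succ * G u l.succ b.succ) := by
    intro l
    rw [(h.pd_metric_zero hu _ _).2, (h.pd_metric_zero hu _ _).2, h.pd_zero_metric hm hu hQ,
      h.static.metric.symm hu b.succ]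
    ring
  simp only [e, ← Finset.mul_sum, h1, Fin.succ_inj]
  split_ifs <;> ring

lemma christoffel_zero_succ (h : IsAdaptedOn G f t₀ δ) (hm : 0 < m) (hu : u ∈ coordBox t₀ δ)
    (hQ : IsRicciQuasiEinsteinAt G f u) (a b : Fin m) :
    christoffel G 0 a.succ b.succ u = -(warpRate G f u * G u a.succ b.succ) := by
  rw [h.christoffel_zero hu, h.pd_zero_metric hm hu hQ]
  ring

end IsAdaptedOn

/-- The metric induced on the slice `u 0 = t`. -/
def sliceMetric (G : MetricCoeff (m + 1)) (t : ℝ) : MetricCoeff m :=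
  fun y => (G (consCoord t y)).submatrix Fin.succ Fin.succ

namespace IsAdaptedOn

variable {t : ℝ} {y : Coord m}

lemma isMetricOn_slice (h : IsAdaptedOn G f t₀ δ) (ht : t ∈ Set.Ioo (t₀ - δ) (t₀ + δ)) :
    IsMetricOn (sliceMetric G t) (Metric.ball 0 δ) := by
  refine ⟨fun i j => ?_, fun y hy => ?_⟩
  · exact (h.static.metric.1 i.succ j.succ).comp
      (contDiff_consCoord.comp (contDiff_const.prodMk contDiff_id)).contDiffOn
      fun y hy => ⟨ht, hy⟩
  · have hp := h.static.metric.2 (consCoord t y) (consCoord_mem_coordBox.2 ⟨ht, hy⟩)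
    exact hp.submatrix (Fin.succ_injective m)

lemma inv_slice (h : IsAdaptedOn G f t₀ δ) (hy : consCoord t y ∈ coordBox t₀ δ) :
    (sliceMetric G t y)⁻¹ = ((G (consCoord t y))⁻¹).submatrix Fin.succ Fin.succ := by
  refine Matrix.inv_eq_right_inv ?_
  ext a b
  have h1 := congrFun (congrFun (h.static.metric.mul_inv hy) a.succ) b.succ
  rw [Matrix.mul_apply, Fin.sum_univ_succ, h.inv_zero_succ hy, mul_zero, zero_add] at h1
  simpa [Matrix.mul_apply, sliceMetric, Matrix.one_apply] using h1

lemma christoffel_slice (h : IsAdaptedOn G f t₀ δ) (hy : consCoord t y ∈ coordBox t₀ δ)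
    (c a b : Fin m) :
    christoffel (sliceMetric G t) c a b y =
      christoffel G c.succ a.succ b.succ (consCoord t y) := by
  have hd := fun i j => ContDiffOn.dAt h.static.isOpen (h.static.metric.1 i j) hy
  rw [christoffel, christoffel, Fin.sum_univ_succ, h.inv_succ_zero hy, zero_mul, zero_add,
    h.inv_slice hy]
  have e : ∀ k i j : Fin m, pd k (fun y => sliceMetric G t y i j) y =
      pd k.succ (fun v => G v i.succ j.succ) (consCoord t y) :=
    fun k i j => pd_comp_consCoord (hd _ _) k
  simp only [e, Matrix.submatrix_apply]

/-- The Gauss equation for the slices, traced: the Ricci tensor of a slice differs from that of the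
ambient metric by a multiple of the metric. -/
lemma ric_slice (h : IsAdaptedOn G f t₀ δ) (hm : 0 < m) (hy : consCoord t y ∈ coordBox t₀ δ)
    (hQ : ∀ u ∈ (coordBox t₀ δ : Set (Coord (m + 1))), IsRicciQuasiEinsteinAt G f u)
    (a b : Fin m) :
    ric (sliceMetric G t) y a b = ric G (consCoord t y) a.succ b.succ +
      (pd 0 (warpRate G f) (consCoord t y) + m * warpRate G f (consCoord t y) ^ 2) *
        G (consCoord t y) a.succ b.succ := by
  have hV := h.static.isOpen
  have hG := h.static.metric
  have hyb := consCoord_mem_coordBox.1 hy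
  have hΓd := fun i j k => ContDiffOn.dAt hV (christoffel_smooth hV hG i j k) hy
  set u := consCoord t y with hu
  have hρd := ContDiffOn.dAt hV (h.warpRate_smooth hm) hy
  have cs := christoffel_symm hV hG hy
  have c0 := fun j => (h.christoffel_zero_zero hy j).1
  have c0' := fun j => (h.christoffel_zero_zero hy j).2
  have c1 := h.christoffel_succ_zero hm hy (hQ u hy)
  have c1' : ∀ c b : Fin m, christoffel G c.succ b.succ 0 u =
      if c = b then warpRate G f u else 0 := fun c b => by rw [cs, c1]
  have c2 := h.christoffel_zero_succ hm hy (hQ u hy)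
  have e0 : curvOp G 0 a.succ 0 b.succ u =
      -((pd 0 (warpRate G f) u + warpRate G f u ^ 2) * G u a.succ b.succ) := by
    rw [curvOp, pd_congr_on hV hy (F' := fun v => (-1) * (warpRate G f v * G v b.succ a.succ))
      (fun v hv => by rw [h.christoffel_zero_succ hm hv (hQ v hv)]; ring),
      pd_congr_on hV hy (F := christoffel G 0 0 a.succ) (F' := fun _ => 0)
      (fun v hv => (h.christoffel_zero_zero hv _).1), pd_const,
      pd_const_mul (hρd.fun_mul (ContDiffOn.dAt hV (hG.1 _ _) hy)),
      pd_mul hρd (ContDiffOn.dAt hV (hG.1 _ _) hy), h.pd_zero_metric hm hy (hQ u hy),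
      Fin.sum_univ_succ]
    simp only [c0, c0', c1, c2, zero_mul, mul_zero, sub_zero, zero_sub, zero_add, mul_ite,
      Finset.sum_neg_distrib, Finset.sum_ite_eq', Finset.mem_univ, if_true]
    rw [hG.symm hy b.succ]
    ring
  have hsl : ∀ k i j l : Fin m, pd k (christoffel (sliceMetric G t) i j l) y =
      pd k.succ (christoffel G i.succ j.succ l.succ) u := by
    intro k i j l
    rw [← pd_comp_consCoord (hΓd _ _ _)]
    refine pd_congr_on Metric.isOpen_ball hyb.2 (fun z hz => ?_) k
    exact h.christoffel_slice (consCoord_mem_coordBox.2 ⟨hyb.1, hz⟩) i j l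
  have ec : ∀ c : Fin m, curvOp G c.succ a.succ c.succ b.succ u =
      curvOp (sliceMetric G t) c a c b y +
      ((if c = b then warpRate G f u ^ 2 * G u a.succ c.succ else 0) -
        warpRate G f u ^ 2 * G u a.succ b.succ) := by
    intro c
    rw [curvOp, curvOp, Fin.sum_univ_succ]
    simp only [hsl, h.christoffel_slice hy, ← hu, c1', c2, if_true]
    rw [hG.symm hy b.succ, hG.symm hy c.succ]
    split_ifs <;> ring
  have h1 := ric_eq_sum_curvOp hV hG hy a.succ b.succ
  have h2 := ric_eq_sum_curvOp Metric.isOpen_ball (h.isMetricOn_slice (t := t) hyb.1) hyb.2 a b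
  rw [Fin.sum_univ_succ, e0] at h1
  simp only [ec, Finset.sum_add_distrib, Finset.sum_sub_distrib, Finset.sum_ite_eq',
    Finset.mem_univ, if_true, Finset.sum_const, Finset.card_univ, Fintype.card_fin,
    nsmul_eq_mul] at h1
  rw [← h2] at h1
  rw [h1]
  ring

/-- In adapted coordinates a quasi-Einstein static metric is a warped product with Einstein
fibre. -/
lemma exists_warpedProduct (h : IsAdaptedOn G f t₀ δ) (hm : 0 < m)
    (hQ : ∀ u ∈ (coordBox t₀ δ : Set (Coord (m + 1))), IsRicciQuasiEinsteinAt G f u) :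
    ∃ (w : ℝ → ℝ) (γ : MetricCoeff m), ContDiffOn ℝ ∞ w (Set.Ioo (t₀ - δ) (t₀ + δ)) ∧
      (∀ s ∈ Set.Ioo (t₀ - δ) (t₀ + δ), 0 < w s) ∧ IsMetricOn γ (Metric.ball 0 δ) ∧
      IsEinsteinOn γ (Metric.ball 0 δ) ∧ ∀ u ∈ (coordBox t₀ δ : Set (Coord (m + 1))),
        ∀ i j : Fin m, G u i.succ j.succ = w (u 0) ^ 2 * γ (dropFirst u) i j := by
  obtain ⟨hV, hG, hf, hst, -⟩ := id h.static
  have hδ := h.pos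
  have h0 : ∀ {t : ℝ}, t ∈ Set.Ioo (t₀ - δ) (t₀ + δ) →
      consCoord t (0 : Coord m) ∈ (coordBox t₀ δ : Set (Coord (m + 1))) :=
    fun ht => consCoord_zero_mem_coordBox hδ ht
  -- The Einstein constant is computed on a slice on which the potential does not vanish.
  obtain ⟨t₁, ht₁, hft⟩ : ∃ t₁ ∈ Set.Ioo (t₀ - δ) (t₀ + δ), f (consCoord t₁ (0 : Coord m)) ≠ 0 := by
    by_contra! hc
    have ht : t₀ ∈ Set.Ioo (t₀ - δ) (t₀ + δ) := ⟨by linarith, by linarith⟩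
    have hd := hasDerivAt_comp_consCoord (ContDiffOn.dAt hV hf (h0 ht))
    refine h.pd_zero _ (h0 ht) (hd.unique ((hasDerivAt_const t₀ (0 : ℝ)).congr_of_eventuallyEq ?_))
    filter_upwards [isOpen_Ioo.mem_nhds ht] with t ht using hc t ht
  have hρ := h.warpRate_smooth hm
  obtain ⟨S, hS, hS0, hSd⟩ := exists_smooth_antideriv (contDiffOn_comp_consCoord hδ hρ) ht₁
  refine ⟨fun t => Real.exp (S t), sliceMetric G t₁, hS.exp, fun s _ => Real.exp_pos _,
    h.isMetricOn_slice ht₁, ?_, ?_⟩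
  · refine ⟨warpRate G f (consCoord t₁ 0) * pd 0 f (consCoord t₁ 0) / f (consCoord t₁ 0) +
      scal G (consCoord t₁ 0) / m + (pd 0 (warpRate G f) (consCoord t₁ 0) +
        m * warpRate G f (consCoord t₁ 0) ^ 2), fun y hy a b => ?_⟩
    have hy1 : consCoord t₁ y ∈ (coordBox t₀ δ : Set (Coord (m + 1))) := ⟨ht₁, hy⟩
    obtain ⟨x, z, hxz⟩ := hQ _ hy1
    have e1 := h.quasiEinstein_coeff hm hy1 hxz
    have e2 : consCoord t₁ y 0 = consCoord t₁ (0 : Coord m) 0 := by simp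
    rw [h.ric_slice hm hy1 hQ, hxz, h.pd_succ _ hy1]
    rw [h.warpRate_eq _ hy1 _ (h0 ht₁) e2, h.potential_eq _ hy1 _ (h0 ht₁) e2,
      h.scal_eq _ hy1 _ (h0 ht₁) e2, h.pd_potential_eq _ hy1 _ (h0 ht₁) e2] at e1
    rw [h.warpRate_eq _ hy1 _ (h0 ht₁) e2, pd_zero_eq_of_zero_eq
      (fun w hw => ContDiffOn.dAt hV hρ hw) h.warpRate_eq _ hy1 _ (h0 ht₁) e2]
    rw [← e1, mul_div_cancel_left₀ _ hft]
    simp only [sliceMetric, Matrix.submatrix_apply]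
    ring
  · intro u hu i j
    have hm1 : ∀ t ∈ Set.Ioo (t₀ - δ) (t₀ + δ),
        consCoord t (dropFirst u) ∈ (coordBox t₀ δ : Set (Coord (m + 1))) := fun t ht => ⟨ht, hu.2⟩
    -- `exp (-2 S) g_ij` is constant along the lines in the first coordinate direction.
    have hd : ∀ t ∈ Set.Ioo (t₀ - δ) (t₀ + δ), HasDerivAt (fun t => Real.exp (-(2 * S t)) *
        G (consCoord t (dropFirst u)) i.succ j.succ) 0 t := by
      intro t ht
      have d1 := hasDerivAt_comp_consCoord (ContDiffOn.dAt hV (hG.1 i.succ j.succ) (hm1 t ht))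
      have d2 := (((hSd t ht).const_mul 2).neg.exp).mul d1
      refine d2.congr_deriv ?_
      rw [h.pd_zero_metric hm (hm1 t ht) (hQ _ (hm1 t ht)),
        h.warpRate_eq _ (hm1 t ht) _ (h0 ht) (by simp)]
      ring
    have hc := (convex_Ioo (t₀ - δ) (t₀ + δ)).is_const_of_fderivWithin_eq_zero (𝕜 := ℝ)
      (fun t ht => (hd t ht).differentiableAt.differentiableWithinAt) (fun t ht => by
        rw [fderivWithin_of_isOpen isOpen_Ioo ht, (hd t ht).hasFDerivAt.fderiv]
        ext; simp) hu.1 ht₁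
    simp only [hS0, mul_zero, neg_zero, Real.exp_zero, one_mul, consCoord_dropFirst] at hc
    simp only [sliceMetric, Matrix.submatrix_apply, ← hc]
    rw [← mul_assoc, ← Real.exp_nat_mul, ← Real.exp_add]
    simp

end IsAdaptedOn

end Warped

/-! ### Unique continuation for static potentials, and the Bach tensor -/

section Bach

variable {n : ℕ} {G : MetricCoeff n} {V W : Set (Coord n)} {u : Coord n} {f : Coord n → ℝ}

/-- Along a segment, `(f, df)` solves a linear ordinary differential equation, because the static
equation expresses the second derivatives of `f` through `f` and `df`. Hence a potential that
vanishes to first order at a point vanishes near it. -/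
lemma IsStaticOn.eventually_eq_zero (h : IsStaticOn G f V) (hu : u ∈ V) (h0 : f u = 0)
    (h1 : ∀ k, pd k f u = 0) : ∀ᶠ v in 𝓝 u, f v = 0 := by
  obtain ⟨hV, hG, hf, hst, -⟩ := id h
  obtain ⟨r, hr, hrV⟩ := Metric.isOpen_iff.1 hV u hu
  filter_upwards [Metric.ball_mem_nhds u hr] with v hv
  set c : ℝ → Coord n := fun t => u + t • (v - u) with hc
  have hcV : ∀ t ∈ Set.Icc (0 : ℝ) 1, c t ∈ V := fun t ht =>
    hrV ((convex_ball u r).add_smul_sub_mem (Metric.mem_ball_self hr) hv ht)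
  have hcd : ∀ t, HasDerivAt c (v - u) t := fun t => by
    have h := ((hasDerivAt_id t).smul_const (v - u)).const_add u
    rwa [one_smul] at h
  have hcc : Continuous c := by fun_prop
  have hcomp : ∀ {F : Coord n → ℝ}, ContDiffOn ℝ ∞ F V →
      ContinuousOn (fun t => F (c t)) (Set.Icc 0 1) := fun hF =>
    hF.continuousOn.comp hcc.continuousOn hcV
  have hder : ∀ {F : Coord n → ℝ}, ContDiffOn ℝ ∞ F V → ∀ t ∈ Set.Icc (0 : ℝ) 1,
      HasDerivAt (fun t => F (c t)) (∑ i, pd i F (c t) * (v - u) i) t := fun hF t ht => by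
    rw [← fderiv_eq_sum_pd]
    exact (ContDiffOn.dAt hV hF (hcV t ht)).hasFDerivAt.comp_hasDerivAt t (hcd t)
  have hfd := fun k => ContDiffOn.pd hV hf k
  set S : Fin n → Fin n → Coord n → ℝ := fun i j x =>
    ric G x i j - scal G x / ((n : ℝ) - 1) * G x i j with hS
  have hSs : ∀ i j, ContDiffOn ℝ ∞ (S i j) V := fun i j =>
    (ric_smooth hV hG i j).sub (((scal_smooth hV hG).div_const _).mul (hG.1 i j))
  have hpp : ∀ t ∈ Set.Icc (0 : ℝ) 1, ∀ i k, pd i (pd k f) (c t) =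
      ∑ l, christoffel G l i k (c t) * pd l f (c t) + f (c t) * S i k (c t) := by
    intro t ht i k
    have := hst (c t) (hcV t ht) i k
    rw [hess] at this
    rw [← this]
    ring
  set F : ℝ → ℝ × (Fin n → ℝ) := fun t => (f (c t), fun k => pd k f (c t)) with hF
  set F' : ℝ → ℝ × (Fin n → ℝ) := fun t => (∑ i, pd i f (c t) * (v - u) i,
    fun k => ∑ i, pd i (pd k f) (c t) * (v - u) i) with hF'
  set b : ℝ → ℝ := fun t => ∑ i, |(v - u) i| +
    ∑ k, ∑ i, (∑ l, |christoffel G l i k (c t)| + |S i k (c t)|) * |(v - u) i| with hb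
  have hbc : ContinuousOn b (Set.Icc 0 1) := by
    refine continuousOn_const.add (continuousOn_finsetSum _ fun k _ =>
      continuousOn_finsetSum _ fun i _ => ContinuousOn.mul (ContinuousOn.add
        (continuousOn_finsetSum _ fun l _ => ?_) ?_) continuousOn_const)
    · exact (hcomp (christoffel_smooth hV hG l i k)).abs
    · exact (hcomp (hSs i k)).abs
  obtain ⟨K, hK⟩ := isCompact_Icc.bddAbove_image hbc
  have hbK : ∀ t ∈ Set.Icc (0 : ℝ) 1, b t ≤ K := fun t ht => hK ⟨t, ht, rfl⟩
  have hn1 : ∀ t, |f (c t)| ≤ ‖F t‖ := fun t => norm_fst_le (F t)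
  have hn2 : ∀ t k, |pd k f (c t)| ≤ ‖F t‖ := fun t k =>
    (norm_le_pi_norm (F t).2 k).trans (norm_snd_le (F t))
  have hbd : ∀ t ∈ Set.Ico (0 : ℝ) 1, ‖F' t‖ ≤ K * ‖F t‖ := by
    intro t ht
    have htI := Set.Ico_subset_Icc_self ht
    refine le_trans ?_ (mul_le_mul_of_nonneg_right (hbK t htI) (norm_nonneg _))
    have hN := norm_nonneg (F t)
    have hp1 : 0 ≤ ∑ i, |(v - u) i| := Finset.sum_nonneg fun _ _ => abs_nonneg _
    have hp2 : ∀ k, 0 ≤ ∑ i, (∑ l, |christoffel G l i k (c t)| + |S i k (c t)|) * |(v - u) i| :=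
      fun k => Finset.sum_nonneg fun i _ => mul_nonneg (add_nonneg
        (Finset.sum_nonneg fun _ _ => abs_nonneg _) (abs_nonneg _)) (abs_nonneg _)
    have hp3 := Finset.sum_nonneg fun k (_ : k ∈ Finset.univ) => hp2 k
    refine norm_prod_le_iff.2 ⟨?_, (pi_norm_le_iff_of_nonneg ?_).2 fun k => ?_⟩
    · calc ‖∑ i, pd i f (c t) * (v - u) i‖ ≤ ∑ i, ‖F t‖ * |(v - u) i| := by
            refine norm_sum_le_of_le _ fun i _ => ?_
            rw [norm_mul]
            exact mul_le_mul_of_nonneg_right (hn2 t i) (abs_nonneg _)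
        _ = (∑ i, |(v - u) i|) * ‖F t‖ := by rw [← Finset.mul_sum, mul_comm]
        _ ≤ b t * ‖F t‖ := mul_le_mul_of_nonneg_right (le_add_of_nonneg_right hp3) hN
    · exact mul_nonneg (add_nonneg hp1 hp3) hN
    · calc ‖∑ i, pd i (pd k f) (c t) * (v - u) i‖
          ≤ ∑ i, ((∑ l, |christoffel G l i k (c t)| + |S i k (c t)|) * |(v - u) i|) * ‖F t‖ := by
            refine norm_sum_le_of_le _ fun i _ => ?_
            rw [norm_mul, mul_right_comm, hpp t htI]
            refine mul_le_mul_of_nonneg_right ?_ (abs_nonneg _)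
            rw [add_mul, Finset.sum_mul]
            refine (norm_add_le _ _).trans (add_le_add (norm_sum_le_of_le _ fun l _ => ?_) ?_)
            · rw [norm_mul]
              exact mul_le_mul_of_nonneg_left (hn2 t l) (abs_nonneg _)
            · rw [norm_mul, mul_comm]
              exact mul_le_mul_of_nonneg_left (hn1 t) (abs_nonneg _)
        _ ≤ b t * ‖F t‖ := by
            rw [← Finset.sum_mul]
            refine mul_le_mul_of_nonneg_right ?_ hN
            exact (Finset.single_le_sum (fun k _ => hp2 k) (Finset.mem_univ k)).trans
              (le_add_of_nonneg_left hp1)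
  have hFc : ContinuousOn F (Set.Icc 0 1) :=
    (hcomp hf).prodMk (continuousOn_pi.2 fun k => hcomp (hfd k))
  have hFd : ∀ t ∈ Set.Ico (0 : ℝ) 1, HasDerivWithinAt F (F' t) (Set.Ici t) t := by
    intro t ht
    have htI := Set.Ico_subset_Icc_self ht
    exact ((hder hf t htI).prodMk (hasDerivAt_pi.2 fun k => hder (hfd k) t htI)).hasDerivWithinAt
  have hF0 : F 0 = 0 := by
    simp only [hF, hc, zero_smul, add_zero, h0, h1]
    rfl
  have hz := eq_zero_of_abs_deriv_le_mul_abs_self_of_eq_zero_right hFc hFd hF0 hbd 1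
    ⟨zero_le_one, le_rfl⟩
  have := congrArg Prod.fst hz
  simpa [hF, hc] using this

/-- The second term of the Bach tensor, the Weyl tensor contracted with the Ricci tensor. -/
def ricWeyl (G : MetricCoeff n) (u : Coord n) (i j : Fin n) : ℝ :=
  ∑ k, ∑ l, ∑ p, ∑ q, (G u)⁻¹ k p * (G u)⁻¹ l q * ric G u p q * weyl G u ![i, k, j, l]

lemma ricWeyl_smooth (hV : IsOpen V) (hG : IsMetricOn G V) (i j : Fin n) :
    ContDiffOn ℝ ∞ (fun v => ricWeyl G v i j) V :=
  ContDiffOn.sum fun k _ => ContDiffOn.sum fun l _ => ContDiffOn.sum fun p _ =>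
    ContDiffOn.sum fun q _ => (((hG.inv_smooth k p).mul (hG.inv_smooth l q)).mul
      (ric_smooth hV hG p q)).mul (weyl_smooth hV hG _)

/-- The Weyl tensor is trace free, and the `D`-tensor is its contraction with `∇f`. -/
lemma IsStaticOn.ricWeyl_eq_zero_of_quasiEinstein (h : IsStaticOn G f V) (hn : 3 ≤ n) (hu : u ∈ V)
    (hQ : IsRicciQuasiEinsteinAt G f u) (hD : ∀ i j k, dTensor G f u i j k = 0) (i j : Fin n) :
    ricWeyl G u i j = 0 := by
  obtain ⟨a, b, hab⟩ := hQ
  have hG := h.metric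
  have e1 : ∀ k l, ∑ p, ∑ q, (G u)⁻¹ k p * (G u)⁻¹ l q * ric G u p q * weyl G u ![i, k, j, l] =
      a * ((G u)⁻¹ k l * weyl G u ![i, k, j, l]) +
        b * grad G f u k * (weyl G u ![i, k, j, l] * grad G f u l) := by
    intro k l
    have e2 : ∑ p, ∑ q, (G u)⁻¹ k p * (G u)⁻¹ l q * G u p q = (G u)⁻¹ k l := by
      have h1 : (G u)⁻¹ * (G u * (G u)⁻¹) = (G u)⁻¹ := by rw [hG.mul_inv hu, mul_one]
      have h2 := congrFun (congrFun h1 k) l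
      rw [Matrix.mul_apply] at h2
      rw [← h2]
      refine Finset.sum_congr rfl fun p _ => ?_
      rw [Matrix.mul_apply, Finset.mul_sum]
      refine Finset.sum_congr rfl fun q _ => ?_
      rw [hG.inv_symm hu l q]
      ring
    have e3 : ∑ p, ∑ q, (G u)⁻¹ k p * (G u)⁻¹ l q * (pd p f u * pd q f u) =
        grad G f u k * grad G f u l := by
      simp only [grad, Finset.sum_mul_sum]
      exact Finset.sum_congr rfl fun p _ => Finset.sum_congr rfl fun q _ => by ring
    calc _ = (a * ∑ p, ∑ q, (G u)⁻¹ k p * (G u)⁻¹ l q * G u p q +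
          b * ∑ p, ∑ q, (G u)⁻¹ k p * (G u)⁻¹ l q * (pd p f u * pd q f u)) *
            weyl G u ![i, k, j, l] := by
          simp only [Finset.mul_sum, ← Finset.sum_add_distrib, Finset.sum_mul]
          refine Finset.sum_congr rfl fun p _ => Finset.sum_congr rfl fun q _ => ?_
          rw [hab]
          ring
      _ = _ := by rw [e2, e3]; ring
  simp only [ricWeyl, e1, Finset.sum_add_distrib, ← Finset.mul_sum, h.weyl_grad hn hu, hD,
    mul_zero, add_zero, trace_weyl_eq_zero hG hu hn]

/-- If `df = 0` near a point where `f ≠ 0`, the static equation makes the metric Ricci flat. -/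
lemma IsStaticOn.ric_eq_zero (h : IsStaticOn G f V) (hu : u ∈ V) (hfu : f u ≠ 0)
    (hd : ∀ᶠ v in 𝓝 u, ∀ k, pd k f v = 0) (hn : 3 ≤ n) (i j : Fin n) : ric G u i j = 0 := by
  have hn' : (3 : ℝ) ≤ n := by exact_mod_cast hn
  have hn1 : (n : ℝ) - 1 ≠ 0 := by linarith
  have h1 : ∀ i j, ric G u i j = scal G u / ((n : ℝ) - 1) * G u i j := by
    intro i j
    have h2 := h.hess_eq u hu i j
    have h3 : hess G f u i j = 0 := by
      rw [hess, pd_congr (F' := fun _ => 0) (hd.mono fun v hv => hv j), pd_const]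
      simp [hd.self_of_nhds]
    rw [h3] at h2
    have := (mul_eq_zero.1 h2.symm).resolve_left hfu
    linarith
  have h4 := scal_eq_of_quasiEinstein (f := f) (a := scal G u / ((n : ℝ) - 1)) (b := 0) h.metric hu
    (fun i j => by rw [h1 i j]; ring)
  have h5 : scal G u = 0 := by
    field_simp at h4
    linarith
  rw [h1, h5, zero_div, zero_mul]

/-- Where the `D`-tensor vanishes, so does the Bach tensor: its second term vanishes where
`∇f ≠ 0`, hence on the closure of this set, and the metric is Ricci flat on the complement. -/
lemma IsStaticOn.bach_eq_zero (h : IsStaticOn G f V) (hn : 3 ≤ n) (hW : IsOpen W) (hWV : W ⊆ V)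
    (hD : ∀ v ∈ W, ∀ i j k, dTensor G f v i j k = 0) (hu : u ∈ W)
    (hne : f u = 0 → ∃ k, pd k f u ≠ 0) (i j : Fin n) : bach G u i j = 0 := by
  have hV := h.isOpen
  have hG := h.metric
  have huV := hWV hu
  have hR : ricWeyl G u i j = 0 := by
    by_cases hd : ∀ᶠ v in 𝓝 u, ∀ k, pd k f v = 0
    · have hfu : f u ≠ 0 := fun h0 => by
        obtain ⟨k, hk⟩ := hne h0
        exact hk (hd.self_of_nhds k)
      simp [ricWeyl, h.ric_eq_zero huV hfu hd hn]
    · by_contra hc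
      have hev := ((ricWeyl_smooth hV hG i j).continuousOn.continuousAt
        (hV.mem_nhds huV)).eventually_ne hc
      refine hd ?_
      filter_upwards [hev, hW.mem_nhds hu] with v hv hvW k
      by_contra hk
      exact hv (h.ricWeyl_eq_zero_of_quasiEinstein hn (hWV hvW)
        (h.isRicciQuasiEinsteinAt_of_dTensor hn (hWV hvW) hk (hD v hvW)) (hD v hvW) i j)
  change _ + 1 / ((n : ℝ) - 2) * ricWeyl G u i j = 0
  rw [hR, divdiv_weyl_eq_zero hV hG huV h.div_eq]
  ring

end Bach

/-! ### Charts of the manifold -/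

section Charts

variable {n : ℕ} {M : Type*} [TopologicalSpace M] [ChartedSpace (Coord n) M]
  {f : M → ℝ} {φ : OpenPartialHomeomorph M (Coord n)} {u : Coord n}

lemma mdifferentiableAt_symm (hφ : φ ∈ IsManifold.maximalAtlas (𝓡 n) ∞ M) (hu : u ∈ φ.target) :
    MDifferentiableAt (𝓡 n) (𝓡 n) φ.symm u :=
  (contMDiffAt_symm_of_mem_maximalAtlas hφ hu).mdifferentiableAt (by simp)

lemma inChart_smooth (hφ : φ ∈ IsManifold.maximalAtlas (𝓡 n) ∞ M)
    (hf : ContMDiff (𝓡 n) 𝓘(ℝ, ℝ) ∞ f) : ContDiffOn ℝ ∞ (inChart f φ) φ.target := by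
  rw [← contMDiffOn_iff_contDiffOn]
  exact hf.comp_contMDiffOn (contMDiffOn_symm_of_mem_maximalAtlas hφ)

/-- Coordinate vectors are linearly independent. -/
lemma mfderiv_symm_injective (hφ : φ ∈ IsManifold.maximalAtlas (𝓡 n) ∞ M) (hu : u ∈ φ.target) :
    Function.Injective (mfderiv (𝓡 n) (𝓡 n) φ.symm u) := by
  have hd := (contMDiffAt_of_mem_maximalAtlas hφ (φ.map_target hu)).mdifferentiableAt
    (n := ∞) (by simp)
  have h := mfderiv_comp u hd (mdifferentiableAt_symm hφ hu)
  have h2 : (φ ∘ φ.symm) =ᶠ[𝓝 u] id :=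
    Filter.eventually_of_mem (φ.open_target.mem_nhds hu) fun v hv => φ.right_inv hv
  rw [h2.mfderiv_eq, mfderiv_id] at h
  intro a b hab
  have ha := congrArg (fun L => L a) h
  have hb := congrArg (fun L => L b) h
  simp only [ContinuousLinearMap.comp_apply] at ha hb
  rw [hab, ← hb] at ha
  exact ha

lemma fderiv_inChart (hφ : φ ∈ IsManifold.maximalAtlas (𝓡 n) ∞ M)
    (hf : ContMDiff (𝓡 n) 𝓘(ℝ, ℝ) ∞ f) (hu : u ∈ φ.target) (x : Coord n) :
    fderiv ℝ (inChart f φ) u x =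
      mfderiv (𝓡 n) 𝓘(ℝ, ℝ) f (φ.symm u) (mfderiv (𝓡 n) (𝓡 n) φ.symm u x) := by
  have h := mfderiv_comp u ((hf (φ.symm u)).mdifferentiableAt (by simp))
    (mdifferentiableAt_symm hφ hu)
  rw [← mfderiv_eq_fderiv]
  exact congrArg (fun L => L x) h

lemma mfderiv_symm_surjective (hφ : φ ∈ IsManifold.maximalAtlas (𝓡 n) ∞ M) (hu : u ∈ φ.target) :
    Function.Surjective (mfderiv (𝓡 n) (𝓡 n) φ.symm u) := by
  let L : Coord n →L[ℝ] Coord n := mfderiv (𝓡 n) (𝓡 n) φ.symm u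
  have h : Function.Injective L.toLinearMap := mfderiv_symm_injective hφ hu
  exact (LinearMap.injective_iff_surjective (V := Coord n) (f := L.toLinearMap)).1 h

lemma mfderiv_ne_zero_iff (hφ : φ ∈ IsManifold.maximalAtlas (𝓡 n) ∞ M)
    (hf : ContMDiff (𝓡 n) 𝓘(ℝ, ℝ) ∞ f) (hu : u ∈ φ.target) :
    mfderiv (𝓡 n) 𝓘(ℝ, ℝ) f (φ.symm u) ≠ 0 ↔ ∃ k, pd k (inChart f φ) u ≠ 0 := by
  rw [← not_iff_not]
  push Not
  constructor
  · intro h k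
    rw [pd, fderiv_inChart hφ hf hu, h]
    rfl
  · intro h
    have h0 : fderiv ℝ (inChart f φ) u = 0 := eq_zero_of_pd_eq_zero h
    ext y
    obtain ⟨x, rfl⟩ := mfderiv_symm_surjective hφ hu y
    exact (fderiv_inChart hφ hf hu x).symm.trans (by rw [h0]; rfl)

variable [IsManifold (𝓡 n) ∞ M] {g : Metric n M}

/-- Coordinate vector fields are smooth sections of the tangent bundle along the inverse chart. -/
lemma contMDiffOn_coordVector (hφ : φ ∈ IsManifold.maximalAtlas (𝓡 n) ∞ M) (i : Fin n) :
    ContMDiffOn (𝓡 n) (𝓡 n).tangent ∞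
      (fun u => (⟨φ.symm u, coordVector φ u i⟩ : TangentBundle (𝓡 n) M)) φ.target := by
  have h1 := (contMDiffOn_symm_of_mem_maximalAtlas hφ).contMDiffOn_tangentMapWithin
    (m := ∞) (by simp) φ.open_target.uniqueMDiffOn
  have h2 : ContMDiffOn (𝓡 n) (𝓡 n).tangent ∞ (fun u : Coord n =>
      (⟨u, EuclideanSpace.single i (1 : ℝ)⟩ : TangentBundle (𝓡 n) (Coord n))) φ.target :=
    (contMDiff_vectorSpace_iff_contDiff.2 contDiff_const).contMDiffOn
  refine (h1.comp h2 fun u hu => hu).congr fun u hu => ?_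
  simp only [Function.comp, tangentMapWithin, coordVector]
  rw [mfderivWithin_of_isOpen φ.open_target hu]

lemma coeff_smooth (hφ : φ ∈ IsManifold.maximalAtlas (𝓡 n) ∞ M) (i j : Fin n) :
    ContDiffOn ℝ ∞ (fun u => coeff g φ u i j) φ.target := by
  rw [← contMDiffOn_iff_contDiffOn]
  intro u hu
  have hb : ContMDiffWithinAt (𝓡 n) (𝓡 n) ∞ φ.symm φ.target u :=
    contMDiffOn_symm_of_mem_maximalAtlas hφ u hu
  have h : ContMDiffWithinAt (𝓡 n) ((𝓡 n).prod 𝓘(ℝ)) ∞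
      (fun u => Bundle.TotalSpace.mk' ℝ (E := Bundle.Trivial M ℝ) (φ.symm u)
        (g.inner (φ.symm u) (coordVector φ u i) (coordVector φ u j))) φ.target u := by
    apply ContMDiffWithinAt.clm_bundle_apply₂ (F₁ := Coord n) (F₂ := Coord n)
    · exact ContMDiffAt.comp_contMDiffWithinAt u g.contMDiff.contMDiffAt hb
    · exact contMDiffOn_coordVector hφ i u hu
    · exact contMDiffOn_coordVector hφ j u hu
  rw [Bundle.contMDiffWithinAt_totalSpace] at h
  exact h.2

lemma sum_coeff (v w : Fin n → ℝ) :
    ∑ i, ∑ j, coeff g φ u i j * (v i * w j) = g.inner (φ.symm u)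
      (mfderiv (𝓡 n) (𝓡 n) φ.symm u (WithLp.toLp 2 v : Coord n))
      (mfderiv (𝓡 n) (𝓡 n) φ.symm u (WithLp.toLp 2 w : Coord n)) := by
  have e : ∀ v : Fin n → ℝ, mfderiv (𝓡 n) (𝓡 n) φ.symm u (WithLp.toLp 2 v : Coord n) =
      ∑ i, v i • coordVector φ u i := by
    intro v
    have : (WithLp.toLp 2 v : Coord n) = ∑ i, v i • EuclideanSpace.single i (1 : ℝ) := by
      conv_lhs => rw [← (EuclideanSpace.basisFun (Fin n) ℝ).sum_repr (WithLp.toLp 2 v)]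
      simp
    rw [this]
    refine (map_sum (mfderiv (𝓡 n) (𝓡 n) φ.symm u) _ _).trans ?_
    exact Finset.sum_congr rfl fun i _ => map_smul (mfderiv (𝓡 n) (𝓡 n) φ.symm u) (v i) _
  rw [e, e]
  simp only [map_sum, map_smul, sum_apply, smul_apply, smul_eq_mul,
    Finset.mul_sum]
  rw [Finset.sum_comm]
  refine Finset.sum_congr rfl fun i _ => Finset.sum_congr rfl fun j _ => ?_
  simp only [coeff, Matrix.of_apply]
  ring

lemma isMetricOn_coeff (hφ : φ ∈ IsManifold.maximalAtlas (𝓡 n) ∞ M) :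
    IsMetricOn (coeff g φ) φ.target := by
  refine ⟨coeff_smooth hφ, fun u hu => Matrix.PosDef.of_dotProduct_mulVec_pos ?_ fun x hx => ?_⟩
  · ext i j
    simp [coeff, g.symm (φ.symm u) (coordVector φ u i)]
  · have h : star x ⬝ᵥ (coeff g φ u).mulVec x = ∑ i, ∑ j, coeff g φ u i j * (x i * x j) := by
      simp only [dotProduct, Matrix.mulVec, Finset.mul_sum, star_trivial]
      exact Finset.sum_congr rfl fun i _ => Finset.sum_congr rfl fun j _ => by ring
    rw [h, sum_coeff]
    refine g.pos _ _ fun h0 => hx ?_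
    have h1 := mfderiv_symm_injective hφ hu (h0.trans (map_zero _).symm)
    exact congrArg WithLp.ofLp h1

lemma isStaticOn_chart (hst : IsVacuumStatic g f) (hh : HasHarmonicCurvature g)
    (hφ : φ ∈ IsManifold.maximalAtlas (𝓡 n) ∞ M) :
    IsStaticOn (coeff g φ) (inChart f φ) φ.target :=
  ⟨φ.open_target, isMetricOn_coeff hφ, inChart_smooth hφ hst.1, hst.2.2 φ hφ, hh φ hφ⟩

/-- Composition of a chart with a diffeomorphism between open sets of coordinate space. -/
lemma trans_symm_mem_maximalAtlas (hφ : φ ∈ IsManifold.maximalAtlas (𝓡 n) ∞ M)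
    {e : OpenPartialHomeomorph (Coord n) (Coord n)} (he : ContDiffOn ℝ ∞ e e.source)
    (he' : ContDiffOn ℝ ∞ e.symm e.target) :
    φ.trans e.symm ∈ IsManifold.maximalAtlas (𝓡 n) ∞ M := by
  refine OpenPartialHomeomorph.mem_maximalAtlas_of_contMDiffOn _ ?_ ?_
  · exact he'.contMDiffOn.comp ((contMDiffOn_of_mem_maximalAtlas hφ).mono fun x hx => hx.1)
      fun x hx => hx.2
  · exact (contMDiffOn_symm_of_mem_maximalAtlas hφ).comp
      (he.contMDiffOn.mono fun x hx => hx.1) fun x hx => hx.2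

lemma coeff_trans_symm (hφ : φ ∈ IsManifold.maximalAtlas (𝓡 n) ∞ M)
    {e : OpenPartialHomeomorph (Coord n) (Coord n)} (h : e.target ⊆ φ.target)
    (he : ContDiffOn ℝ ∞ e e.source) (hu : u ∈ e.source) (i j : Fin n) :
    coeff g (φ.trans e.symm) u i j = pullCoeff e (coeff g φ) u i j := by
  have hd : MDifferentiableAt (𝓡 n) (𝓡 n) e u :=
    ((he.contDiffAt (e.open_source.mem_nhds hu)).differentiableAt (by simp)).mdifferentiableAt
  have hc := mfderiv_comp u (mdifferentiableAt_symm hφ (h (e.map_source hu))) hd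
  have hv : ∀ i, coordVector (φ.trans e.symm) u i =
      mfderiv (𝓡 n) (𝓡 n) φ.symm (e u) (fderiv ℝ e u (EuclideanSpace.single i 1)) := by
    intro i
    rw [← mfderiv_eq_fderiv]
    exact congrArg (fun L => L (EuclideanSpace.single i (1 : ℝ) : Coord n)) hc
  have h1 := sum_coeff (g := g) (φ := φ) (u := e u)
    (fderiv ℝ e u (EuclideanSpace.single i 1)) (fderiv ℝ e u (EuclideanSpace.single j 1))
  refine Eq.trans ?_ (h1.symm.trans ?_)
  · change g.inner (φ.symm (e u)) (coordVector (φ.trans e.symm) u i)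
      (coordVector (φ.trans e.symm) u j) = _
    rw [hv, hv]
  · exact Finset.sum_congr rfl fun a _ => Finset.sum_congr rfl fun b _ => mul_comm _ _

/-- Unique continuation: the potential of a connected vacuum static space does not vanish to first
order at any point. -/
lemma IsVacuumStatic.mfderiv_ne_zero [ConnectedSpace M] (hst : IsVacuumStatic g f)
    (hh : HasHarmonicCurvature g) {x : M} (hx : f x = 0) : mfderiv (𝓡 n) 𝓘(ℝ, ℝ) f x ≠ 0 := by
  have hf := hst.1
  set Z : Set M := {x | f x = 0 ∧ mfderiv (𝓡 n) 𝓘(ℝ, ℝ) f x = 0} with hZ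
  have hat := fun y : M => IsManifold.chart_mem_maximalAtlas (I := 𝓡 n) (n := ∞) y
  have hmem := fun y : M => mem_chart_target (Coord n) y
  have hinv := fun y : M => (chartAt (Coord n) y).left_inv (mem_chart_source (Coord n) y)
  have hev : ∀ (y : M) {P : Coord n → Prop}, (∀ᶠ v in 𝓝 (chartAt (Coord n) y y), P v) →
      ∀ᶠ z in 𝓝 y, z ∈ (chartAt (Coord n) y).source ∧ P (chartAt (Coord n) y z) := fun y P hP =>
    Filter.Eventually.and (chart_source_mem_nhds (Coord n) y)
      (((chartAt (Coord n) y).continuousAt (mem_chart_source _ y)).eventually hP)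
  have hopen : IsOpen Z := by
    refine isOpen_iff_mem_nhds.2 fun y hy => ?_
    have h1 := (isStaticOn_chart hst hh (hat y)).eventually_eq_zero (hmem y)
      (by rw [inChart, hinv, hy.1]) (by
        have := (mfderiv_ne_zero_iff (hat y) hf (hmem y)).not.1
        rw [hinv] at this
        simpa using this (not_not.2 hy.2))
    have h2 : ∀ᶠ z in 𝓝 y, f z = 0 := (hev y h1).mono fun z hz => by
      have := hz.2
      rwa [inChart, (chartAt (Coord n) y).left_inv hz.1] at this
    filter_upwards [h2.eventually_nhds] with z hz
    refine ⟨hz.self_of_nhds, ?_⟩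
    have h3 : f =ᶠ[𝓝 z] fun _ => (0 : ℝ) := hz
    rw [h3.mfderiv_eq, mfderiv_const]
    rfl
  have hclosed : IsOpen Zᶜ := by
    refine isOpen_iff_mem_nhds.2 fun y hy => ?_
    by_cases h0 : f y = 0
    · have h1 : mfderiv (𝓡 n) 𝓘(ℝ, ℝ) f y ≠ 0 := fun h => hy ⟨h0, h⟩
      rw [← hinv y] at h1
      obtain ⟨k, hk⟩ := (mfderiv_ne_zero_iff (hat y) hf (hmem y)).1 h1
      have h2 := ((ContDiffOn.pd (chartAt (Coord n) y).open_target
        (inChart_smooth (hat y) hf) k).continuousOn.continuousAt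
          ((chartAt (Coord n) y).open_target.mem_nhds (hmem y))).eventually_ne hk
      filter_upwards [hev y h2] with z hz hzZ
      refine (mfderiv_ne_zero_iff (hat y) hf ((chartAt (Coord n) y).map_source hz.1)).2
        ⟨k, hz.2⟩ ?_
      rw [(chartAt (Coord n) y).left_inv hz.1]
      exact hzZ.2
    · filter_upwards [hf.continuous.continuousAt.eventually_ne h0] with z hz hzZ using hz hzZ.1
  intro hd
  obtain ⟨y, hy⟩ := hst.2.1
  have hc : IsClopen Z := ⟨⟨hclosed⟩, hopen⟩
  have : y ∈ Z := by
    rw [hc.eq_univ ⟨x, hx, hd⟩]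
    trivial
  exact hy this.1

/-- In a chart, the points over `U` form an open set to which the local statement applies. -/
lemma isDFlatOn (hst : IsVacuumStatic g f) (hh : HasHarmonicCurvature g) (hn : 3 ≤ n) {U : Set M}
    (hU : IsOpen U) (heq : RicciEigenvaluesEqualOn g f U) : IsDFlatOn g f U := by
  intro φ hφ u hu huU
  refine (isStaticOn_chart hst hh hφ).dTensor_eq_zero hn
    (φ.symm.isOpen_inter_preimage hU) (W := φ.target ∩ φ.symm ⁻¹' U) Set.inter_subset_left ?_
    ⟨hu, huU⟩
  intro v hv hk hreg
  exact heq φ hφ v hv.1 hv.2 ((mfderiv_ne_zero_iff hφ hst.1 hv.1).2 hk) hreg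

lemma isBachFlatOn [ConnectedSpace M] (hst : IsVacuumStatic g f) (hh : HasHarmonicCurvature g)
    (hn : 3 ≤ n) {U : Set M} (hU : IsOpen U) (hD : IsDFlatOn g f U) : IsBachFlatOn g U := by
  intro φ hφ u hu huU
  refine (isStaticOn_chart hst hh hφ).bach_eq_zero hn
    (φ.symm.isOpen_inter_preimage hU) (W := φ.target ∩ φ.symm ⁻¹' U) Set.inter_subset_left
    (fun v hv => hD φ hφ v hv.1 hv.2) ⟨hu, huU⟩ fun h0 => ?_
  exact (mfderiv_ne_zero_iff hφ hst.1 hu).1 (hst.mfderiv_ne_zero hh h0)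

end Charts

/-- The chart of the warped product is a chart around `p` composed with the coordinates adapted to
`f`. -/
lemma isWarpedProductEinsteinNear {m : ℕ} {M : Type*} [TopologicalSpace M]
    [ChartedSpace (Coord (m + 1)) M] [IsManifold (𝓡 (m + 1)) ∞ M] {g : Metric (m + 1) M}
    {f : M → ℝ} (hst : IsVacuumStatic g f) (hh : HasHarmonicCurvature g) (hm : 2 ≤ m) {U : Set M}
    (hU : IsOpen U) (hD : IsDFlatOn g f U) {p : M} (hp : p ∈ U)
    (hdf : mfderiv (𝓡 (m + 1)) 𝓘(ℝ, ℝ) f p ≠ 0) : IsWarpedProductEinsteinNear g p := by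
  set φ₀ := chartAt (Coord (m + 1)) p with hφ₀
  have hat : φ₀ ∈ IsManifold.maximalAtlas (𝓡 (m + 1)) ∞ M := IsManifold.chart_mem_maximalAtlas p
  have hpt : φ₀ p ∈ φ₀.target := mem_chart_target _ p
  have hinv : φ₀.symm (φ₀ p) = p := φ₀.left_inv (mem_chart_source _ p)
  have hs := isStaticOn_chart hst hh hat
  set V := φ₀.target ∩ φ₀.symm ⁻¹' U with hVdef
  have hVt : V ⊆ φ₀.target := Set.inter_subset_left
  have hsV : IsStaticOn (coeff g φ₀) (inChart f φ₀) V :=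
    ⟨φ₀.symm.isOpen_inter_preimage hU, ⟨fun i j => (hs.metric.1 i j).mono hVt,
      fun u hu => hs.metric.2 u (hVt hu)⟩, hs.smooth.mono hVt, fun v hv => hs.hess_eq v (hVt hv),
      fun v hv => hs.div_eq v (hVt hv)⟩
  obtain ⟨k, hk⟩ := (mfderiv_ne_zero_iff hat hst.1 hpt).1 (by rwa [hinv])
  obtain ⟨e, t₀, δ, hδ, hsrc, htgt, hxe, he, he', hprop⟩ := hsV.exists_adapted
    (x₀ := φ₀ p) ⟨hpt, by rwa [Set.mem_preimage, hinv]⟩ hk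
  have htgt' := htgt.trans hVt
  have hφ := trans_symm_mem_maximalAtlas hat he he'
  have htar : (φ₀.trans e.symm).target = e.source :=
    Set.inter_eq_left.2 fun _ hx => htgt' (e.map_source hx)
  have hcoe : ∀ u ∈ e.source, ∀ i j, coeff g (φ₀.trans e.symm) u i j =
      pullCoeff e (coeff g φ₀) u i j := fun u hu => coeff_trans_symm hat htgt' he hu
  have hs2 := isStaticOn_chart hst hh hφ
  rw [htar, hsrc] at hs2
  rw [hsrc] at hprop hcoe
  have hA : IsAdaptedOn (coeff g (φ₀.trans e.symm)) (inChart f (φ₀.trans e.symm)) t₀ δ :=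
    ⟨hδ, hs2, fun u hu => (hcoe u hu 0 0).trans (hprop u hu).1,
      fun u hu a => (hcoe u hu 0 a.succ).trans ((hprop u hu).2.1 a).1,
      fun u hu => (hprop u hu).2.2.1, fun u hu => (hprop u hu).2.2.2⟩
  obtain ⟨w, γ, hw, hw0, hγ, hE, hwγ⟩ := hA.exists_warpedProduct (by lia) fun u hu =>
    hs2.isRicciQuasiEinsteinAt_of_dTensor (by lia) hu (hA.pd_zero u hu)
      (hD _ hφ u (by rwa [htar, hsrc]) (htgt (e.map_source (by rwa [hsrc]))).2)
  refine ⟨_, hφ, ⟨mem_chart_source _ p, hxe⟩, t₀ - δ, t₀ + δ, Metric.ball 0 δ, w, γ,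
    Metric.isOpen_ball, htar.trans hsrc, hw, hw0, hγ, hE, ?_⟩
  rw [htar, hsrc]
  exact fun u hu => ⟨hA.metric_zero u hu, fun i j => ⟨hA.metric_zero_succ u hu i,
    hA.metric_succ_zero hu i, hwγ u hu i j⟩⟩

end VacuumStatic

end

theorem mainTheorem5 {m : ℕ} (hm : 3 ≤ m) {M : Type*} [TopologicalSpace M] [T2Space M]
    [SecondCountableTopology M] [ConnectedSpace M] [ChartedSpace (VacuumStatic.Coord (m + 1)) M]
    [IsManifold (𝓡 (m + 1)) ∞ M] (g : VacuumStatic.Metric (m + 1) M) (f : M → ℝ)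
    (hstatic : VacuumStatic.IsVacuumStatic g f) (hharm : VacuumStatic.HasHarmonicCurvature g)
    (U : Set M) (hU : IsOpen U) (heq : VacuumStatic.RicciEigenvaluesEqualOn g f U) :
    (∀ p ∈ U, mfderiv (𝓡 (m + 1)) 𝓘(ℝ, ℝ) f p ≠ 0 →
      VacuumStatic.IsWarpedProductEinsteinNear g p) ∧
    VacuumStatic.IsDFlatOn g f U ∧ VacuumStatic.IsBachFlatOn g U := by
  have hD := VacuumStatic.isDFlatOn hstatic hharm (by lia) hU heq
  exact ⟨fun p hp hdf =>
    VacuumStatic.isWarpedProductEinsteinNear hstatic hharm (by lia) hU hD hp hdf, hD,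
    VacuumStatic.isBachFlatOn hstatic hharm (by lia) hU hD⟩
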